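/- A \emph{straight-line drawing} of $K_n$ is given by a set $P$ of $n$ points of the plane, no three of them on a line, and a $k$-edge-colouring $\chi$ assigns to each pair of points one of $k$ colours. Let $\mathrm{cr}_k(P;\chi)$ be the number of pairs of edges of the same colour that cross, let $\overline{\overline{\mathrm{cr}}}_k(K_n)=\min_{P,\chi}\mathrm{cr}_k(P;\chi)$ over all such $P$ with $|P|=n$ and all $\chi$, and let $\overline{\overline{\mathrm{cr}}}_k=\lim_{n\to\infty}\overline{\overline{\mathrm{cr}}}_k(K_n)/\binom n4$. \emph{Doubling construction.} A \emph{matching} of $P$ is a map $m:P\to P$ with $m(p)\ne p$ and $m(m(p))\ne p$ for all $p$. Given $(P,\chi,m)$, replace every $p\in P$ by its two \emph{children} $p_1,p_2$, the points of the line through $p$ and $m(p)$ at distance $\varepsilon$ from $p$, with $p_1$ further from $m(p)$ than $p_2$; here $\varepsilon>0$ is so small that no smaller positive $\varepsilon$ changes the order type. For $p\neq q$ the edge $p_iq_j$ gets the colour $\chi(pq)$. The \emph{details} at $p$ prescribe the colour of $p_1p_2$, the new partner of $p_1$ (the left child of $m(p)$, or the right child of $m(p)$, as seen from $p$, or $p_2$),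 and the new partner of $p_2$ (the left or the right child of $m(p)$). The details at a child are those of its parent, and the step is iterated; this gives $(P_t,\chi_t)$ with $|P_t|=2^t|P|$, $t\ge 0$. When the limit $$\ell(P,\chi,m,D)=\lim_{t\to\infty}\mathrm{cr}_k(P_t;\chi_t)\Big/\binom{|P_t|}{4}$$ exists and does not depend on the choices of $\varepsilon$, it is called the limit of the construction for the matching $m$ and the details $D$. \textbf{Theorem.} Let $k\in\{2,\dots,10\}$ and let $N_k,b_k$ be as in the table. $$\begin{array}{c|ccccccccc} k&2&3&4&5&6&7&8&9&10\\\hline N_k&1468394&732746&413342&264459&183248&133405&99638&78269&60922\\ b_k&0.11731413&0.06062466&0.03572151&0.02389326&0.01726050&0.01314080&0.01028335&0.00845339&0.00692671 \end{array}$$ Then the limit $\overline{\overline{\mathrm{cr}}}_k$ exists, and there are a set $P$ of $135$ points of the plane, no three on a line, a $k$-edge-colouring $\chi$ with $\mathrm{cr}_k(P;\chi)=N_k$, a matching $m$ and details $D$ such that the doubling construction can be iterated indefinitely, the limit $\ell=\ell(P,\chi,m,D)$ exists, no matching and details for the same $(P,\chi)$ give a smaller limit, and $$\overline{\overline{\mathrm{cr}}}_k\le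 \ell<b_k .$$ In particular $\overline{\overline{\mathrm{cr}}}_2<0.117315$, $\overline{\overline{\mathrm{cr}}}_3<0.060625$ and $\overline{\overline{\mathrm{cr}}}_{10}<0.0069268$. Moreover $\ell<0.11798016$ for $k=2$ (the previous bound), and $2.74\,\ell<\frac2{k^2}-\frac1{k^3}$ for every $k\in\{2,\dots,10\}$, so that the bound from the $k$-page book crossing number is improved by a factor greater than $2.74$. -/

import Mathlib

namespace ColoredCrossing

noncomputable section

/-- The Euclidean plane. -/
abbrev Plane : Type := EuclideanSpace ℝ (Fin 2)

/-- The points are pairwise distinct and no three of them lie on a line. -/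
def InGeneralPosition {ι : Type} (P : ι → Plane) : Prop :=
  Function.Injective P ∧
    ∀ a b c : ι, a ≠ b → a ≠ c → b ≠ c → ¬ Collinear ℝ {P a, P b, P c}

/-- The monochromatic crossings of the straight-line drawing of the complete graph on `ι` with
vertices placed at `P` and edges coloured by `χ`: unordered pairs of distinct edges of the same
colour whose relative interiors meet. The values of `χ` on the diagonal play no role. -/
def monoCrossings {ι : Type} {k : ℕ} (P : ι → Plane) (χ : Sym2 ι → Fin k) :
    Set (Sym2 (Sym2 ι)) :=
  {z | ∃ a b c d : ι, a ≠ b ∧ c ≠ d ∧ s(a, b) ≠ s(c, d) ∧ z = s(s(a, b), s(c, d)) ∧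
    χ s(a, b) = χ s(c, d) ∧
    (openSegment ℝ (P a) (P b) ∩ openSegment ℝ (P c) (P d)).Nonempty}

/-- The number `cr_k(P; χ)` of monochromatic crossings. -/
def monoCr {ι : Type} {k : ℕ} (P : ι → Plane) (χ : Sym2 ι → Fin k) : ℕ :=
  (monoCrossings P χ).ncard

/-- The geometric `k`-colored crossing number of the complete graph `K_n`: the minimum number of
monochromatic crossings over all straight-line drawings and all `k`-edge-colourings. -/
def geomCr (k n : ℕ) : ℕ :=
  sInf {m : ℕ | ∃ (P : Fin n → Plane) (χ : Sym2 (Fin n) → Fin k),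
    InGeneralPosition P ∧ monoCr P χ = m}

/-- `L` is the geometric `k`-colored crossing constant, that is, the limit of
`geomCr k n / (n choose 4)` as `n → ∞`. -/
def IsCrossingConstant (k : ℕ) (L : ℝ) : Prop :=
  Filter.Tendsto (fun n : ℕ => (geomCr k n : ℝ) / (n.choose 4 : ℝ)) Filter.atTop (nhds L)

/-- Twice the signed area of the triangle `p q r`; positive iff `r` lies to the left of the
line `p q` directed from `p` to `q`. -/
def orient (p q r : Plane) : ℝ :=
  (q 0 - p 0) * (r 1 - p 1) - (q 1 - p 1) * (r 0 - p 0)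

/-- Two families of points have the same order type. -/
def SameOrderType {ι : Type} (P Q : ι → Plane) : Prop :=
  ∀ a b c : ι, SignType.sign (orient (P a) (P b) (P c)) = SignType.sign (orient (Q a) (Q b) (Q c))

/-- Each vertex is matched with an incident edge, and no edge is matched twice. -/
def IsMatching {ι : Type} (m : ι → ι) : Prop :=
  ∀ p : ι, m p ≠ p ∧ m (m p) ≠ p

/-- The admitted targets of the matching edge of the first child of `p`: the left or the right
child of the partner of `p`, or the second child of `p`. -/
inductive FirstTarget : Type
  | left
  | right
  | sibling

/-- The admitted targets of the matching edge of the second child of `p`. -/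
inductive SecondTarget : Type
  | left
  | right

/-- The details at a vertex `p`: the colour of the edge between the two children of `p`, and the
matching edges of the first and of the second child. -/
structure Details (k : ℕ) : Type where
  color : Fin k
  first : FirstTarget
  second : SecondTarget

/-- A family of points with a `k`-edge-colouring, a self-map (the matching) and details. -/
structure Config (ι : Type) (k : ℕ) : Type where
  pts : ι → Plane
  col : Sym2 ι → Fin k
  mat : ι → ι
  det : ι → Details k

namespace Config

variable {ι : Type} {k : ℕ}

/-- The unit vector pointing from `p` to its partner. -/
def direction (C : Config ι k) (p : ι) : Plane :=
  ‖C.pts (C.mat p) - C.pts p‖⁻¹ • (C.pts (C.mat p) - C.pts p)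

/-- The children of `p` are the two points at distance `ε` from `p` on the line spanned by the
matching edge of `p`. The first child `(p, false)` is the one further from the partner of `p`, the
second child is `(p, true)`. -/
def childPts (C : Config ι k) (ε : ℝ) (x : ι × Bool) : Plane :=
  if x.2 then C.pts x.1 + ε • C.direction x.1 else C.pts x.1 - ε • C.direction x.1

open Classical in
/-- Edges between children of different vertices inherit the colour of the edge between the
parents; the colour of the edge between the two children of `p` is the one given by the details. -/
def childCol (C : Config ι k) : Sym2 (ι × Bool) → Fin k :=
  Sym2.lift ⟨fun x y => if x.1 = y.1 then (C.det x.1).color else C.col s(x.1, y.1), by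
    intro x y
    by_cases h : x.1 = y.1
    · simp [h]
    · have h' : y.1 ≠ x.1 := fun e => h e.symm
      simp [h, h', Sym2.eq_swap]⟩

open Classical in
/-- The child of the partner of `p` lying to the left of the matching edge of `p`, seen from
`p`. -/
def leftChild (C : Config ι k) (ε : ℝ) (p : ι) : ι × Bool :=
  if 0 < orient (C.pts p) (C.pts (C.mat p)) (C.childPts ε (C.mat p, false)) then
    (C.mat p, false) else (C.mat p, true)

/-- The other child of the partner of `p`. -/
def rightChild (C : Config ι k) (ε : ℝ) (p : ι) : ι × Bool :=
  ((C.leftChild ε p).1, !(C.leftChild ε p).2)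

/-- The matching on the children prescribed by the details. -/
def childMat (C : Config ι k) (ε : ℝ) : ι × Bool → ι × Bool
  | (p, false) =>
    match (C.det p).first with
    | .left => C.leftChild ε p
    | .right => C.rightChild ε p
    | .sibling => (p, true)
  | (p, true) =>
    match (C.det p).second with
    | .left => C.leftChild ε p
    | .right => C.rightChild ε p

/-- One step of the doubling construction; children inherit the details of their parent. -/
def double (C : Config ι k) (ε : ℝ) : Config (ι × Bool) k where
  pts := C.childPts ε
  col := C.childCol
  mat := C.childMat ε
  det := fun x => C.det x.1

end Config

/-- The vertices after `t` doubling steps. -/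
def Level (ι : Type) : ℕ → Type
  | 0 => ι
  | t + 1 => Level ι t × Bool

/-- The result of `t` doubling steps, where step number `i` uses the distance `ε i`. -/
def Config.iter {ι : Type} {k : ℕ} (C : Config ι k) (ε : ℕ → ℝ) : (t : ℕ) → Config (Level ι t) k
  | 0 => C
  | t + 1 => (Config.iter C ε t).double (ε t)

/-- In every step, `ε` is positive and so small that no smaller positive distance changes the order
type of the doubled point set. -/
def Config.SmallEnough {ι : Type} {k : ℕ} (C : Config ι k) (ε : ℕ → ℝ) : Prop :=
  ∀ t : ℕ, 0 < ε t ∧ ∀ δ : ℝ, 0 < δ → δ ≤ ε t →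
    SameOrderType ((C.iter ε t).childPts δ) ((C.iter ε t).childPts (ε t))

/-- The iterated doubling construction can be carried out from `C`, and however the sufficiently
small distances are chosen, the number of monochromatic crossings divided by the number of
quadruples of points tends to `l`. -/
def Config.HasDoublingLimit {ι : Type} {k : ℕ} (C : Config ι k) (l : ℝ) : Prop :=
  (∃ ε : ℕ → ℝ, C.SmallEnough ε) ∧
  ∀ ε : ℕ → ℝ, C.SmallEnough ε →
    Filter.Tendsto
      (fun t : ℕ => (monoCr (C.iter ε t).pts (C.iter ε t).col : ℝ) /
        ((Nat.card (Level ι t)).choose 4 : ℝ))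
      Filter.atTop (nhds l)

/-- Among all matchings and all details for the coloured point set of `C`, those of `C` give the
smallest limit `l`. -/
def Config.IsOptimal {ι : Type} {k : ℕ} (C : Config ι k) (l : ℝ) : Prop :=
  ∀ (m : ι → ι) (D : ι → Details k), IsMatching m →
    ∀ l' : ℝ, Config.HasDoublingLimit { C with mat := m, det := D } l' → l ≤ l'

end

end ColoredCrossing

namespace ColoredCrossing

/-! ### Orientations and crossings of segments -/

/-! Whether two edges cross depends only on orientations of triples, so monochromatic crossings are
counted through ordered quadruples, eight for each crossing (`card_crossQuads`). Deleting a vertex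
of an optimal drawing and averaging over the vertex shows that `geomCr k n / (n choose 4)` is
nondecreasing from `n = 4` on. Hence the crossing constant exists and is at most the limit of the
ratios along any sequence of ever larger drawings, in particular along a doubling construction
(`exists_isCrossingConstant_le`).

For small distances all orientations of the doubled set are forced by the old orientations and the
matching (`Config.CanonicalSigns`). A crossing of the doubled drawing is then of one of two kinds.
Either its four ends have different parents, and it is one of the `2 ^ 4` copies of an old crossing;
or its two edges start at the two children of a common vertex `p`. In the second case the other two
ends lie on the same side of the matching line of `p` and are joined to `p` in the same colour, and
only one of the two ways of attaching them to the children gives a crossing. So `cr'` lies between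
`16 cr` and `16 cr` plus half the number of such ordered pairs.

The second term depends only on how many edges of each colour leave `p` on either side of its
matching line. When both children are always matched with the left child of the partner and the
sibling edge takes the colour of the matching edge (`Config.LeftDetails`), these side counts obey an
affine recursion: they double, and the count of the matching colour gains a small constant. The
recursion can be summed in closed form. There is an explicit quadratic function of the side counts,
`Config.vertexPotential`, for which crossings plus total potential grow by a factor of at most 16 in
each step (`Config.Regular.potential_double`). As the potential is nonnegative, `cr_t / 16 ^ t` is
nondecreasing and bounded by `cr_0 + potential`, so it converges, and the limit of the construction
is at most `24 (cr_0 + potential) / n ^ 4`. The order types do not depend on the admissible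
distances chosen, so neither does the limit.

Optimality needs no search. A finite point set has finitely many matchings and details, so among
those that possess a limit some pair attains the smallest one, and that is no larger than the limit
of an explicitly given pair. For each `k` it therefore suffices to exhibit points, a colouring and
one matching, and to evaluate three finite quantities: general position, the number of crossings,
and the potential.

These evaluations are left to the kernel. To make them feasible, subsets and relations on the 135
points are stored in the binary digits of single natural numbers, so that one multiplication or bit
operation acts on all points or all pairs at once; the lemmas on packed arithmetic prove that these
operations compute what is wanted. -/

theorem orient_rotate (a b c : Plane) : orient b c a = orient a b c := by
  unfold orient; ring

theorem orient_swap_left (a b c : Plane) : orient b a c = -orient a b c := by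
  unfold orient; ring

theorem orient_swap_right (a b c : Plane) : orient a c b = -orient a b c := by
  unfold orient; ring

theorem collinear_iff_orient_eq_zero (a b c : Plane) (hab : a ≠ b) :
    Collinear ℝ {a, b, c} ↔ orient a b c = 0 := by
  rw [collinear_iff_of_mem (p₀ := a) (by simp)]
  constructor
  · rintro ⟨v, h⟩
    obtain ⟨s, hs⟩ := h b (by simp)
    obtain ⟨t, ht⟩ := h c (by simp)
    subst hs ht
    simp [orient]
    ring
  · intro h
    refine ⟨b - a, ?_⟩
    -- Since `a ≠ b`, some coordinate of `b - a` is nonzero; the parameter of the third point along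
    -- the line is solved from that coordinate.
    have hne : b 0 - a 0 ≠ 0 ∨ b 1 - a 1 ≠ 0 := by
      by_contra! hc
      apply hab
      ext i
      fin_cases i
      · simpa using (sub_eq_zero.mp hc.1).symm
      · simpa using (sub_eq_zero.mp hc.2).symm
    simp only [orient] at h
    intro p hp
    simp only [Set.mem_insert_iff, Set.mem_singleton_iff] at hp
    rcases hp with rfl | rfl | rfl
    · exact ⟨0, by simp⟩
    · exact ⟨1, by simp⟩
    · rcases hne with h0 | h1
      · refine ⟨(p 0 - a 0) / (b 0 - a 0), ?_⟩
        ext i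
        fin_cases i
        · simp; field_simp; ring
        · simp; field_simp; linarith
      · refine ⟨(p 1 - a 1) / (b 1 - a 1), ?_⟩
        ext i
        fin_cases i
        · simp; field_simp; linarith
        · simp; field_simp; ring

/-- Sign of the orientation of a triple of a family of points. -/
noncomputable def sg {ι : Type} (P : ι → Plane) (a b c : ι) : SignType :=
  SignType.sign (orient (P a) (P b) (P c))

section sg

variable {ι : Type} (P : ι → Plane)

theorem sg_rotate (a b c : ι) : sg P b c a = sg P a b c := by
  simp only [sg, orient_rotate (P a) (P b) (P c)]

theorem sg_swap_left (a b c : ι) : sg P b a c = -sg P a b c := by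
  simp only [sg, orient_swap_left (P a) (P b) (P c), Left.sign_neg]

theorem sg_swap_right (a b c : ι) : sg P a c b = -sg P a b c := by
  simp only [sg, orient_swap_right (P a) (P b) (P c), Left.sign_neg]

theorem sg_self_left (a b : ι) : sg P a a b = 0 := by simp [sg, orient]

theorem sg_self_right (a b : ι) : sg P a b b = 0 := by simp [sg, orient, mul_comm]

theorem sg_self_outer (a b : ι) : sg P a b a = 0 := by simp [sg, orient]

end sg

/-- The edges `a b` and `c d` cross, expressed through orientations. -/
def Crosses {ι : Type} (P : ι → Plane) (a b c d : ι) : Prop :=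
  sg P a b c * sg P a b d = -1 ∧ sg P c d a * sg P c d b = -1

theorem InGeneralPosition.sg_ne_zero {ι : Type} {P : ι → Plane} (h : InGeneralPosition P)
    {a b c : ι} (hab : a ≠ b) (hac : a ≠ c) (hbc : b ≠ c) : sg P a b c ≠ 0 := by
  intro h0
  refine h.2 a b c hab hac hbc ?_
  rw [collinear_iff_orient_eq_zero _ _ _ (h.1.ne hab)]
  exact sign_eq_zero_iff.mp h0

/-- Two coinciding points make every triple containing both degenerate, so injectivity follows as
soon as a third index is available. This is what `h3` supplies. -/
theorem inGeneralPosition_of_sg {ι : Type} {P : ι → Plane}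
    (h : ∀ a b c : ι, a ≠ b → a ≠ c → b ≠ c → sg P a b c ≠ 0)
    (h3 : ∀ a b : ι, a ≠ b → ∃ c, c ≠ a ∧ c ≠ b) : InGeneralPosition P := by
  have hinj : Function.Injective P := by
    intro a b hab
    by_contra hne
    obtain ⟨c, hca, hcb⟩ := h3 a b hne
    apply h a b c hne hca.symm hcb.symm
    simp [sg, orient, hab]
  refine ⟨hinj, fun a b c hab hac hbc hcol => h a b c hab hac hbc ?_⟩
  rw [collinear_iff_orient_eq_zero _ _ _ (hinj.ne hab)] at hcol
  simp [sg, hcol]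

theorem sign_mul_sign_eq_neg_one {x y : ℝ} :
    SignType.sign x * SignType.sign y = -1 ↔ x * y < 0 := by
  rw [← sign_mul, sign_eq_neg_one_iff]

/-- The line `c d` cuts the segment `a b` in the ratio of the signed areas of `c d a` and `c d b`,
and symmetrically for the other segment. Opposite signs make the ratios positive, so both points are
interior to their segments, and they coincide. -/
theorem openSegment_inter_of_orient {a b c d : Plane} (h1 : orient a b c * orient a b d < 0)
    (h2 : orient c d a * orient c d b < 0) :
    (openSegment ℝ a b ∩ openSegment ℝ c d).Nonempty := by
  have key : ∀ x y : ℝ, x * y < 0 → 0 < x / (x - y) ∧ 0 < -y / (x - y) ∧ x - y ≠ 0 := by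
    intro x y h
    rcases mul_neg_iff.mp h with ⟨hx, hy⟩ | ⟨hx, hy⟩
    · exact ⟨div_pos hx (by linarith), div_pos (by linarith) (by linarith), by
        intro h; linarith⟩
    · exact ⟨div_pos_of_neg_of_neg hx (by linarith),
        div_pos_of_neg_of_neg (by linarith) (by linarith), by intro h; linarith⟩
  obtain ⟨p1, p2, p3⟩ := key _ _ h1
  obtain ⟨q1, q2, q3⟩ := key _ _ h2
  refine ⟨(-orient c d b / (orient c d a - orient c d b)) • a +
    (orient c d a / (orient c d a - orient c d b)) • b, ⟨_, _, q2, q1, ?_, rfl⟩,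
    ⟨_, _, p2, p1, ?_, ?_⟩⟩
  · field_simp; ring
  · field_simp; ring
  · have e : orient a b c - orient a b d = -(orient c d a - orient c d b) := by
      unfold orient; ring
    -- The two barycentric descriptions of the intersection point agree: this is the linear relation
    -- between four points of the plane, whose coefficients are signed areas.
    have id : ∀ i, -orient a b d * c i + orient a b c * d i =
        -(-orient c d b * a i + orient c d a * b i) := by
      intro i
      fin_cases i <;> simp [orient] <;> ring
    ext i
    have hi := id i
    rw [e]
    simp only [PiLp.add_apply, PiLp.smul_apply, smul_eq_mul]
    rw [div_mul_eq_mul_div, div_mul_eq_mul_div, div_mul_eq_mul_div, div_mul_eq_mul_div,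
      ← add_div, ← add_div, hi, neg_div_neg_eq]

/-- `orient a b` is affine in its last argument and vanishes on the line `a b`. At the common point
it is a combination of its values at `c` and `d` with positive weights, so these values have
opposite signs once one of them is nonzero. -/
theorem orient_mul_neg_of_openSegment_inter {a b c d : Plane} (hc : orient a b c ≠ 0)
    (h : (openSegment ℝ a b ∩ openSegment ℝ c d).Nonempty) :
    orient a b c * orient a b d < 0 := by
  obtain ⟨x, ⟨s, t, hs, ht, hst, rfl⟩, ⟨u, v, hu, hv, huv, hx⟩⟩ := h
  have h0 := congrArg (fun z : Plane => z 0) hx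
  have h1 := congrArg (fun z : Plane => z 1) hx
  simp at h0 h1
  have hs' : s = 1 - t := by linarith
  have hu' : u = 1 - v := by linarith
  have e : u * orient a b c + v * orient a b d = 0 := by
    subst hs' hu'
    unfold orient
    linear_combination (b 0 - a 0) * h1 - (b 1 - a 1) * h0
  have e2 : orient a b d = -(u / v) * orient a b c := by
    field_simp; linarith
  rw [e2]
  have : 0 < u / v := div_pos hu hv
  have h3 : 0 < orient a b c ^ 2 := by positivity
  nlinarith

theorem crosses_iff {ι : Type} {P : ι → Plane} (h : InGeneralPosition P) {a b c d : ι}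
    (hab : a ≠ b) (hcd : c ≠ d) (hne : s(a, b) ≠ s(c, d)) :
    (openSegment ℝ (P a) (P b) ∩ openSegment ℝ (P c) (P d)).Nonempty ↔ Crosses P a b c d := by
  constructor
  · intro hx
    have hx' : (openSegment ℝ (P c) (P d) ∩ openSegment ℝ (P a) (P b)).Nonempty := by
      rwa [Set.inter_comm]
    have key : ∀ {a b c d : ι}, a ≠ b → c ≠ d → s(a, b) ≠ s(c, d) →
        (openSegment ℝ (P a) (P b) ∩ openSegment ℝ (P c) (P d)).Nonempty →
        orient (P a) (P b) (P c) * orient (P a) (P b) (P d) < 0 := by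
      intro a b c d hab hcd hne hx
      -- Distinct edges share at most one end, so `c` or `d` is not an end of `a b`; by general
      -- position that point is off the line `a b`.
      by_cases hc : c ≠ a ∧ c ≠ b
      · exact orient_mul_neg_of_openSegment_inter
          (fun h0 => h.sg_ne_zero hab hc.1.symm hc.2.symm (by simp [sg, h0])) hx
      · have hd : d ≠ a ∧ d ≠ b := by
          constructor
          · rintro rfl
            rcases not_and_or.mp hc with hc | hc
            · exact hcd (not_not.mp hc)
            · rw [not_not.mp hc] at hne
              exact hne Sym2.eq_swap
          · rintro rfl
            rcases not_and_or.mp hc with hc | hc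
            · rw [not_not.mp hc] at hne
              exact hne rfl
            · exact hcd (not_not.mp hc)
        rw [mul_comm]
        refine orient_mul_neg_of_openSegment_inter
          (fun h0 => h.sg_ne_zero hab hd.1.symm hd.2.symm (by simp [sg, h0])) ?_
        rwa [openSegment_symm ℝ (P d)]
    exact ⟨sign_mul_sign_eq_neg_one.mpr (key hab hcd hne hx),
      sign_mul_sign_eq_neg_one.mpr (key hcd hab hne.symm hx')⟩
  · rintro ⟨h1, h2⟩
    exact openSegment_inter_of_orient (sign_mul_sign_eq_neg_one.mp h1)
      (sign_mul_sign_eq_neg_one.mp h2)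

section crosses

variable {ι : Type} {P : ι → Plane} {a b c d : ι}

theorem Crosses.ne (h : Crosses P a b c d) :
    a ≠ b ∧ a ≠ c ∧ a ≠ d ∧ b ≠ c ∧ b ≠ d ∧ c ≠ d := by
  refine ⟨?_, ?_, ?_, ?_, ?_, ?_⟩ <;> rintro rfl <;>
    simp [Crosses, sg_self_left, sg_self_right, sg_self_outer] at h

theorem crosses_swap_left : Crosses P b a c d ↔ Crosses P a b c d := by
  simp only [Crosses, sg_swap_left P a b, neg_mul_neg, mul_comm (sg P c d b)]

theorem crosses_swap_right : Crosses P a b d c ↔ Crosses P a b c d := by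
  simp only [Crosses, sg_swap_left P c d, neg_mul_neg, mul_comm (sg P a b d)]

theorem crosses_symm : Crosses P c d a b ↔ Crosses P a b c d := by
  simp only [Crosses, and_comm]

end crosses

/-! ### Counting crossings by ordered quadruples -/

open Classical in
/-- The ordered quadruples `(a, b, c, d)` such that the edges `a b` and `c d` cross and have the
same colour. -/
noncomputable def crossQuads {ι : Type} [Fintype ι] {k : ℕ} (P : ι → Plane)
    (χ : Sym2 ι → Fin k) : Finset (ι × ι × ι × ι) :=
  Finset.univ.filter fun t => Crosses P t.1 t.2.1 t.2.2.1 t.2.2.2 ∧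
    χ s(t.1, t.2.1) = χ s(t.2.2.1, t.2.2.2)

theorem mem_crossQuads {ι : Type} [Fintype ι] {k : ℕ} {P : ι → Plane} {χ : Sym2 ι → Fin k}
    {a b c d : ι} : (a, b, c, d) ∈ crossQuads P χ ↔
      Crosses P a b c d ∧ χ s(a, b) = χ s(c, d) := by
  simp [crossQuads]

theorem crossQuads_swap_left {ι : Type} [Fintype ι] {k : ℕ} {P : ι → Plane}
    {χ : Sym2 ι → Fin k} {a b c d : ι} :
    (b, a, c, d) ∈ crossQuads P χ ↔ (a, b, c, d) ∈ crossQuads P χ := by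
  rw [mem_crossQuads, mem_crossQuads, crosses_swap_left, Sym2.eq_swap]

theorem crossQuads_swap_right {ι : Type} [Fintype ι] {k : ℕ} {P : ι → Plane}
    {χ : Sym2 ι → Fin k} {a b c d : ι} :
    (a, b, d, c) ∈ crossQuads P χ ↔ (a, b, c, d) ∈ crossQuads P χ := by
  rw [mem_crossQuads, mem_crossQuads, crosses_swap_right, Sym2.eq_swap (a := d)]

theorem crossQuads_symm {ι : Type} [Fintype ι] {k : ℕ} {P : ι → Plane}
    {χ : Sym2 ι → Fin k} {a b c d : ι} :
    (c, d, a, b) ∈ crossQuads P χ ↔ (a, b, c, d) ∈ crossQuads P χ := by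
  rw [mem_crossQuads, mem_crossQuads, crosses_symm, eq_comm]

/-- An unordered pair of crossing edges comes from eight quadruples: each edge can be reversed and
the two edges can be exchanged. These are different because the four ends of a crossing are
distinct. -/
theorem card_crossQuads {ι : Type} [Fintype ι] {k : ℕ} {P : ι → Plane}
    (h : InGeneralPosition P) (χ : Sym2 ι → Fin k) :
    (crossQuads P χ).card = 8 * monoCr P χ := by
  classical
  let φ : ι × ι × ι × ι → Sym2 (Sym2 ι) := fun t => s(s(t.1, t.2.1), s(t.2.2.1, t.2.2.2))
  have himg : monoCrossings P χ = ((crossQuads P χ).image φ : Finset (Sym2 (Sym2 ι))) := by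
    ext z
    simp only [monoCrossings, Set.mem_ofPred_eq, Finset.coe_image, Set.mem_image, Finset.mem_coe,
      Prod.exists]
    constructor
    · rintro ⟨a, b, c, d, hab, hcd, hne, rfl, hχ, hx⟩
      exact ⟨a, b, c, d, mem_crossQuads.mpr ⟨(crosses_iff h hab hcd hne).mp hx, hχ⟩, rfl⟩
    · rintro ⟨a, b, c, d, hm, rfl⟩
      obtain ⟨hx, hχ⟩ := mem_crossQuads.mp hm
      obtain ⟨h1, h2, h3, h4, h5, h6⟩ := hx.ne
      have hne : s(a, b) ≠ s(c, d) := by simp [h2, h3]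
      exact ⟨a, b, c, d, h1, h6, hne, rfl, hχ, (crosses_iff h h1 h6 hne).mpr hx⟩
  rw [monoCr, himg, Set.ncard_coe_finset, Finset.card_eq_sum_card_image φ,
    Finset.sum_const_nat (m := 8), mul_comm]
  intro z hz
  obtain ⟨⟨a, b, c, d⟩, hm, rfl⟩ := Finset.mem_image.mp hz
  obtain ⟨h1, h2, h3, h4, h5, h6⟩ := (mem_crossQuads.mp hm).1.ne
  have : (crossQuads P χ).filter (fun t => φ t = φ (a, b, c, d)) =
      {(a, b, c, d), (b, a, c, d), (a, b, d, c), (b, a, d, c),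
        (c, d, a, b), (c, d, b, a), (d, c, a, b), (d, c, b, a)} := by
    ext ⟨x, y, z, w⟩
    simp only [Finset.mem_filter, Finset.mem_insert, Finset.mem_singleton, φ, Sym2.eq_iff,
      Prod.mk.injEq]
    constructor
    · rintro ⟨-, ⟨⟨rfl, rfl⟩ | ⟨rfl, rfl⟩, ⟨rfl, rfl⟩ | ⟨rfl, rfl⟩⟩ |
        ⟨⟨rfl, rfl⟩ | ⟨rfl, rfl⟩, ⟨rfl, rfl⟩ | ⟨rfl, rfl⟩⟩⟩ <;>
        simp only [and_self, true_or, or_true]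
    · have e1 := crossQuads_swap_left.mpr hm
      have e2 := crossQuads_symm.mpr hm
      have e3 := crossQuads_swap_left.mpr e2
      rintro (⟨rfl, rfl, rfl, rfl⟩ | ⟨rfl, rfl, rfl, rfl⟩ | ⟨rfl, rfl, rfl, rfl⟩ |
        ⟨rfl, rfl, rfl, rfl⟩ | ⟨rfl, rfl, rfl, rfl⟩ | ⟨rfl, rfl, rfl, rfl⟩ |
        ⟨rfl, rfl, rfl, rfl⟩ | ⟨rfl, rfl, rfl, rfl⟩)
      · exact ⟨hm, by simp⟩
      · exact ⟨e1, by simp⟩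
      · exact ⟨crossQuads_swap_right.mpr hm, by simp⟩
      · exact ⟨crossQuads_swap_right.mpr e1, by simp⟩
      · exact ⟨e2, by simp⟩
      · exact ⟨crossQuads_swap_right.mpr e2, by simp⟩
      · exact ⟨e3, by simp⟩
      · exact ⟨crossQuads_swap_right.mpr e3, by simp⟩
  rw [this]
  simp [h1, h2, h3, h4, h5, h6, h1.symm, h2.symm, h3.symm, h4.symm, h5.symm, h6.symm]

/-! ### Restriction to subfamilies and relabelling -/

theorem crosses_comp {ι κ : Type} {P : ι → Plane} {f : κ → ι} {a b c d : κ} :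
    Crosses (P ∘ f) a b c d ↔ Crosses P (f a) (f b) (f c) (f d) := Iff.rfl

theorem InGeneralPosition.comp {ι κ : Type} {P : ι → Plane} (h : InGeneralPosition P) {f : κ → ι}
    (hf : Function.Injective f) : InGeneralPosition (P ∘ f) :=
  ⟨h.1.comp hf, fun _ _ _ hab hac hbc => h.2 _ _ _ (hf.ne hab) (hf.ne hac) (hf.ne hbc)⟩

/-- The quadruples of a subfamily are the quadruples of the family with all entries in the
range. -/
theorem map_crossQuads_comp {ι κ : Type} [Fintype ι] [Fintype κ] [DecidableEq ι] {k : ℕ}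
    (P : ι → Plane) (χ : Sym2 ι → Fin k) (f : κ → ι) :
    (crossQuads (P ∘ f) (χ ∘ Sym2.map f)).image (Prod.map f (Prod.map f (Prod.map f f))) =
      (crossQuads P χ).filter fun t => t.1 ∈ Set.range f ∧ t.2.1 ∈ Set.range f ∧
        t.2.2.1 ∈ Set.range f ∧ t.2.2.2 ∈ Set.range f := by
  classical
  ext ⟨x, y, z, w⟩
  simp only [Finset.mem_image, Prod.exists, Finset.mem_filter, Prod.map_apply, Prod.mk.injEq]
  constructor
  · rintro ⟨a, b, c, d, hm, rfl, rfl, rfl, rfl⟩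
    refine ⟨?_, ⟨a, rfl⟩, ⟨b, rfl⟩, ⟨c, rfl⟩, ⟨d, rfl⟩⟩
    simpa [mem_crossQuads, crosses_comp] using hm
  · rintro ⟨hm, ⟨a, rfl⟩, ⟨b, rfl⟩, ⟨c, rfl⟩, ⟨d, rfl⟩⟩
    refine ⟨a, b, c, d, ?_, rfl, rfl, rfl, rfl⟩
    simpa [mem_crossQuads, crosses_comp] using hm

theorem card_crossQuads_comp {ι κ : Type} [Fintype ι] [Fintype κ] [DecidableEq ι] {k : ℕ}
    (P : ι → Plane) (χ : Sym2 ι → Fin k) {f : κ → ι} (hf : Function.Injective f) :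
    (crossQuads (P ∘ f) (χ ∘ Sym2.map f)).card =
      ((crossQuads P χ).filter fun t => t.1 ∈ Set.range f ∧ t.2.1 ∈ Set.range f ∧
        t.2.2.1 ∈ Set.range f ∧ t.2.2.2 ∈ Set.range f).card := by
  rw [← map_crossQuads_comp, Finset.card_image_of_injective]
  exact hf.prodMap (hf.prodMap (hf.prodMap hf))

theorem monoCr_comp_equiv {ι κ : Type} [Fintype ι] [Fintype κ] {k : ℕ} {P : ι → Plane}
    (h : InGeneralPosition P) (χ : Sym2 ι → Fin k) (e : κ ≃ ι) :
    monoCr (P ∘ e) (χ ∘ Sym2.map e) = monoCr P χ := by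
  classical
  have h1 := card_crossQuads_comp P χ e.injective
  rw [Finset.filter_true_of_mem (by simp), card_crossQuads h,
    card_crossQuads (h.comp e.injective)] at h1
  omega

/-! ### The crossing constant -/

/-- The points `(i, i²)` are in general position. -/
theorem exists_inGeneralPosition (n : ℕ) : ∃ P : Fin n → Plane, InGeneralPosition P := by
  refine ⟨fun i => !₂[(i : ℝ), (i : ℝ) ^ 2], ?_, ?_⟩
  · intro i j hij
    have := congrArg (fun z : Plane => z 0) hij
    simpa [Fin.ext_iff] using this
  · intro a b c hab hac hbc
    have hab' : (a : ℝ) ≠ b := by simpa [Fin.ext_iff] using hab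
    have hac' : (a : ℝ) ≠ c := by simpa [Fin.ext_iff] using hac
    have hbc' : (b : ℝ) ≠ c := by simpa [Fin.ext_iff] using hbc
    rw [collinear_iff_orient_eq_zero]
    · have : orient !₂[(a : ℝ), (a : ℝ) ^ 2] !₂[(b : ℝ), (b : ℝ) ^ 2] !₂[(c : ℝ), (c : ℝ) ^ 2] =
          (b - a) * (c - a) * (c - b) := by
        simp [orient]; ring
      rw [this]
      exact mul_ne_zero (mul_ne_zero (sub_ne_zero.mpr hab'.symm) (sub_ne_zero.mpr hac'.symm))
        (sub_ne_zero.mpr hbc'.symm)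
    · intro h
      exact hab' (by simpa using congrArg (fun z : Plane => z 0) h)

theorem geomCr_le {k n : ℕ} {P : Fin n → Plane} (h : InGeneralPosition P)
    (χ : Sym2 (Fin n) → Fin k) : geomCr k n ≤ monoCr P χ :=
  Nat.sInf_le ⟨P, χ, h, rfl⟩

theorem geomCr_le_of_card {k n : ℕ} {ι : Type} [Fintype ι] {P : ι → Plane}
    (h : InGeneralPosition P) (χ : Sym2 ι → Fin k) (hn : Fintype.card ι = n) :
    geomCr k n ≤ monoCr P χ := by
  let e : Fin n ≃ ι := (Fintype.equivFinOfCardEq hn).symm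
  rw [← monoCr_comp_equiv h χ e]
  exact geomCr_le (h.comp e.injective) _

/-- The infimum defining `geomCr` is attained only because some drawing exists; a colouring requires
at least one colour. -/
theorem exists_monoCr_eq_geomCr {k : ℕ} (hk : 0 < k) (n : ℕ) :
    ∃ (P : Fin n → Plane) (χ : Sym2 (Fin n) → Fin k),
      InGeneralPosition P ∧ monoCr P χ = geomCr k n := by
  obtain ⟨P, hP⟩ := exists_inGeneralPosition n
  exact Nat.sInf_mem (s := {m : ℕ | ∃ (P : Fin n → Plane) (χ : Sym2 (Fin n) → Fin k),
    InGeneralPosition P ∧ monoCr P χ = m}) ⟨_, P, fun _ => ⟨0, hk⟩, hP, rfl⟩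

/-- Averaging over the deletion of a vertex. -/
theorem succ_mul_geomCr_le {k : ℕ} (hk : 0 < k) (n : ℕ) :
    (n + 1) * geomCr k n + 3 * geomCr k (n + 1) ≤ n * geomCr k (n + 1) := by
  classical
  obtain ⟨P, χ, hP, hm⟩ := exists_monoCr_eq_geomCr hk (n + 1)
  have hle : ∀ v : Fin (n + 1), 8 * geomCr k n ≤
      ((crossQuads P χ).filter fun t => t.1 ≠ v ∧ t.2.1 ≠ v ∧ t.2.2.1 ≠ v ∧ t.2.2.2 ≠ v).card := by
    intro v
    have hinj : Function.Injective v.succAbove := Fin.succAbove_right_injective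
    have h1 := card_crossQuads_comp P χ hinj
    rw [card_crossQuads (hP.comp hinj)] at h1
    simp only [Fin.range_succAbove, Set.mem_compl_iff, Set.mem_singleton_iff] at h1
    exact (Nat.mul_le_mul_left 8 (geomCr_le (hP.comp hinj) _)).trans h1.le
  have hsum := Finset.sum_le_sum fun v (_ : v ∈ Finset.univ) => hle v
  simp only [Finset.sum_const, Finset.card_univ, Fintype.card_fin, smul_eq_mul,
    Finset.card_filter] at hsum
  rw [Finset.sum_comm] at hsum
  -- A crossing has four distinct ends, so it survives the deletion of `n + 1 - 4` of the `n + 1`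
  -- vertices. Adding 3 on the left avoids truncated subtraction.
  have hin : ∀ t ∈ crossQuads P χ,
      (∑ v : Fin (n + 1), if t.1 ≠ v ∧ t.2.1 ≠ v ∧ t.2.2.1 ≠ v ∧ t.2.2.2 ≠ v then 1 else 0) + 3
        = n := by
    rintro ⟨a, b, c, d⟩ ht
    obtain ⟨h1, h2, h3, h4, h5, h6⟩ := (mem_crossQuads.mp ht).1.ne
    rw [← Finset.card_filter]
    have e : (Finset.univ.filter fun v : Fin (n + 1) => a ≠ v ∧ b ≠ v ∧ c ≠ v ∧ d ≠ v) =
        ({a, b, c, d} : Finset (Fin (n + 1)))ᶜ := by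
      ext v
      simp [eq_comm]
    have hc : ({a, b, c, d} : Finset (Fin (n + 1))).card = 4 := by
      simp [h1, h2, h3, h4, h5, h6]
    have := Finset.card_add_card_compl ({a, b, c, d} : Finset (Fin (n + 1)))
    simp only [Fintype.card_fin] at this
    rw [e]
    omega
  have h3 : (∑ t ∈ crossQuads P χ, ((∑ v : Fin (n + 1),
      if t.1 ≠ v ∧ t.2.1 ≠ v ∧ t.2.2.1 ≠ v ∧ t.2.2.2 ≠ v then 1 else 0) + 3)) =
      8 * geomCr k (n + 1) * n := by
    rw [Finset.sum_const_nat hin, card_crossQuads hP, hm]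
  rw [Finset.sum_add_distrib, Finset.sum_const, smul_eq_mul, card_crossQuads hP, hm] at h3
  nlinarith

/-- This is the averaging inequality divided by binomial coefficients, through `(n + 1 - 4) * C(n +
1, 4) = (n + 1) * C(n, 4)`. For `n ≥ 4` all factors that are divided by are positive. -/
theorem crossingRatio_le_succ {k : ℕ} (hk : 0 < k) {n : ℕ} (hn : 4 ≤ n) :
    (geomCr k n : ℝ) / (n.choose 4 : ℝ) ≤ (geomCr k (n + 1) : ℝ) / ((n + 1).choose 4 : ℝ) := by
  have h1 : (0 : ℝ) < n.choose 4 := by exact_mod_cast Nat.choose_pos hn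
  have h2 : (0 : ℝ) < (n + 1).choose 4 := by exact_mod_cast Nat.choose_pos (by omega)
  rw [div_le_div_iff₀ h1 h2]
  have h3 : ((n + 1).choose 4 : ℝ) * ((n : ℝ) + 1 - 4) = n.choose 4 * (n + 1) := by
    have := Nat.choose_mul_succ_eq n 4
    have e : ((n + 1 - 4 : ℕ) : ℝ) = (n : ℝ) + 1 - 4 := by
      rw [Nat.cast_sub (by omega)]; push_cast; ring
    rw [← e]
    exact_mod_cast this.symm
  have h4 : ((n : ℝ) + 1) * geomCr k n + 3 * geomCr k (n + 1) ≤ n * geomCr k (n + 1) := by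
    exact_mod_cast succ_mul_geomCr_le hk n
  have h5 : (0 : ℝ) < (n : ℝ) + 1 - 4 := by
    have : (4 : ℝ) ≤ n := by exact_mod_cast hn
    linarith
  have h6 : ((n + 1).choose 4 : ℝ) = n.choose 4 * (n + 1) / ((n : ℝ) + 1 - 4) := by
    field_simp; linarith
  rw [h6, mul_div_assoc', div_le_iff₀ h5]
  nlinarith [mul_le_mul_of_nonneg_left h4 h1.le]

/-- If arbitrarily large drawings have crossing ratios tending to `l`, the crossing constant
exists and is at most `l`. -/
theorem exists_isCrossingConstant_le {k : ℕ} (hk : 0 < k) {l : ℝ} {N cr : ℕ → ℕ}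
    (hN : Filter.Tendsto N Filter.atTop Filter.atTop) (hcr : ∀ t, geomCr k (N t) ≤ cr t)
    (hl : Filter.Tendsto (fun t => (cr t : ℝ) / ((N t).choose 4 : ℝ)) Filter.atTop (nhds l)) :
    ∃ L, IsCrossingConstant k L ∧ L ≤ l := by
  let r : ℕ → ℝ := fun n => (geomCr k n : ℝ) / (n.choose 4 : ℝ)
  -- The shift by 4 skips the values of `n` for which the binomial coefficient vanishes.
  have hmono : Monotone fun n => r (n + 4) :=
    monotone_nat_of_le_succ fun n => crossingRatio_le_succ hk (by omega)
  have hle : ∀ n, r (n + 4) ≤ l := by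
    intro n
    -- By monotonicity a fixed ratio is at most the ratio at `N t` for all large `t`, hence at most
    -- the ratio of the given drawings, and so at most their limit.
    refine ge_of_tendsto hl ?_
    filter_upwards [hN.eventually_ge_atTop (n + 4)] with t ht
    obtain ⟨j, hj⟩ : ∃ j, N t = n + j + 4 := ⟨N t - n - 4, by omega⟩
    calc r (n + 4) ≤ r (n + j + 4) := hmono (by omega)
      _ = (geomCr k (N t) : ℝ) / ((N t).choose 4 : ℝ) := by rw [hj]
      _ ≤ _ := by
        have := hcr t
        gcongr
  refine ⟨⨆ n, r (n + 4), ?_, ciSup_le hle⟩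
  have := tendsto_atTop_ciSup hmono ⟨l, by rintro _ ⟨n, rfl⟩; exact hle n⟩
  exact (Filter.tendsto_add_atTop_iff_nat 4).mp this

/-! ### Orientations of the doubled point set -/

open Filter Topology

theorem eventually_sign_eq {f : ℝ → ℝ} (hf : Continuous f) (h0 : f 0 ≠ 0) :
    ∀ᶠ δ in 𝓝[>] (0 : ℝ), SignType.sign (f δ) = SignType.sign (f 0) := by
  refine Filter.Eventually.filter_mono nhdsWithin_le_nhds ?_
  rcases lt_or_gt_of_ne h0 with h | h
  · filter_upwards [(hf.tendsto 0).eventually_lt_const h] with δ hδ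
    rw [sign_neg hδ, sign_neg h]
  · filter_upwards [(hf.tendsto 0).eventually_const_lt h] with δ hδ
    rw [sign_pos hδ, sign_pos h]

/-- Near `0` from the right the lowest nonvanishing coefficient decides the sign. -/
theorem exists_eventually_sign_quadratic (A B C : ℝ) :
    ∃ s, ∀ᶠ δ in 𝓝[>] (0 : ℝ), SignType.sign (A + B * δ + C * δ ^ 2) = s := by
  by_cases hA : A = 0
  · by_cases hB : B = 0
    · refine ⟨SignType.sign C, ?_⟩
      filter_upwards [self_mem_nhdsWithin] with δ hδ
      have hδ' : (0 : ℝ) < δ ^ 2 := pow_pos hδ 2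
      simp [hA, hB, sign_mul, sign_pos hδ']
    · refine ⟨SignType.sign B, ?_⟩
      have := eventually_sign_eq (f := fun δ => B + C * δ) (by fun_prop) (by simpa using hB)
      filter_upwards [this, self_mem_nhdsWithin] with δ h1 hδ
      have e : A + B * δ + C * δ ^ 2 = δ * (B + C * δ) := by rw [hA]; ring
      rw [e, sign_mul, sign_pos hδ, h1]
      simp
  · refine ⟨SignType.sign A, ?_⟩
    have := eventually_sign_eq (f := fun δ => A + B * δ + C * δ ^ 2) (by fun_prop)
      (by simpa using hA)
    filter_upwards [this] with δ h1
    rw [h1]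
    simp

namespace Config

variable {ι : Type} {k : ℕ} (C : Config ι k)

theorem childPts_apply (ε : ℝ) (x : ι × Bool) (i : Fin 2) :
    C.childPts ε x i =
      C.pts x.1 i + (if x.2 then C.direction x.1 i else -C.direction x.1 i) * ε := by
  unfold childPts
  split_ifs <;> simp [mul_comm, sub_eq_add_neg]

/-- Children move linearly with the distance and `orient` is quadratic in the coordinates, so each
orientation is a quadratic polynomial in the distance. -/
theorem exists_orient_childPts (x y z : ι × Bool) : ∃ A B D : ℝ, ∀ δ : ℝ,
    orient (C.childPts δ x) (C.childPts δ y) (C.childPts δ z) = A + B * δ + D * δ ^ 2 := by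
  have h : ∃ v : ι × Bool → Fin 2 → ℝ, ∀ δ w i, C.childPts δ w i = C.pts w.1 i + v w i * δ :=
    ⟨_, C.childPts_apply⟩
  obtain ⟨v, hv⟩ := h
  refine ⟨orient (C.pts x.1) (C.pts y.1) (C.pts z.1),
    (v y 0 - v x 0) * (C.pts z.1 1 - C.pts x.1 1) + (C.pts y.1 0 - C.pts x.1 0) * (v z 1 - v x 1)
      - ((v y 1 - v x 1) * (C.pts z.1 0 - C.pts x.1 0) +
        (C.pts y.1 1 - C.pts x.1 1) * (v z 0 - v x 0)),
    (v y 0 - v x 0) * (v z 1 - v x 1) - (v y 1 - v x 1) * (v z 0 - v x 0), fun δ => ?_⟩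
  simp only [orient, hv]
  ring

/-- The distance `ε` is admissible in one doubling step. -/
def Admissible (ε : ℝ) : Prop :=
  0 < ε ∧ ∀ δ : ℝ, 0 < δ → δ ≤ ε → SameOrderType (C.childPts δ) (C.childPts ε)

/-- Each of the finitely many triples has a constant orientation on some interval to the right of
`0`; the right end of a common interval is an admissible distance. -/
theorem exists_admissible [Finite ι] : ∃ ε, C.Admissible ε := by
  have h : ∀ t : (ι × Bool) × (ι × Bool) × (ι × Bool), ∃ s, ∀ᶠ δ in 𝓝[>] (0 : ℝ),
      sg (C.childPts δ) t.1 t.2.1 t.2.2 = s := by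
    rintro ⟨x, y, z⟩
    obtain ⟨A, B, D, h⟩ := C.exists_orient_childPts x y z
    simp only [sg, h]
    exact exists_eventually_sign_quadratic A B D
  choose s hs using h
  obtain ⟨ε, hε, hsub⟩ := mem_nhdsGT_iff_exists_Ioc_subset.mp (eventually_all.mpr hs)
  refine ⟨ε, hε, fun δ h0 hle a b c => ?_⟩
  have h1 := hsub ⟨h0, hle⟩ (a, b, c)
  have h2 := hsub ⟨hε, le_refl ε⟩ (a, b, c)
  exact h1.trans h2.symm

/-- The children of `p` lie on the matching line of `p`, and the direction from the first child to
the second is the direction from `p` to its partner. Only the length of the base changes. -/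
theorem orient_siblings (ε : ℝ) (p : ι) (z : Plane) :
    orient (C.childPts ε (p, false)) (C.childPts ε (p, true)) z =
      2 * ε * ‖C.pts (C.mat p) - C.pts p‖⁻¹ * orient (C.pts p) (C.pts (C.mat p)) z := by
  simp only [orient, childPts_apply, direction]
  simp
  ring

/-- The partner of `p` lies on the line in question, so only the displacement of its child counts.
This displacement points to or from the partner of the partner, which leads to the triple formed by
`m p`, `m (m p)` and `p`. -/
theorem orient_partner_child (ε : ℝ) (p : ι) (b : Bool) :
    orient (C.pts p) (C.pts (C.mat p)) (C.childPts ε (C.mat p, b)) =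
      (if b then 1 else -1) * (ε * ‖C.pts (C.mat (C.mat p)) - C.pts (C.mat p)‖⁻¹ *
        orient (C.pts (C.mat p)) (C.pts (C.mat (C.mat p))) (C.pts p)) := by
  simp only [orient, childPts_apply, direction]
  cases b <;> simp <;> ring

/-- The orientations of the doubled point set, expressed through those of the original one. -/
structure CanonicalSigns (Q : ι × Bool → Plane) : Prop where
  distinct : ∀ x y z : ι × Bool, x.1 ≠ y.1 → x.1 ≠ z.1 → y.1 ≠ z.1 →
    sg Q x y z = sg C.pts x.1 y.1 z.1
  siblings : ∀ (p : ι) (x : ι × Bool), x.1 ≠ p → x.1 ≠ C.mat p →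
    sg Q (p, false) (p, true) x = sg C.pts p (C.mat p) x.1
  partner : ∀ (p : ι) (b : Bool), sg Q (p, false) (p, true) (C.mat p, b) =
    (if b then 1 else -1) * sg C.pts (C.mat p) (C.mat (C.mat p)) p

variable {C}

theorem norm_inv_pos (hP : InGeneralPosition C.pts) (hm : IsMatching C.mat) (p : ι) :
    0 < ‖C.pts (C.mat p) - C.pts p‖⁻¹ :=
  inv_pos.mpr (norm_pos_iff.mpr (sub_ne_zero.mpr (hP.1.ne (hm p).1)))

/-- An admissible distance has the same signs as every smaller one, so signs may be computed as the
distance tends to `0`. For three different parents the limit is the nondegenerate parent triple. For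
two siblings a positive factor proportional to the distance is divided out first. For siblings
against a child of the partner the formula is exact at every distance. -/
theorem Admissible.canonicalSigns (hP : InGeneralPosition C.pts) (hm : IsMatching C.mat) {ε : ℝ}
    (hε : C.Admissible ε) : C.CanonicalSigns (C.childPts ε) := by
  have transfer : ∀ (x y z : ι × Bool) (s : SignType),
      (∀ᶠ δ in 𝓝[>] (0 : ℝ), sg (C.childPts δ) x y z = s) → sg (C.childPts ε) x y z = s := by
    intro x y z s h
    obtain ⟨δ, hδ, h0, hle⟩ := (h.and (Ioc_mem_nhdsGT hε.1)).exists
    rw [← hδ]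
    exact (hε.2 δ h0 hle x y z).symm
  have hcont : ∀ (x : ι × Bool) (i : Fin 2), Continuous fun δ => C.childPts δ x i := by
    intro x i
    simp only [childPts_apply]
    fun_prop
  have hz : ∀ x, C.childPts 0 x = C.pts x.1 := by
    intro x
    ext i
    simp [childPts_apply]
  refine ⟨fun x y z hxy hxz hyz => transfer _ _ _ _ ?_, fun p x hx hx' => transfer _ _ _ _ ?_,
    fun p b => ?_⟩
  · have := eventually_sign_eq
      (f := fun δ => orient (C.childPts δ x) (C.childPts δ y) (C.childPts δ z))
      (((((hcont y 0).sub (hcont x 0)).mul ((hcont z 1).sub (hcont x 1)))).sub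
        (((hcont y 1).sub (hcont x 1)).mul ((hcont z 0).sub (hcont x 0)))) (by
        simp only [hz]
        exact fun h0 => hP.sg_ne_zero hxy hxz hyz (by simp [sg, h0]))
    simp only [hz] at this
    exact this
  · have := eventually_sign_eq
      (f := fun δ => orient (C.pts p) (C.pts (C.mat p)) (C.childPts δ x))
      ((continuous_const.mul ((hcont x 1).sub continuous_const)).sub
        (continuous_const.mul ((hcont x 0).sub continuous_const))) (by
        simp only [hz]
        exact fun h0 => hP.sg_ne_zero (hm p).1.symm hx.symm hx'.symm (by simp [sg, h0]))
    simp only [hz] at this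
    filter_upwards [this, self_mem_nhdsWithin] with δ h1 hδ
    have hδ' : (0 : ℝ) < δ := hδ
    have h2 : 0 < 2 * δ * ‖C.pts (C.mat p) - C.pts p‖⁻¹ :=
      mul_pos (by linarith) (norm_inv_pos hP hm p)
    rw [sg, orient_siblings, sign_mul, sign_pos h2, one_mul, h1, sg]
  · have h2 : 0 < 2 * ε * ‖C.pts (C.mat p) - C.pts p‖⁻¹ :=
      mul_pos (by linarith [hε.1]) (norm_inv_pos hP hm p)
    have h3 : 0 < ε * ‖C.pts (C.mat (C.mat p)) - C.pts (C.mat p)‖⁻¹ :=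
      mul_pos hε.1 (norm_inv_pos hP hm _)
    rw [sg, orient_siblings, sign_mul, sign_pos h2, one_mul, orient_partner_child, sign_mul,
      sign_mul, sign_pos h3, one_mul, sg]
    cases b <;> simp

/-- This expresses the left child by orientations of the parents alone, so the new matching depends
only on the order type and not on the distance. -/
theorem leftChild_eq (hP : InGeneralPosition C.pts) (hm : IsMatching C.mat) {ε : ℝ} (hε : 0 < ε)
    (p : ι) : C.leftChild ε p =
      (C.mat p, decide (sg C.pts (C.mat p) (C.mat (C.mat p)) p = 1)) := by
  have h3 : 0 < ε * ‖C.pts (C.mat (C.mat p)) - C.pts (C.mat p)‖⁻¹ :=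
    mul_pos hε (norm_inv_pos hP hm _)
  have hne : sg C.pts (C.mat p) (C.mat (C.mat p)) p ≠ 0 :=
    hP.sg_ne_zero (hm _).1.symm (hm p).1 (hm p).2
  have hiff : 0 < orient (C.pts p) (C.pts (C.mat p)) (C.childPts ε (C.mat p, false)) ↔
      sg C.pts (C.mat p) (C.mat (C.mat p)) p = -1 := by
    rw [orient_partner_child, sg, sign_eq_neg_one_iff]
    simp only [Bool.false_eq_true, if_false, neg_one_mul, neg_pos]
    rw [mul_neg_iff]
    simp [h3, h3.not_gt]
  simp only [leftChild, hiff]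
  generalize sg C.pts (C.mat p) (C.mat (C.mat p)) p = s at *
  cases s <;> simp at hne ⊢

/-- Two chirotopes of a doubled point set agree if they agree on representative triples. -/
theorem sg_eq_of_representatives {Q Q' : ι × Bool → Plane}
    (h1 : ∀ x y z : ι × Bool, x.1 ≠ y.1 → x.1 ≠ z.1 → y.1 ≠ z.1 → sg Q x y z = sg Q' x y z)
    (h2 : ∀ (p : ι) (x : ι × Bool), x.1 ≠ p →
      sg Q (p, false) (p, true) x = sg Q' (p, false) (p, true) x) (x y z : ι × Bool) :
    sg Q x y z = sg Q' x y z := by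
  have key : ∀ x y z : ι × Bool, x.1 = y.1 → sg Q x y z = sg Q' x y z := by
    rintro ⟨p, i⟩ ⟨q, j⟩ ⟨r, l⟩ h
    obtain rfl : p = q := h
    by_cases hr : r = p
    · subst hr
      cases i <;> cases j <;> cases l <;> simp [sg_self_left, sg_self_right, sg_self_outer]
    · cases i <;> cases j <;> try simp only [sg_self_left]
      · exact h2 p (r, l) hr
      · rw [sg_swap_left Q (p, false), sg_swap_left Q' (p, false), h2 p (r, l) hr]
  by_cases hxy : x.1 = y.1
  · exact key x y z hxy
  by_cases hxz : x.1 = z.1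
  · rw [← sg_rotate Q x y z, ← sg_rotate Q y z x, ← sg_rotate Q' x y z, ← sg_rotate Q' y z x]
    exact key z x y hxz.symm
  by_cases hyz : y.1 = z.1
  · rw [← sg_rotate Q x y z, ← sg_rotate Q' x y z]
    exact key y z x hyz
  exact h1 x y z hxy hxz hyz

/-- The delicate case is a child of the partner of `p`: its parent lies on the matching line of `p`,
but it moves off that line because `m (m p) ≠ p`. -/
theorem CanonicalSigns.sg_ne_zero {Q : ι × Bool → Plane} (h : C.CanonicalSigns Q)
    (hP : InGeneralPosition C.pts) (hm : IsMatching C.mat) {p : ι} {x : ι × Bool} (hx : x.1 ≠ p) :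
    sg Q (p, false) (p, true) x ≠ 0 := by
  by_cases hx' : x.1 = C.mat p
  · obtain ⟨q, b⟩ := x
    obtain rfl : q = C.mat p := hx'
    have hne : sg C.pts (C.mat p) (C.mat (C.mat p)) p ≠ 0 :=
      hP.sg_ne_zero (hm _).1.symm (hm p).1 (hm p).2
    rw [h.partner]
    cases b <;> simpa using hne
  · rw [h.siblings p x hx hx']
    exact hP.sg_ne_zero (hm p).1.symm hx.symm (Ne.symm hx')

theorem CanonicalSigns.inGeneralPosition {Q : ι × Bool → Plane} (h : C.CanonicalSigns Q)
    (hP : InGeneralPosition C.pts) (hm : IsMatching C.mat) : InGeneralPosition Q := by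
  refine inGeneralPosition_of_sg ?_ ?_
  · have key : ∀ x y z : ι × Bool, x ≠ y → x ≠ z → y ≠ z → x.1 = y.1 → sg Q x y z ≠ 0 := by
      rintro ⟨p, i⟩ ⟨q, j⟩ ⟨r, l⟩ hxy hxz hyz heq
      obtain rfl : p = q := heq
      have hr : r ≠ p := by
        rintro rfl
        cases i <;> cases j <;> cases l <;> simp at hxy hxz hyz
      have := h.sg_ne_zero hP hm (x := (r, l)) hr
      cases i <;> cases j <;> simp at hxy
      · exact this
      · rw [sg_swap_left Q (p, false)]
        simpa using this
    intro x y z hxy hxz hyz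
    by_cases exy : x.1 = y.1
    · exact key x y z hxy hxz hyz exy
    by_cases exz : x.1 = z.1
    · rw [← sg_rotate Q x y z, ← sg_rotate Q y z x]
      exact key z x y hxz.symm hyz.symm hxy exz.symm
    by_cases eyz : y.1 = z.1
    · rw [← sg_rotate Q x y z]
      exact key y z x hyz hxy.symm hxz.symm eyz
    rw [h.distinct x y z exy exz eyz]
    exact hP.sg_ne_zero exy exz eyz
  -- A child of `m p` serves as the third point, unless `m p` is the second parent `q`; then a child
  -- of `m q` does, as `m q` is neither `p` nor `q`.
  · rintro ⟨p, i⟩ ⟨q, j⟩ -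
    by_cases hq : q = C.mat p
    · refine ⟨(C.mat q, false), ?_, ?_⟩ <;> intro h0 <;> rw [Prod.mk.injEq] at h0
      · exact (hm p).2 (hq ▸ h0.1)
      · exact (hm q).1 h0.1
    · refine ⟨(C.mat p, false), ?_, ?_⟩ <;> intro h0 <;> rw [Prod.mk.injEq] at h0
      · exact (hm p).1 h0.1
      · exact hq h0.1.symm

theorem childMat_fst (ε : ℝ) (x : ι × Bool) : (C.childMat ε x).1 = C.mat x.1 ∨
    (x.2 = false ∧ C.childMat ε x = (x.1, true)) := by
  have hl : ∀ p, (C.leftChild ε p).1 = C.mat p := by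
    intro p
    unfold leftChild
    split_ifs <;> rfl
  obtain ⟨p, b⟩ := x
  cases b
  · simp only [childMat]
    cases (C.det p).first
    · exact Or.inl (hl p)
    · exact Or.inl (hl p)
    · exact Or.inr (by simp)
  · simp only [childMat]
    cases (C.det p).second
    · exact Or.inl (hl p)
    · exact Or.inl (hl p)

/-- A fixed point or 2-cycle among the children would project to one of `m`, unless siblings are
matched with each other. Only the first child may be matched with its sibling, so siblings cannot
form a 2-cycle. -/
theorem isMatching_childMat (hm : IsMatching C.mat) (ε : ℝ) : IsMatching (C.childMat ε) := by
  intro x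
  constructor
  · intro h
    rcases C.childMat_fst ε x with h1 | ⟨h1, h2⟩
    · exact (hm x.1).1 (by rw [← h1, h])
    · rw [h] at h2
      rw [h2] at h1
      simp at h1
  · intro h
    rcases C.childMat_fst ε x with h1 | ⟨h1, h2⟩
    · rcases C.childMat_fst ε (C.childMat ε x) with h3 | ⟨h3, h4⟩
      · rw [h, h1] at h3
        exact (hm x.1).2 h3.symm
      · rw [h, h1] at h4
        exact (hm x.1).1 (congrArg Prod.fst h4).symm
    · rcases C.childMat_fst ε (C.childMat ε x) with h3 | ⟨h3, h4⟩
      · rw [h, h2] at h3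
        exact (hm x.1).1 h3.symm
      · rw [h2] at h3
        simp at h3

end Config

/-! ### Crossings of the doubled point set -/

theorem SignType.mul_self_ne_neg_one (s : SignType) : s * s ≠ -1 := by
  cases s <;> decide

theorem SignType.eq_neg_of_mul_eq_neg_one {s t : SignType} (h : s * t = -1) : t = -s := by
  revert h; cases s <;> cases t <;> decide

/-- If the edges `a b` and `c d` cross then `b` and `d` lie on the same side of `a c`. -/
theorem Crosses.same_side {ι : Type} {P : ι → Plane} {a b c d : ι} (h : Crosses P a b c d) :
    sg P a c b = sg P a c d := by
  obtain ⟨h1, h2⟩ := h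
  rw [sg_swap_right P a b c]
  rw [sg_rotate P a c d] at h2
  simp only [sg] at *
  rw [sign_mul_sign_eq_neg_one] at h1 h2
  -- The alternating sum of the signed areas of the four triangles spanned by four points is zero.
  -- Together with the two sign conditions of the crossing it determines the remaining signs.
  have e : orient (P a) (P b) (P c) - orient (P a) (P b) (P d) + orient (P a) (P c) (P d)
      - orient (P c) (P d) (P b) = 0 := by
    unfold orient; ring
  rw [← Left.sign_neg]
  rcases mul_neg_iff.mp h1 with ⟨u1, u2⟩ | ⟨u1, u2⟩ <;>
    rcases mul_neg_iff.mp h2 with ⟨v1, v2⟩ | ⟨v1, v2⟩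
  · linarith
  · rw [sign_neg v1, sign_neg (by linarith)]
  · rw [sign_pos v1, sign_pos (by linarith)]
  · linarith

/-- Of the perfect matchings of four points in the plane at most one consists of crossing segments,
namely the diagonals when the points are in convex position. -/
theorem Crosses.not_exchange {ι : Type} {P : ι → Plane} {a b c d : ι} (h : Crosses P a b c d) :
    ¬ Crosses P c b a d := by
  intro h'
  have e1 := h.same_side
  obtain ⟨h1, h2⟩ := h
  obtain ⟨h3, h4⟩ := h'
  have f2 := SignType.eq_neg_of_mul_eq_neg_one h2
  have f3 := SignType.eq_neg_of_mul_eq_neg_one h3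
  rw [sg_swap_right P c b d, sg_rotate P a c d, ← e1] at f2
  rw [neg_inj] at f2
  rw [f2, sg_rotate P a c b] at f3
  have f1 : sg P a c b ≠ 0 := by
    rw [sg_swap_right P a b c]
    intro h0
    revert h0 h1
    generalize sg P a b c = s
    cases s <;> simp
  revert f1 f3
  generalize sg P a c b = s
  cases s <;> decide

namespace Config

variable {ι : Type} {k : ℕ} {C : Config ι k}

theorem childCol_of_ne {x y : ι × Bool} (h : x.1 ≠ y.1) :
    C.childCol s(x, y) = C.col s(x.1, y.1) := by
  simp [childCol, h]

theorem childCol_of_eq {x y : ι × Bool} (h : x.1 = y.1) :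
    C.childCol s(x, y) = (C.det x.1).color := by
  simp [childCol, h]

/-- Assembles a quadruple of children from a quadruple of parents. -/
def childQuad (t : (ι × ι × ι × ι) × (Bool × Bool × Bool × Bool)) :
    (ι × Bool) × (ι × Bool) × (ι × Bool) × (ι × Bool) :=
  ((t.1.1, t.2.1), (t.1.2.1, t.2.2.1), (t.1.2.2.1, t.2.2.2.1), (t.1.2.2.2, t.2.2.2.2))

theorem childQuad_injective : Function.Injective (childQuad (ι := ι)) := by
  rintro ⟨⟨a, b, c, d⟩, i, j, l, m⟩ ⟨⟨a', b', c', d'⟩, i', j', l', m'⟩ h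
  simp only [childQuad, Prod.mk.injEq] at h ⊢
  tauto

/-- The line through the siblings `c`, `d` is the matching line of their parent. It leaves both
children of another vertex on one side unless it passes through that vertex, which must then be the
partner. -/
theorem CanonicalSigns.partner_of_opposite {Q : ι × Bool → Plane} (h : C.CanonicalSigns Q)
    {a b c d : ι × Bool}
    (hcd : c.1 = d.1) (hab : a.1 = b.1) (hac : a.1 ≠ c.1)
    (hs : sg Q c d a * sg Q c d b = -1) : a.1 = C.mat c.1 := by
  by_contra hne
  obtain ⟨q, i⟩ := c
  obtain ⟨q', j⟩ := d
  obtain rfl : q = q' := hcd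
  have h1 := h.siblings q a hac hne
  have h2 := h.siblings q b (hab ▸ hac) (hab ▸ hne)
  rw [← hab, ← h1] at h2
  cases i <;> cases j <;> try simp only [sg_self_left] at hs
  · simp at hs
  · rw [h2] at hs
    exact SignType.mul_self_ne_neg_one _ hs
  · rw [sg_swap_left Q (q, false), sg_swap_left Q (q, false), h2] at hs
    exact SignType.mul_self_ne_neg_one _ hs
  · simp at hs

/-- If the other edge joins children of different vertices, `a` and `b` lie on the same side of it.
If it also joins siblings, each parent would be the partner of the other, which a matching excludes.
-/
theorem CanonicalSigns.not_siblings {Q : ι × Bool → Plane} (h : C.CanonicalSigns Q)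
    (hm : IsMatching C.mat)
    {a b c d : ι × Bool} (hx : Crosses Q a b c d) (hab : a.1 = b.1) (hac : a.1 ≠ c.1)
    (had : a.1 ≠ d.1) : False := by
  by_cases hcd : c.1 = d.1
  · have h1 := h.partner_of_opposite hcd hab hac hx.2
    have h2 := h.partner_of_opposite hab hcd hac.symm hx.1
    exact (hm c.1).2 (by rw [← h1, ← h2])
  · have h2 := hx.2
    rw [h.distinct c d a hcd hac.symm had.symm,
      h.distinct c d b hcd (hab ▸ hac.symm) (hab ▸ had.symm), hab] at h2
    exact SignType.mul_self_ne_neg_one _ h2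

variable [Fintype ι] {Q : ι × Bool → Plane}

theorem CanonicalSigns.mem_crossQuads_iff (h : C.CanonicalSigns Q) {a b c d : ι × Bool}
    (hab : a.1 ≠ b.1) (hac : a.1 ≠ c.1) (had : a.1 ≠ d.1) (hbc : b.1 ≠ c.1) (hbd : b.1 ≠ d.1)
    (hcd : c.1 ≠ d.1) : (a, b, c, d) ∈ crossQuads Q C.childCol ↔
      (a.1, b.1, c.1, d.1) ∈ crossQuads C.pts C.col := by
  simp only [mem_crossQuads, Crosses, h.distinct a b c hab hac hbc, h.distinct a b d hab had hbd,
    h.distinct c d a hcd hac.symm had.symm, h.distinct c d b hcd hbc.symm hbd.symm,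
    childCol_of_ne hab, childCol_of_ne hcd]

/-- The crossings inherited from the original point set. -/
noncomputable def inheritedQuads (C : Config ι k) :
    Finset ((ι × Bool) × (ι × Bool) × (ι × Bool) × (ι × Bool)) :=
  (crossQuads C.pts C.col ×ˢ Finset.univ).map ⟨childQuad, childQuad_injective⟩

theorem card_inheritedQuads : C.inheritedQuads.card = 16 * (crossQuads C.pts C.col).card := by
  rw [inheritedQuads, Finset.card_map, Finset.card_product,
    mul_comm]
  simp

/-- Orientations and colours of quadruples with four different parents are inherited, so every
choice of children of an old crossing is again a crossing of equal colours. -/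
theorem CanonicalSigns.inheritedQuads_subset (h : C.CanonicalSigns Q) :
    C.inheritedQuads ⊆ crossQuads Q C.childCol := by
  intro t ht
  obtain ⟨⟨⟨a, b, c, d⟩, i, j, l, m⟩, ht', rfl⟩ := Finset.mem_map.mp ht
  have hq := (Finset.mem_product.mp ht').1
  obtain ⟨h1, h2, h3, h4, h5, h6⟩ := (mem_crossQuads.mp hq).1.ne
  exact (h.mem_crossQuads_iff (a := (a, i)) (b := (b, j)) (c := (c, l)) (d := (d, m))
    h1 h2 h3 h4 h5 h6).mpr hq

theorem CanonicalSigns.le_card_crossQuads (h : C.CanonicalSigns Q) :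
    16 * (crossQuads C.pts C.col).card ≤ (crossQuads Q C.childCol).card := by
  rw [← card_inheritedQuads]
  exact Finset.card_le_card h.inheritedQuads_subset

open Classical in
/-- Pairs of children in the same colour class on the same side of the line through the children
of `p`. -/
noncomputable def sameSidePairs (C : Config ι k) (Q : ι × Bool → Plane) (p : ι) :
    Finset ((ι × Bool) × (ι × Bool)) :=
  Finset.univ.filter fun t => t.1 ≠ t.2 ∧ sg Q (p, false) (p, true) t.1 ≠ 0 ∧
    sg Q (p, false) (p, true) t.1 = sg Q (p, false) (p, true) t.2 ∧
    C.col s(p, t.1.1) = C.col s(p, t.2.1)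

-- When two crossing edges start at children of `p`, they use both children, and their other ends
-- lie on the same side of the sibling line by `Crosses.same_side`. Keeping only `p` and these two
-- ends is injective: by `Crosses.not_exchange` the ends cannot cross under both assignments to the
-- two children.
open Classical in
theorem CanonicalSigns.card_common_fst_le (h : C.CanonicalSigns Q)
    (hP : InGeneralPosition C.pts) (hm : IsMatching C.mat) :
    ((crossQuads Q C.childCol).filter fun t => t.1.1 = t.2.2.1.1).card ≤
      ∑ p, (C.sameSidePairs Q p).card := by
  rw [← Finset.card_sigma]
  refine Finset.card_le_card_of_injOn
    (fun t => (⟨t.1.1, (t.2.1, t.2.2.2)⟩ : Σ _ : ι, (ι × Bool) × (ι × Bool))) ?_ ?_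
  · rintro ⟨⟨p, i⟩, b, ⟨p', j⟩, d⟩ ht
    simp only [Finset.coe_filter, Set.mem_ofPred_eq] at ht
    obtain ⟨ht, rfl⟩ := ht
    obtain ⟨hx, hχ⟩ := mem_crossQuads.mp ht
    obtain ⟨h1, h2, h3, h4, h5, h6⟩ := hx.ne
    have hij : j = !i := by
      cases i <;> cases j <;> simp at h2 ⊢
    subst hij
    have hb : b.1 ≠ p := by
      obtain ⟨q, l⟩ := b
      rintro rfl
      cases i <;> cases l <;> simp at h1 h4
    have hd : d.1 ≠ p := by
      obtain ⟨q, l⟩ := d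
      rintro rfl
      cases i <;> cases l <;> simp at h3 h6
    have hs : sg Q (p, false) (p, true) b = sg Q (p, false) (p, true) d := by
      have := hx.same_side
      cases i
      · exact this
      · rw [Bool.not_true, sg_swap_left Q (p, false), sg_swap_left Q (p, false), neg_inj] at this
        exact this
    rw [childCol_of_ne (Ne.symm hb), childCol_of_ne (Ne.symm hd)] at hχ
    simp only [Finset.coe_sigma, Set.mem_sigma_iff, Finset.coe_univ, Set.mem_univ, true_and,
      Finset.mem_coe, sameSidePairs, Finset.mem_filter, Finset.mem_univ]
    exact ⟨h5, h.sg_ne_zero hP hm hb, hs, hχ⟩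
  · rintro ⟨⟨p, i⟩, b, ⟨p', j⟩, d⟩ ht ⟨⟨p₁, i₁⟩, b₁, ⟨p₁', j₁⟩, d₁⟩ ht₁ heq
    simp only [Finset.coe_filter, Set.mem_ofPred_eq] at ht ht₁
    obtain ⟨ht, rfl⟩ := ht
    obtain ⟨ht₁, rfl⟩ := ht₁
    simp only [Sigma.mk.injEq, heq_eq_eq, Prod.mk.injEq] at heq
    obtain ⟨rfl, rfl, rfl⟩ := heq
    have hx := (mem_crossQuads.mp ht).1
    have hx₁ := (mem_crossQuads.mp ht₁).1
    have h2 := hx.ne.2.1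
    have h2₁ := hx₁.ne.2.1
    have := hx.not_exchange
    cases i <;> cases j <;> cases i₁ <;> cases j₁ <;> simp at h2 h2₁ ⊢ <;> exact this hx₁

/-- A new crossing is inherited unless an end of one edge and an end of the other have a common
parent. There are four possible coincidences, and reversing edges reduces each of them to the first,
hence the factor 4. -/
theorem CanonicalSigns.card_crossQuads_le (h : C.CanonicalSigns Q)
    (hP : InGeneralPosition C.pts) (hm : IsMatching C.mat) :
    (crossQuads Q C.childCol).card ≤
      16 * (crossQuads C.pts C.col).card + 4 * ∑ p, (C.sameSidePairs Q p).card := by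
  classical
  set X := crossQuads Q C.childCol with hX
  have hac := h.card_common_fst_le hP hm
  rw [← hX] at hac
  have had : (X.filter fun t => t.1.1 = t.2.2.2.1).card ≤ ∑ p, (C.sameSidePairs Q p).card := by
    refine le_trans (Finset.card_le_card_of_injOn (fun t => (t.1, t.2.1, t.2.2.2, t.2.2.1)) ?_ ?_)
      hac
    · rintro ⟨a, b, c, d⟩ ht
      simp only [Finset.coe_filter, Set.mem_ofPred_eq] at ht ⊢
      exact ⟨crossQuads_swap_right.mpr ht.1, ht.2⟩
    · rintro ⟨a, b, c, d⟩ - ⟨a', b', c', d'⟩ - heq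
      simp only [Prod.mk.injEq] at heq ⊢
      tauto
  have hbc : (X.filter fun t => t.2.1.1 = t.2.2.1.1).card ≤ ∑ p, (C.sameSidePairs Q p).card := by
    refine le_trans (Finset.card_le_card_of_injOn (fun t => (t.2.1, t.1, t.2.2.1, t.2.2.2)) ?_ ?_)
      hac
    · rintro ⟨a, b, c, d⟩ ht
      simp only [Finset.coe_filter, Set.mem_ofPred_eq] at ht ⊢
      exact ⟨crossQuads_swap_left.mpr ht.1, ht.2⟩
    · rintro ⟨a, b, c, d⟩ - ⟨a', b', c', d'⟩ - heq
      simp only [Prod.mk.injEq] at heq ⊢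
      tauto
  have hbd : (X.filter fun t => t.2.1.1 = t.2.2.2.1).card ≤ ∑ p, (C.sameSidePairs Q p).card := by
    refine le_trans (Finset.card_le_card_of_injOn (fun t => (t.2.1, t.1, t.2.2.2, t.2.2.1)) ?_ ?_)
      hac
    · rintro ⟨a, b, c, d⟩ ht
      simp only [Finset.coe_filter, Set.mem_ofPred_eq] at ht ⊢
      exact ⟨crossQuads_swap_left.mpr (crossQuads_swap_right.mpr ht.1), ht.2⟩
    · rintro ⟨a, b, c, d⟩ - ⟨a', b', c', d'⟩ - heq
      simp only [Prod.mk.injEq] at heq ⊢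
      tauto
  -- Without such a coincidence neither edge joins two siblings, by `not_siblings`; the four parents
  -- are then distinct and form an old crossing.
  have hsub : X ⊆ C.inheritedQuads ∪ (((X.filter fun t => t.1.1 = t.2.2.1.1) ∪
      (X.filter fun t => t.1.1 = t.2.2.2.1)) ∪ ((X.filter fun t => t.2.1.1 = t.2.2.1.1) ∪
      (X.filter fun t => t.2.1.1 = t.2.2.2.1))) := by
    rintro ⟨a, b, c, d⟩ ht
    simp only [Finset.mem_union, Finset.mem_filter, ht, true_and]
    by_cases e1 : a.1 = c.1
    · exact Or.inr (Or.inl (Or.inl e1))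
    by_cases e2 : a.1 = d.1
    · exact Or.inr (Or.inl (Or.inr e2))
    by_cases e3 : b.1 = c.1
    · exact Or.inr (Or.inr (Or.inl e3))
    by_cases e4 : b.1 = d.1
    · exact Or.inr (Or.inr (Or.inr e4))
    have hx := (mem_crossQuads.mp ht).1
    have e5 : a.1 ≠ b.1 := fun e => h.not_siblings hm hx e e1 e2
    have e6 : c.1 ≠ d.1 := fun e => h.not_siblings hm (crosses_symm.mpr hx) e (Ne.symm e1)
      (Ne.symm e3)
    refine Or.inl (Finset.mem_map.mpr ⟨((a.1, b.1, c.1, d.1), (a.2, b.2, c.2, d.2)), ?_, rfl⟩)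
    exact Finset.mem_product.mpr
      ⟨(h.mem_crossQuads_iff e5 e1 e2 e3 e4 e6).mp ht, Finset.mem_univ _⟩
  have h1 := Finset.card_le_card hsub
  have h2 := Finset.card_union_le C.inheritedQuads (((X.filter fun t => t.1.1 = t.2.2.1.1) ∪
      (X.filter fun t => t.1.1 = t.2.2.2.1)) ∪ ((X.filter fun t => t.2.1.1 = t.2.2.1.1) ∪
      (X.filter fun t => t.2.1.1 = t.2.2.2.1)))
  have h3 := Finset.card_union_le ((X.filter fun t => t.1.1 = t.2.2.1.1) ∪
      (X.filter fun t => t.1.1 = t.2.2.2.1)) ((X.filter fun t => t.2.1.1 = t.2.2.1.1) ∪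
      (X.filter fun t => t.2.1.1 = t.2.2.2.1))
  have h4 := Finset.card_union_le (X.filter fun t => t.1.1 = t.2.2.1.1)
    (X.filter fun t => t.1.1 = t.2.2.2.1)
  have h5 := Finset.card_union_le (X.filter fun t => t.2.1.1 = t.2.2.1.1)
    (X.filter fun t => t.2.1.1 = t.2.2.2.1)
  rw [card_inheritedQuads] at h2
  omega

end Config

namespace Config

variable {ι : Type} {k : ℕ} {C : Config ι k}

/-! ### Side counts and their evolution under doubling -/

/-- Two children count alike except at the vertex `p` and its partner `m`, where membership depends
on the child; these four children are accounted for separately. -/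
theorem card_filter_children [Fintype ι] (F : ι × Bool → Prop) [DecidablePred F] (f : ι → Prop)
    [DecidablePred f] {p m : ι}
    (hpm : p ≠ m) (hp : ¬ f p) (hm : ¬ f m)
    (h : ∀ q b, q ≠ p → q ≠ m → (F (q, b) ↔ f q)) :
    (Finset.univ.filter F).card = 2 * (Finset.univ.filter f).card +
      ((if F (p, false) then 1 else 0) + if F (p, true) then 1 else 0) +
      ((if F (m, false) then 1 else 0) + if F (m, true) then 1 else 0) := by
  classical
  have key : ∀ q, ∑ b, (if F (q, b) then 1 else 0) = 2 * (if f q then 1 else 0) +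
      (if q = p then ((if F (p, false) then 1 else 0) + if F (p, true) then 1 else 0) else 0) +
      (if q = m then ((if F (m, false) then 1 else 0) + if F (m, true) then 1 else 0) else 0) := by
    intro q
    rw [Fintype.sum_bool]
    by_cases hqp : q = p
    · subst hqp
      simp [hp, hpm, add_comm]
    by_cases hqm : q = m
    · subst hqm
      simp [hm, hqp, add_comm]
    simp only [h q _ hqp hqm, hqp, hqm, if_false]
    ring
  rw [Finset.card_filter, Fintype.sum_prod_type, Finset.sum_congr rfl fun q _ => key q,
    Finset.sum_add_distrib, Finset.sum_add_distrib, ← Finset.mul_sum, Finset.card_filter]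
  simp

/-- The number of vertices `q` on the side `s` of the matching edge of `p` such that `p q` has
colour `c`. -/
noncomputable def sideCount [Fintype ι] (C : Config ι k) (s : SignType) (p : ι) (c : Fin k) : ℕ :=
  (Finset.univ.filter fun q => sg C.pts p (C.mat p) q = s ∧ C.col s(p, q) = c).card

/-- The details used at every vertex: the edge between the children gets the colour of the
matching edge, and both children are matched with the left child of the partner. -/
def LeftDetails (C : Config ι k) : Prop :=
  ∀ p, C.det p = ⟨C.col s(p, C.mat p), .left, .left⟩

/-- The children of `p` lie on the line, and the two children of the partner lie on opposite sides
of it. So each side receives exactly one of the latter, in the colour of the matching edge. -/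
theorem CanonicalSigns.card_sibling_side [Fintype ι] {Q : ι × Bool → Plane}
    (h : C.CanonicalSigns Q) (hP : InGeneralPosition C.pts) (hm : IsMatching C.mat)
    {s : SignType} (hs : s ≠ 0) (p : ι) (c : Fin k) :
    (Finset.univ.filter fun x : ι × Bool =>
      sg Q (p, false) (p, true) x = s ∧ C.col s(p, x.1) = c).card =
      2 * C.sideCount s p c + if c = C.col s(p, C.mat p) then 1 else 0 := by
  rw [card_filter_children _ (fun q => sg C.pts p (C.mat p) q = s ∧ C.col s(p, q) = c)
    (hm p).1.symm (by simp [sg_self_outer, hs.symm]) (by simp [sg_self_right, hs.symm])]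
  · have hne : sg C.pts (C.mat p) (C.mat (C.mat p)) p ≠ 0 :=
      hP.sg_ne_zero (hm _).1.symm (hm p).1 (hm p).2
    simp only [h.partner, sg_self_outer, sg_self_right, hs.symm, false_and, if_false, sideCount,
      eq_comm (a := c), add_zero]
    congr 1
    by_cases hc : C.col s(p, C.mat p) = c
    · simp only [hc, and_true, if_true]
      revert hs hne
      generalize sg C.pts (C.mat p) (C.mat (C.mat p)) p = r
      cases s <;> cases r <;> simp +decide
    · simp [hc]
  · intro q b hqp hqm
    rw [h.siblings p (q, b) hqp hqm]

/-- Orientations seen from a child whose partner is the left child. -/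
theorem CanonicalSigns.sg_left_siblings {Q : ι × Bool → Plane} (h : C.CanonicalSigns Q)
    (hP : InGeneralPosition C.pts) (hm : IsMatching C.mat) (p : ι) :
    sg Q (p, false) (p, true)
      (C.mat p, decide (sg C.pts (C.mat p) (C.mat (C.mat p)) p = 1)) = 1 := by
  have hne : sg C.pts (C.mat p) (C.mat (C.mat p)) p ≠ 0 :=
    hP.sg_ne_zero (hm _).1.symm (hm p).1 (hm p).2
  rw [h.partner]
  revert hne
  generalize sg C.pts (C.mat p) (C.mat (C.mat p)) p = r
  cases r <;> simp

/-- After rotation this is the position of `x` relative to the line through the two children of the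
partner, the matching line of `m x.1`. It agrees with the position of the parent of `x` because `m
(m x.1) ≠ x.1`. -/
theorem CanonicalSigns.sg_left_right {Q : ι × Bool → Plane} (h : C.CanonicalSigns Q)
    (hP : InGeneralPosition C.pts) (hm : IsMatching C.mat) (x : ι × Bool) :
    sg Q x (C.mat x.1, decide (sg C.pts (C.mat x.1) (C.mat (C.mat x.1)) x.1 = 1))
      (C.mat x.1, !decide (sg C.pts (C.mat x.1) (C.mat (C.mat x.1)) x.1 = 1)) = -1 := by
  have hne : sg C.pts (C.mat x.1) (C.mat (C.mat x.1)) x.1 ≠ 0 :=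
    hP.sg_ne_zero (hm _).1.symm (hm x.1).1 (hm x.1).2
  have h1 := h.siblings (C.mat x.1) x (hm x.1).1.symm (hm x.1).2.symm
  rw [← sg_rotate]
  revert hne h1
  generalize sg C.pts (C.mat x.1) (C.mat (C.mat x.1)) x.1 = r
  cases r
  · simp
  · intro _ h1
    simpa using h1
  · intro _ h1
    have h2 := sg_swap_left Q (C.mat x.1, false) (C.mat x.1, true) x
    rw [h1] at h2
    simpa using h2

variable {ε : ℝ}

theorem leftDetails_double (hP : InGeneralPosition C.pts) (hm : IsMatching C.mat)
    (hd : C.LeftDetails) (hε : 0 < ε) (x : ι × Bool) : (C.double ε).mat x =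
      (C.mat x.1, decide (sg C.pts (C.mat x.1) (C.mat (C.mat x.1)) x.1 = 1)) := by
  rw [← leftChild_eq hP hm hε]
  obtain ⟨p, b⟩ := x
  cases b <;> simp [double, childMat, hd p]

theorem col_double_mat (hP : InGeneralPosition C.pts) (hm : IsMatching C.mat)
    (hd : C.LeftDetails) (hε : 0 < ε) (x : ι × Bool) :
    (C.double ε).col s(x, (C.double ε).mat x) = C.col s(x.1, C.mat x.1) := by
  rw [leftDetails_double hP hm hd hε]
  exact childCol_of_ne (hm x.1).1.symm

/-- Details are inherited literally, yet they keep prescribing the colour of the matching edge: the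
new matching edge joins a child of `p` to a child of its partner and so has the old colour. -/
theorem LeftDetails.double (hP : InGeneralPosition C.pts) (hm : IsMatching C.mat)
    (hd : C.LeftDetails) (hε : 0 < ε) : (C.double ε).LeftDetails := by
  intro x
  rw [col_double_mat hP hm hd hε]
  exact hd x.1

/-- Vertices away from the matching edge contribute both children. Besides these, two points of the
matching colour enter: the sibling, to the right of the first child's new matching edge and to the
left of the second child's; and the other child of the partner, always to the right. -/
theorem sideCount_double [Fintype ι] (hP : InGeneralPosition C.pts) (hm : IsMatching C.mat)
    (hd : C.LeftDetails) (hε : C.Admissible ε) {s : SignType} (hs : s ≠ 0) (x : ι × Bool)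
    (c : Fin k) : (C.double ε).sideCount s x c = 2 * C.sideCount s x.1 c +
      if c = C.col s(x.1, C.mat x.1) then
        (if s = (if x.2 then 1 else -1) then 1 else 0) + (if s = -1 then 1 else 0) else 0 := by
  have h := hε.canonicalSigns hP hm
  have hL1 := h.sg_left_siblings hP hm x.1
  have hL2 := h.sg_left_right hP hm x
  have hcolp : ∀ b, (C.double ε).col s(x, (x.1, b)) = C.col s(x.1, C.mat x.1) := fun b => by
    have h0 : (C.double ε).col s(x, (x.1, b)) = (C.det x.1).color := childCol_of_eq rfl
    rw [h0, hd x.1]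
  have hcolq : ∀ y : ι × Bool, y.1 ≠ x.1 → (C.double ε).col s(x, y) = C.col s(x.1, y.1) :=
    fun y hy => childCol_of_ne (Ne.symm hy)
  have hpts : (C.double ε).pts = C.childPts ε := rfl
  rw [sideCount, leftDetails_double hP hm hd hε.1, hpts]
  generalize decide (sg C.pts (C.mat x.1) (C.mat (C.mat x.1)) x.1 = 1) = τ at *
  have hpm := (hm x.1).1
  rw [card_filter_children _ (fun q => sg C.pts x.1 (C.mat x.1) q = s ∧ C.col s(x.1, q) = c)
    hpm.symm (by simp [sg_self_outer, hs.symm]) (by simp [sg_self_right, hs.symm])]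
  · rw [add_assoc, sideCount]
    congr 1
    simp only [hcolp, hcolq (C.mat x.1, _) hpm, eq_comm (a := c)]
    by_cases hc : C.col s(x.1, C.mat x.1) = c
    · simp only [hc, and_true, if_true]
      congr 1
      · obtain ⟨p, b⟩ := x
        cases b
        · have e : sg (C.childPts ε) (p, false) (C.mat p, τ) (p, true) = -1 := by
            rw [sg_swap_right, hL1]
          simp [sg_self_outer, e, hs.symm, eq_comm]
        · have e : sg (C.childPts ε) (p, true) (C.mat p, τ) (p, false) = 1 := by
            rw [sg_rotate, hL1]
          simp [sg_self_outer, e, hs.symm, eq_comm]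
      · cases τ
        · simp only [Bool.not_false] at hL2
          simp [sg_self_right, hL2, hs.symm, eq_comm]
        · simp only [Bool.not_true] at hL2
          simp [sg_self_right, hL2, hs.symm, eq_comm]
    · simp [hc]
  · intro q b hqp hqm
    rw [hcolq (q, b) hqp, h.distinct x (C.mat x.1, τ) (q, b) hpm.symm (Ne.symm hqp) (Ne.symm hqm)]

/-- The pairs are grouped by side and colour; a group of `x` points has `x (x - 1)` ordered pairs of
distinct points. Points on the line itself are excluded by definition. -/
theorem card_sameSidePairs_le [Fintype ι] (hP : InGeneralPosition C.pts) (hm : IsMatching C.mat)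
    {Q : ι × Bool → Plane} (h : C.CanonicalSigns Q) (p : ι) :
    ((C.sameSidePairs Q p).card : ℝ) ≤ ∑ c, (
      (2 * (C.sideCount 1 p c : ℝ) + if c = C.col s(p, C.mat p) then 1 else 0) *
        ((2 * (C.sideCount 1 p c : ℝ) + if c = C.col s(p, C.mat p) then 1 else 0) - 1) +
      (2 * (C.sideCount (-1) p c : ℝ) + if c = C.col s(p, C.mat p) then 1 else 0) *
        ((2 * (C.sideCount (-1) p c : ℝ) + if c = C.col s(p, C.mat p) then 1 else 0) - 1)) := by
  classical
  let F : SignType → Fin k → Finset (ι × Bool) := fun s c => Finset.univ.filter fun x =>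
    sg Q (p, false) (p, true) x = s ∧ C.col s(p, x.1) = c
  have hF : ∀ {s : SignType} (_ : s ≠ 0) (c : Fin k), (((F s c).offDiag.card : ℕ) : ℝ) =
      (2 * (C.sideCount s p c : ℝ) + if c = C.col s(p, C.mat p) then 1 else 0) *
        ((2 * (C.sideCount s p c : ℝ) + if c = C.col s(p, C.mat p) then 1 else 0) - 1) := by
    intro s hs c
    have h1 : (F s c).card = _ := h.card_sibling_side hP hm hs p c
    rw [Finset.offDiag_card, Nat.cast_sub (Nat.le_mul_self _), Nat.cast_mul, h1]
    push_cast
    ring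
  have hsub : C.sameSidePairs Q p ⊆
      Finset.univ.biUnion fun c => (F 1 c).offDiag ∪ (F (-1) c).offDiag := by
    rintro ⟨x, y⟩ hxy
    simp only [sameSidePairs, Finset.mem_filter, Finset.mem_univ, true_and] at hxy
    obtain ⟨h1, h2, h3, h4⟩ := hxy
    simp only [Finset.mem_biUnion, Finset.mem_univ, true_and, Finset.mem_union,
      Finset.mem_offDiag, F, Finset.mem_filter]
    refine ⟨C.col s(p, x.1), ?_⟩
    rw [← h3, ← h4]
    revert h2
    generalize sg Q (p, false) (p, true) x = s
    cases s <;> simp [h1]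
  have h1 : (C.sameSidePairs Q p).card ≤ ∑ c, ((F 1 c).offDiag.card + (F (-1) c).offDiag.card) :=
    (Finset.card_le_card hsub).trans (Finset.card_biUnion_le.trans
      (Finset.sum_le_sum fun c _ => Finset.card_union_le _ _))
  calc ((C.sameSidePairs Q p).card : ℝ)
      ≤ ((∑ c, ((F 1 c).offDiag.card + (F (-1) c).offDiag.card) : ℕ) : ℝ) := by exact_mod_cast h1
    _ = _ := by
      push_cast
      refine Finset.sum_congr rfl fun c _ => ?_
      rw [hF one_ne_zero, hF (by decide)]

/-- The contribution of `p` to the potential controlling all future crossings. -/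
noncomputable def vertexPotential [Fintype ι] (C : Config ι k) (p : ι) : ℝ :=
  ∑ c, (((C.sideCount 1 p c : ℝ) ^ 2 + (C.sideCount (-1) p c : ℝ) ^ 2) / 4 -
    ((C.sideCount 1 p c : ℝ) + C.sideCount (-1) p c) / 12) +
  (C.sideCount 1 p (C.col s(p, C.mat p)) : ℝ) / 4 +
  5 * (C.sideCount (-1) p (C.col s(p, C.mat p)) : ℝ) / 12 + 4 / 21

/-- The coefficients of `vertexPotential` solve this recursion. The quadratic part and the `1 / 12`
balance the same-side pairs of every colour. The coefficients `1 / 4` and `5 / 12` absorb the linear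
terms left over for the matching colour. The constant `κ` must satisfy `14 κ = 8 / 3`, so it is `4 /
21`. The only inequality used is the bound on the same-side pairs. -/
theorem vertexPotential_step [Fintype ι] (hP : InGeneralPosition C.pts) (hm : IsMatching C.mat)
    (hd : C.LeftDetails) (hε : C.Admissible ε) (p : ι) :
    (C.double ε).vertexPotential (p, false) + (C.double ε).vertexPotential (p, true) +
      (C.sameSidePairs (C.childPts ε) p).card / 2 ≤ 16 * C.vertexPotential p := by
  have hS := card_sameSidePairs_le hP hm (hε.canonicalSigns hP hm) p
  have e1 : (-1 : SignType) ≠ 0 := by decide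
  have e2 : (1 : SignType) ≠ -1 := by decide
  -- The identity for one colour with side counts `x`, `y`. For the matching colour the first child
  -- has counts `2 x` and `2 y + 2`, and the second `2 x + 1` and `2 y + 1`; the third summand is
  -- half the number of same-side pairs.
  have key : ∀ (c c₀ : Fin k) (x y : ℝ),
      ((2 * x) ^ 2 + (2 * y + if c = c₀ then 2 else 0) ^ 2) / 4 -
        (2 * x + (2 * y + if c = c₀ then 2 else 0)) / 12 +
      (((2 * x + if c = c₀ then 1 else 0) ^ 2 + (2 * y + if c = c₀ then 1 else 0) ^ 2) / 4 -
        ((2 * x + if c = c₀ then 1 else 0) + (2 * y + if c = c₀ then 1 else 0)) / 12) +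
      ((2 * x + if c = c₀ then 1 else 0) * ((2 * x + if c = c₀ then 1 else 0) - 1) +
        (2 * y + if c = c₀ then 1 else 0) * ((2 * y + if c = c₀ then 1 else 0) - 1)) / 2 =
      16 * ((x ^ 2 + y ^ 2) / 4 - (x + y) / 12) +
        if c = c₀ then 3 * x + 5 * y + 7 / 6 else 0 := by
    intro c c₀ x y
    split_ifs <;> ring
  have hsum := Finset.sum_congr (rfl : (Finset.univ : Finset (Fin k)) = Finset.univ)
    fun c _ => key c (C.col s(p, C.mat p)) (C.sideCount 1 p c) (C.sideCount (-1) p c)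
  simp only [Finset.sum_add_distrib, Finset.sum_ite_eq', Finset.mem_univ,
    if_true, ← Finset.mul_sum, ← Finset.sum_div] at hsum
  simp only [vertexPotential, col_double_mat hP hm hd hε.1,
    sideCount_double hP hm hd hε one_ne_zero, sideCount_double hP hm hd hε e1, if_true, e2,
    Bool.false_eq_true, if_false]
  simp only [Finset.sum_add_distrib] at hS
  push_cast
  simp only [ite_self, add_zero]
  linarith

end Config

/-! ### The limit of the doubling construction -/

noncomputable instance Level.fintype {ι : Type} [Fintype ι] : (t : ℕ) → Fintype (Level ι t)
  | 0 => inferInstanceAs (Fintype ι)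
  | t + 1 => @instFintypeProd (Level ι t) Bool (Level.fintype t) _

theorem Level.card {ι : Type} [Fintype ι] (t : ℕ) :
    Nat.card (Level ι t) = 2 ^ t * Fintype.card ι := by
  induction t with
  | zero => simp [Level]
  | succ t ih =>
    have : Nat.card (Level ι (t + 1)) = Nat.card (Level ι t × Bool) := rfl
    rw [this, Nat.card_prod, ih, Nat.card_eq_fintype_card, Fintype.card_bool]
    ring

theorem monoCr_congr {ι : Type} [Fintype ι] {k : ℕ} {P P' : ι → Plane}
    (h : InGeneralPosition P) (h' : InGeneralPosition P') (hs : SameOrderType P P')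
    (χ : Sym2 ι → Fin k) : monoCr P χ = monoCr P' χ := by
  have hsg : ∀ a b c, sg P a b c = sg P' a b c := hs
  have e : crossQuads P χ = crossQuads P' χ := by
    ext ⟨a, b, c, d⟩
    simp only [mem_crossQuads, Crosses, hsg]
  have h1 := card_crossQuads h χ
  have h2 := card_crossQuads h' χ
  rw [e] at h1
  omega

namespace Config

variable {ι : Type} {k : ℕ} {C : Config ι k}

/-- The configurations to which the doubling analysis applies. -/
structure Regular (C : Config ι k) : Prop where
  pos : InGeneralPosition C.pts
  mat : IsMatching C.mat
  det : C.LeftDetails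

theorem Regular.double (h : C.Regular) {ε : ℝ} (hε : C.Admissible ε) : (C.double ε).Regular :=
  ⟨(hε.canonicalSigns h.pos h.mat).inGeneralPosition h.pos h.mat, isMatching_childMat h.mat ε,
    h.det.double h.pos h.mat hε.1⟩

theorem Regular.iter (h : C.Regular) {ε : ℕ → ℝ} (hε : C.SmallEnough ε) (t : ℕ) :
    (C.iter ε t).Regular := by
  induction t with
  | zero => exact h
  | succ t ih => exact ih.double (hε t)

/-- Inherited crossings alone already make the number of crossings divided by `16 ^ t`
nondecreasing. -/
theorem Regular.monoCr_double [Fintype ι] (h : C.Regular) {ε : ℝ} (hε : C.Admissible ε) :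
    16 * monoCr C.pts C.col ≤ monoCr (C.double ε).pts (C.double ε).col := by
  have h1 := (hε.canonicalSigns h.pos h.mat).le_card_crossQuads
  rw [card_crossQuads h.pos] at h1
  have h2 := card_crossQuads (h.double hε).pos (C.double ε).col
  have h3 : (crossQuads (C.double ε).pts (C.double ε).col).card =
    (crossQuads (C.childPts ε) C.childCol).card := rfl
  omega

/-- The total potential. -/
noncomputable def potential [Fintype ι] (C : Config ι k) : ℝ := ∑ p, C.vertexPotential p

/-- Dividing the quadruple count by 8 leaves half the number of same-side pairs as the excess over
`16 cr`. This is exactly the amount by which `vertexPotential_step` lets the potential fall behind a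
factor 16. -/
theorem Regular.potential_double [Fintype ι] (h : C.Regular) {ε : ℝ} (hε : C.Admissible ε) :
    monoCr (C.double ε).pts (C.double ε).col + (C.double ε).potential ≤
      16 * (monoCr C.pts C.col + C.potential) := by
  have h1 := (hε.canonicalSigns h.pos h.mat).card_crossQuads_le h.pos h.mat
  rw [card_crossQuads h.pos] at h1
  have h2 := card_crossQuads (h.double hε).pos (C.double ε).col
  have h3 : (crossQuads (C.double ε).pts (C.double ε).col).card =
    (crossQuads (C.childPts ε) C.childCol).card := rfl
  rw [h3] at h2
  rw [h2] at h1
  have h4 : (8 * monoCr (C.double ε).pts (C.double ε).col : ℝ) ≤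
      16 * (8 * monoCr C.pts C.col) + 4 * ∑ p, ((C.sameSidePairs (C.childPts ε) p).card : ℝ) := by
    exact_mod_cast h1
  have h5 := Finset.sum_le_sum fun p (_ : p ∈ Finset.univ) =>
    vertexPotential_step h.pos h.mat h.det hε p
  rw [Finset.sum_add_distrib, Finset.sum_add_distrib, ← Finset.sum_div, ← Finset.mul_sum] at h5
  have h6 : (C.double ε).potential = ∑ p, (C.double ε).vertexPotential (p, false) +
      ∑ p, (C.double ε).vertexPotential (p, true) := by
    rw [potential, Fintype.sum_prod_type, ← Finset.sum_add_distrib]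
    refine Finset.sum_congr rfl fun p _ => ?_
    rw [Fintype.sum_bool, add_comm]
  rw [h6]
  unfold potential
  linarith

/-- For a natural number `n` one has `n ≤ n ^ 2`, so the quadratic terms outweigh the negative
linear ones. -/
theorem vertexPotential_nonneg [Fintype ι] (C : Config ι k) (p : ι) : 0 ≤ C.vertexPotential p := by
  have key : ∀ n : ℕ, (n : ℝ) / 12 ≤ (n : ℝ) ^ 2 / 4 := by
    intro n
    have : (n : ℝ) ≤ (n : ℝ) ^ 2 := by exact_mod_cast Nat.le_self_pow two_ne_zero n
    linarith [(Nat.cast_nonneg n : (0 : ℝ) ≤ n)]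
  unfold vertexPotential
  have : 0 ≤ ∑ c, (((C.sideCount 1 p c : ℝ) ^ 2 + (C.sideCount (-1) p c : ℝ) ^ 2) / 4 -
      ((C.sideCount 1 p c : ℝ) + C.sideCount (-1) p c) / 12) :=
    Finset.sum_nonneg fun c _ => by
      have h1 := key (C.sideCount 1 p c)
      have h2 := key (C.sideCount (-1) p c)
      linarith
  positivity

/-- The iterated construction can always be carried out. -/
theorem exists_smallEnough [Finite ι] (C : Config ι k) : ∃ ε, C.SmallEnough ε := by
  have hfin : ∀ t, Finite (Level ι t) := by
    intro t
    induction t with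
    | zero => assumption
    | succ t ih => exact @Finite.instProd (Level ι t) Bool ih _
  have hex : ∀ (t : ℕ) (D : Config (Level ι t) k), ∃ ε, D.Admissible ε := fun t D =>
    haveI := hfin t
    D.exists_admissible
  choose e he using hex
  -- An admissible distance at step `t` depends on the configuration produced by the earlier
  -- choices, so configurations are built by recursion first; the sequence of distances is then read
  -- off and shown to reproduce them.
  let D : (t : ℕ) → Config (Level ι t) k := fun t =>
    Nat.rec (motive := fun t => Config (Level ι t) k) C (fun t D => D.double (e t D)) t
  have hD : ∀ t, C.iter (fun t => e t (D t)) t = D t := by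
    intro t
    induction t with
    | zero => rfl
    | succ t ih =>
      change (C.iter _ t).double (e t (D t)) = (D t).double (e t (D t))
      rw [ih]
  refine ⟨fun t => e t (D t), fun t => ?_⟩
  change (C.iter (fun t => e t (D t)) t).Admissible (e t (D t))
  rw [hD]
  exact he t _

/-- Canonical signs involve only the old orientations and the matching, so configurations that agree
in these have doublings of the same order type. -/
theorem Regular.sameOrderType_double {C C' : Config ι k} (h : C.Regular) (h' : C'.Regular)
    (hs : SameOrderType C.pts C'.pts) (hmat : C.mat = C'.mat) {ε ε' : ℝ} (hε : C.Admissible ε)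
    (hε' : C'.Admissible ε') : SameOrderType (C.childPts ε) (C'.childPts ε') := by
  have hsg : ∀ a b c, sg C.pts a b c = sg C'.pts a b c := hs
  have h1 := hε.canonicalSigns h.pos h.mat
  have h2 := hε'.canonicalSigns h'.pos h'.mat
  refine sg_eq_of_representatives ?_ ?_
  · intro x y z hxy hxz hyz
    rw [h1.distinct x y z hxy hxz hyz, h2.distinct x y z hxy hxz hyz, hsg]
  · rintro p ⟨q, b⟩ hx
    by_cases hq : q = C.mat p
    · subst hq
      have := h2.partner p b
      rw [← hmat] at this
      rw [h1.partner, this, hsg]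
    · rw [h1.siblings p _ hx hq, h2.siblings p _ hx (hmat ▸ hq), hsg, hmat]

theorem Regular.mat_double_congr {C C' : Config ι k} (h : C.Regular) (h' : C'.Regular)
    (hs : SameOrderType C.pts C'.pts) (hmat : C.mat = C'.mat) {ε ε' : ℝ} (hε : 0 < ε)
    (hε' : 0 < ε') : (C.double ε).mat = (C'.double ε').mat := by
  have hsg : ∀ a b c, sg C.pts a b c = sg C'.pts a b c := hs
  funext x
  rw [leftDetails_double h.pos h.mat h.det hε, leftDetails_double h'.pos h'.mat h'.det hε', hmat,
    hsg]

/-- Order type, colouring and matching have to be carried along together: the new matching refers to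
left children, which the order type determines, and under `LeftDetails` colouring and matching
determine the details. -/
theorem Regular.iter_congr (h : C.Regular) {ε ε' : ℕ → ℝ} (hε : C.SmallEnough ε)
    (hε' : C.SmallEnough ε') (t : ℕ) : SameOrderType (C.iter ε t).pts (C.iter ε' t).pts ∧
      (C.iter ε t).col = (C.iter ε' t).col ∧ (C.iter ε t).mat = (C.iter ε' t).mat := by
  induction t with
  | zero => exact ⟨fun _ _ _ => rfl, rfl, rfl⟩
  | succ t ih =>
    obtain ⟨hs, hcol, hmat⟩ := ih
    have h1 := h.iter hε t
    have h2 := h.iter hε' t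
    refine ⟨h1.sameOrderType_double h2 hs hmat (hε t) (hε' t), ?_, ?_⟩
    · have hdet : (C.iter ε t).det = (C.iter ε' t).det := by
        funext p
        rw [h1.det p, h2.det p, hcol, hmat]
      change (C.iter ε t).childCol = (C.iter ε' t).childCol
      funext z
      induction z with
      | _ x y =>
        by_cases hxy : x.1 = y.1
        · rw [childCol_of_eq hxy, childCol_of_eq hxy, hdet]
        · rw [childCol_of_ne hxy, childCol_of_ne hxy, hcol]
    · exact h1.mat_double_congr h2 hs hmat (hε t).1 (hε' t).1

/-- The sequence `cr / 16 ^ t` is nondecreasing and bounded by crossings plus potential. Since `C(2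
^ t n, 4)` is asymptotic to `16 ^ t n ^ 4 / 24`, its limit is turned into the limit of the
construction by the factor `24 / n ^ 4`. -/
theorem Regular.exists_hasDoublingLimit [Fintype ι] (h : C.Regular) (hι : 0 < Fintype.card ι) :
    ∃ l, C.HasDoublingLimit l ∧
      l ≤ 24 * (monoCr C.pts C.col + C.potential) / (Fintype.card ι : ℝ) ^ 4 := by
  obtain ⟨ε₀, hε₀⟩ := C.exists_smallEnough
  set n := Fintype.card ι with hn
  have hn0 : (0 : ℝ) < n := by exact_mod_cast hι
  let cr : ℕ → ℝ := fun t => monoCr (C.iter ε₀ t).pts (C.iter ε₀ t).col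
  have hmono : Monotone fun t => cr t / 16 ^ t := by
    refine monotone_nat_of_le_succ fun t => ?_
    have h1 : (16 * cr t : ℝ) ≤ cr (t + 1) := by
      have h2 := (h.iter hε₀ t).monoCr_double (hε₀ t)
      have h3 : (16 : ℝ) * (monoCr (C.iter ε₀ t).pts (C.iter ε₀ t).col : ℕ) ≤
        (monoCr ((C.iter ε₀ t).double (ε₀ t)).pts ((C.iter ε₀ t).double (ε₀ t)).col : ℕ) := by
        exact_mod_cast h2
      exact h3
    rw [div_le_div_iff₀ (by positivity) (by positivity), pow_succ]
    nlinarith [pow_pos (by norm_num : (0 : ℝ) < 16) t]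
  have hpot : ∀ t, cr t + (C.iter ε₀ t).potential ≤
      16 ^ t * (monoCr C.pts C.col + C.potential) := by
    intro t
    induction t with
    | zero => simp [cr, Config.iter]; rfl
    | succ t ih =>
      have h1 : cr (t + 1) + (C.iter ε₀ (t + 1)).potential ≤
          16 * (cr t + (C.iter ε₀ t).potential) := (h.iter hε₀ t).potential_double (hε₀ t)
      rw [pow_succ]
      linarith
  have hbdd : ∀ t, cr t / 16 ^ t ≤ monoCr C.pts C.col + C.potential := by
    intro t
    rw [div_le_iff₀ (by positivity), mul_comm]
    have : 0 ≤ (C.iter ε₀ t).potential := Finset.sum_nonneg fun p _ => vertexPotential_nonneg _ p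
    linarith [hpot t]
  have hlim := tendsto_atTop_ciSup hmono ⟨_, by rintro _ ⟨t, rfl⟩; exact hbdd t⟩
  set u := ⨆ t, cr t / 16 ^ t with hu
  have hule : u ≤ monoCr C.pts C.col + C.potential := ciSup_le hbdd
  -- The sequence `ε₀` only served to define `u`; any other admissible sequence yields the same
  -- numbers of crossings.
  refine ⟨24 * u / (n : ℝ) ^ 4, ⟨⟨ε₀, hε₀⟩, fun ε hε => ?_⟩, by gcongr⟩
  have hcr : ∀ t, (monoCr (C.iter ε t).pts (C.iter ε t).col : ℝ) = cr t := by
    intro t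
    obtain ⟨hs, hcol, -⟩ := h.iter_congr hε hε₀ t
    rw [hcol, monoCr_congr (h.iter hε t).pos (h.iter hε₀ t).pos hs]
  have hNat : Filter.Tendsto (fun t : ℕ => 2 ^ t * n) Filter.atTop Filter.atTop :=
    Filter.Tendsto.atTop_mul_const' hι (tendsto_pow_atTop_atTop_of_one_lt (by norm_num))
  have hequiv := (isEquivalent_choose 4).comp_tendsto hNat
  have hE : Asymptotics.IsEquivalent Filter.atTop
      (fun t => cr t / (((2 ^ t * n).choose 4 : ℕ) : ℝ))
      (fun t => cr t / (((2 ^ t * n : ℕ) : ℝ) ^ 4 / (Nat.factorial 4 : ℝ))) :=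
    Asymptotics.IsEquivalent.refl.div hequiv
  simp only [hcr, Level.card, ← hn]
  rw [hE.tendsto_nhds_iff]
  have e : (fun t => cr t / (((2 ^ t * n : ℕ) : ℝ) ^ 4 / (Nat.factorial 4 : ℝ))) =
      fun t => 24 * (cr t / 16 ^ t) / (n : ℝ) ^ 4 := by
    funext t
    have : ((2 : ℝ) ^ t) ^ 4 = 16 ^ t := by
      rw [← pow_mul, mul_comm, pow_mul]; norm_num
    have h24 : ((Nat.factorial 4 : ℕ) : ℝ) = 24 := by norm_num [Nat.factorial]
    rw [h24]
    push_cast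
    rw [mul_pow, this]
    field_simp
  rw [e]
  exact (hlim.const_mul 24).div_const _

theorem HasDoublingLimit.unique {l l' : ℝ} (h : C.HasDoublingLimit l) (h' : C.HasDoublingLimit l') :
    l = l' := by
  obtain ⟨ε, hε⟩ := h.1
  exact tendsto_nhds_unique (h.2 ε hε) (h'.2 ε hε)

/-! ### Finiteness of the choices and existence of an optimal one -/

instance : Finite FirstTarget :=
  Finite.of_surjective (fun i : Fin 3 => ![FirstTarget.left, .right, .sibling] i) (by
    rintro (_ | _ | _)
    exacts [⟨0, rfl⟩, ⟨1, rfl⟩, ⟨2, rfl⟩])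

instance : Finite SecondTarget :=
  Finite.of_surjective (fun i : Fin 2 => ![SecondTarget.left, .right] i) (by
    rintro (_ | _)
    exacts [⟨0, rfl⟩, ⟨1, rfl⟩])

instance : Finite (Details k) :=
  Finite.of_surjective (fun d : Fin k × FirstTarget × SecondTarget =>
    (⟨d.1, d.2.1, d.2.2⟩ : Details k)) fun d => ⟨(d.color, d.first, d.second), rfl⟩

/-- Among the finitely many matchings and details there is a best one. -/
theorem exists_isOptimal [Finite ι] {l : ℝ} (hm : IsMatching C.mat) (hl : C.HasDoublingLimit l) :
    ∃ (m : ι → ι) (D : ι → Details k) (l' : ℝ), IsMatching m ∧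
      HasDoublingLimit { C with mat := m, det := D } l' ∧
      IsOptimal { C with mat := m, det := D } l' ∧ l' ≤ l := by
  -- Choices without a limit are left out of the minimisation; `IsOptimal` compares only with
  -- choices that have one.
  let T : Set ((ι → ι) × (ι → Details k)) := {x | IsMatching x.1 ∧
    ∃ l', HasDoublingLimit { C with mat := x.1, det := x.2 } l'}
  have hT : ∀ x ∈ T, ∃ l', HasDoublingLimit { C with mat := x.1, det := x.2 } l' :=
    fun x hx => hx.2
  choose! f hf using hT
  have hC : (C.mat, C.det) ∈ T := ⟨hm, l, hl⟩
  obtain ⟨x, hx, hmin⟩ := Set.exists_min_image T f T.toFinite ⟨_, hC⟩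
  refine ⟨x.1, x.2, f x, hx.1, hf x hx, ?_, ?_⟩
  · intro m D hm' l' hl'
    have hy : (m, D) ∈ T := ⟨hm', l', hl'⟩
    rw [← (hf _ hy).unique hl']
    exact hmin _ hy
  · rw [← (hf _ hC).unique hl]
    exact hmin _ hC

end Config

/-! ### Packed arithmetic

The functions below are evaluated by the kernel, so they are written with the primitive operations
on natural numbers. -/

/-- The sum of the first `n` values of `f`. -/
def sumTo (f : ℕ → ℕ) (n : ℕ) : ℕ := Nat.rec 0 (fun i s => Nat.add s (f i)) n

/-- The number with the `n` digits `f 0, f 1, …` in base `2 ^ w`, lowest digit first. -/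
def pk (w : ℕ) (f : ℕ → ℕ) (n : ℕ) : ℕ := sumTo (fun i => Nat.mul (f i) (Nat.pow 2 (Nat.mul w i))) n

/-- The digit number `i` of `A` in base `2 ^ w`. -/
def field (w A i : ℕ) : ℕ := Nat.mod (Nat.shiftRight A (Nat.mul w i)) (Nat.pow 2 w)

/-- The number with `n` binary digits, all of them `1`. -/
def ones (n : ℕ) : ℕ := Nat.sub (Nat.pow 2 n) 1

/-- The mask selecting every second digit in base `2 ^ s`. -/
def mask (s : ℕ) : ℕ := Nat.mul (Nat.div (ones 32768) (ones (Nat.mul 2 s))) (ones s)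

/-- Adding neighbouring digits in base `2 ^ s`. -/
def fold (s v : ℕ) : ℕ := Nat.add (Nat.land v (mask s)) (Nat.land (Nat.shiftRight v s) (mask s))

/-- The number of binary digits `1` of `v < 2 ^ 32768`. -/
def pop (v : ℕ) : ℕ := Nat.mod (fold 8 (fold 4 (fold 2 (fold 1 v)))) (ones 16)

theorem sumTo_eq (f : ℕ → ℕ) (n : ℕ) : sumTo f n = ∑ i ∈ Finset.range n, f i := by
  induction n with
  | zero => rfl
  | succ n ih => rw [Finset.sum_range_succ, ← ih]; rfl

theorem pk_eq (w : ℕ) (f : ℕ → ℕ) (n : ℕ) : pk w f n = ∑ i ∈ Finset.range n, f i * 2 ^ (w * i) :=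
  sumTo_eq _ _

theorem pk_succ (w : ℕ) (f : ℕ → ℕ) (n : ℕ) : pk w f (n + 1) = pk w f n + f n * 2 ^ (w * n) := rfl

theorem ones_eq (n : ℕ) : ones n = 2 ^ n - 1 := rfl

theorem field_lt (w A i : ℕ) : field w A i < 2 ^ w := Nat.mod_lt _ (Nat.two_pow_pos w)

theorem pk_congr {w n : ℕ} {f g : ℕ → ℕ} (h : ∀ i < n, f i = g i) : pk w f n = pk w g n := by
  rw [pk_eq, pk_eq]
  exact Finset.sum_congr rfl fun i hi => by rw [h i (Finset.mem_range.1 hi)]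

theorem pk_lt {w n : ℕ} {f : ℕ → ℕ} (h : ∀ i < n, f i < 2 ^ w) : pk w f n < 2 ^ (w * n) := by
  induction n with
  | zero => simp [pk_eq]
  | succ n ih =>
    have h1 := ih fun i hi => h i (by omega)
    have h2 : f n + 1 ≤ 2 ^ w := h n (by omega)
    have h3 : 2 ^ (w * (n + 1)) = 2 ^ w * 2 ^ (w * n) := by rw [← pow_add]; congr 1; ring
    rw [pk_succ, h3]
    nlinarith [Nat.mul_le_mul_right (2 ^ (w * n)) h2]

/-- Digits smaller than the base do not overlap, so the binary digits of the packed number are those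
of its digits. Nearly all bit operations below are verified through this. -/
theorem testBit_pk {w n : ℕ} {f : ℕ → ℕ} (h : ∀ i < n, f i < 2 ^ w) (i : ℕ) {j : ℕ} (hj : j < w) :
    (pk w f n).testBit (w * i + j) = (decide (i < n) && (f i).testBit j) := by
  induction n with
  | zero => simp [pk_eq]
  | succ n ih =>
    have h0 : ∀ i < n, f i < 2 ^ w := fun i hi => h i (by omega)
    rw [pk_succ, add_comm, mul_comm (f n), Nat.testBit_two_pow_mul_add _ (pk_lt h0), ih h0]
    rcases lt_trichotomy i n with hi | rfl | hi
    · have : w * i + j < w * n := by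
        have := Nat.mul_le_mul_left w hi
        rw [Nat.succ_eq_add_one, mul_add] at this
        omega
      rw [if_pos this]; simp [hi, Nat.lt_succ_of_lt hi]
    · rw [if_neg (by omega)]; simp
    · have : w * n + w ≤ w * i := by
        have := Nat.mul_le_mul_left w hi
        rwa [Nat.succ_eq_add_one, mul_add, mul_one] at this
      rw [if_neg (by omega)]
      have h1 : f n < 2 ^ (w * i + j - w * n) :=
        (h n (by omega)).trans_le (Nat.pow_le_pow_right (by norm_num) (by omega))
      rw [Nat.testBit_lt_two_pow h1]
      simp; omega

theorem testBit_ext_digits {w a b : ℕ} (hw : 0 < w)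
    (h : ∀ i j, j < w → a.testBit (w * i + j) = b.testBit (w * i + j)) : a = b := by
  refine Nat.eq_of_testBit_eq fun t => ?_
  have := h (t / w) (t % w) (Nat.mod_lt _ hw)
  rwa [Nat.div_add_mod] at this

theorem pk_add (w n : ℕ) (f g : ℕ → ℕ) : pk w f n + pk w g n = pk w (fun i => f i + g i) n := by
  simp only [pk_eq, add_mul, Finset.sum_add_distrib]

theorem mul_pk (w n a : ℕ) (f : ℕ → ℕ) : a * pk w f n = pk w (fun i => a * f i) n := by
  simp only [pk_eq, Finset.mul_sum, mul_assoc]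

theorem pk_mul (w n a : ℕ) (f : ℕ → ℕ) : pk w f n * a = pk w (fun i => f i * a) n := by
  rw [mul_comm, mul_pk]
  exact pk_congr fun i _ => mul_comm _ _

/-- No borrowing occurs when every digit of the subtrahend is at most the corresponding digit of the
minuend. -/
theorem pk_sub {w n : ℕ} {f g : ℕ → ℕ} (h : ∀ i < n, g i ≤ f i) :
    pk w f n - pk w g n = pk w (fun i => f i - g i) n := by
  have : pk w (fun i => f i - g i) n + pk w g n = pk w f n := by
    rw [pk_add]
    exact pk_congr fun i hi => Nat.sub_add_cancel (h i hi)
  omega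

/-- Modulo `2 ^ s - 1` the power `2 ^ s` is `1`, so the spacing of the digits shrinks from `s + w`
to `w`. With `w = 0` this adds up all digits; with `w = 1` it compresses a column into a row. -/
theorem pk_mod (s w n : ℕ) (f : ℕ → ℕ) :
    pk (s + w) f n ≡ pk w f n [MOD 2 ^ s - 1] := by
  simp only [pk_eq, Nat.ModEq.eq_1]
  refine Nat.ModEq.sum fun i _ => Nat.ModEq.mul_left _ ?_
  have h : 2 ^ s ≡ 1 [MOD 2 ^ s - 1] := by
    conv_lhs => rw [← Nat.sub_add_cancel (Nat.one_le_two_pow (n := s))]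
    simp [Nat.ModEq]
  calc 2 ^ ((s + w) * i) = (2 ^ s) ^ i * 2 ^ (w * i) := by rw [← pow_mul, ← pow_add, add_mul]
    _ ≡ 1 ^ i * 2 ^ (w * i) [MOD 2 ^ s - 1] := (h.pow i).mul_right _
    _ = 2 ^ (w * i) := by simp

theorem pk_zero_eq (f : ℕ → ℕ) (n : ℕ) : pk 0 f n = ∑ i ∈ Finset.range n, f i := by simp [pk_eq]

theorem pk_pk (w n : ℕ) (f : ℕ → ℕ) :
    pk w (fun i => pk 1 (fun j => f (w * i + j)) w) n = pk 1 f (w * n) := by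
  induction n with
  | zero => simp [pk_eq]
  | succ n ih =>
    rw [pk_succ, ih, pk_eq, pk_eq, pk_eq, mul_add, mul_one, Finset.sum_range_add, Finset.sum_mul]
    congr 1
    refine Finset.sum_congr rfl fun i _ => ?_
    rw [mul_assoc, ← pow_add]; congr 2; ring

theorem sum_range_mul (w n : ℕ) (f : ℕ → ℕ) :
    ∑ t ∈ Finset.range (w * n), f t =
      ∑ i ∈ Finset.range n, ∑ j ∈ Finset.range w, f (w * i + j) := by
  induction n with
  | zero => simp
  | succ n ih => rw [Finset.sum_range_succ, ← ih, mul_add, mul_one, Finset.sum_range_add]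

/-! ### Counting the digits `1` -/

theorem mask_def (s : ℕ) : mask s = ones 32768 / ones (2 * s) * ones s := rfl

/-- The quotient in the definition of `mask` is a geometric series: a digit `1` in every place of
base `2 ^ (2 s)`. -/
theorem mask_eq {s N : ℕ} (hs : 0 < s) (hN : 2 * s * N = 32768) :
    mask s = pk (2 * s) (fun _ => ones s) N := by
  have h : pk (2 * s) (fun _ => ones s) N = (∑ i ∈ Finset.range N, (2 ^ (2 * s)) ^ i) * ones s := by
    rw [pk_eq, Finset.sum_mul]
    exact Finset.sum_congr rfl fun i _ => by rw [← pow_mul, mul_comm]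
  rw [h, Nat.geomSum_eq (Nat.one_lt_two_pow (by omega)), ← pow_mul, hN, mask_def, ones_eq (2 * s),
    ones_eq 32768]

theorem testBit_ones (n j : ℕ) : (ones n).testBit j = decide (j < n) := by
  rw [ones_eq, Nat.testBit_two_pow_sub_one]

theorem ones_lt (n : ℕ) : ones n < 2 ^ n := by
  have : 0 < 2 ^ n := by positivity
  rw [ones_eq]; omega

/-- The mask isolates the digits of even index, and after a shift by one place those of odd index.
Both are then digits in base `2 ^ (2 s)` and are added place by place. -/
theorem fold_pk {s N : ℕ} (hs : 0 < s) (hN : 2 * s * N = 32768) {d : ℕ → ℕ}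
    (hd : ∀ i < 2 * N, d i < 2 ^ s) :
    fold s (pk s d (2 * N)) = pk (2 * s) (fun i => d (2 * i) + d (2 * i + 1)) N := by
  have hss : 2 ^ s ≤ 2 ^ (2 * s) := Nat.pow_le_pow_right (by norm_num) (by omega)
  have hm : ∀ i j, j < 2 * s → (mask s).testBit (2 * s * i + j) =
      (decide (i < N) && decide (j < s)) := by
    intro i j hj
    rw [mask_eq hs hN, testBit_pk (fun _ _ => (ones_lt s).trans_le hss) i hj, testBit_ones]
  have h0 : pk s d (2 * N) &&& mask s = pk (2 * s) (fun i => d (2 * i)) N := by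
    refine testBit_ext_digits (w := 2 * s) (by omega) fun i j hj => ?_
    rw [Nat.testBit_and, hm i j hj,
      testBit_pk (fun i hi => (hd (2 * i) (by omega)).trans_le hss) i hj]
    by_cases hi : i < N
    · by_cases hjs : j < s
      · have e : 2 * s * i + j = s * (2 * i) + j := by ring
        rw [e, testBit_pk hd _ hjs]
        simp [hi, hjs]
      · have : (d (2 * i)).testBit j = false := Nat.testBit_lt_two_pow
          ((hd (2 * i) (by omega)).trans_le (Nat.pow_le_pow_right (by norm_num) (by omega)))
        simp [hjs, this]
    · simp [hi]
  have h1 : (pk s d (2 * N) >>> s) &&& mask s = pk (2 * s) (fun i => d (2 * i + 1)) N := by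
    refine testBit_ext_digits (w := 2 * s) (by omega) fun i j hj => ?_
    rw [Nat.testBit_and, hm i j hj, Nat.testBit_shiftRight,
      testBit_pk (fun i hi => (hd (2 * i + 1) (by omega)).trans_le hss) i hj]
    by_cases hi : i < N
    · by_cases hjs : j < s
      · have e : s + (2 * s * i + j) = s * (2 * i + 1) + j := by ring
        rw [e, testBit_pk hd _ hjs]
        simp [hi, hjs]
        omega
      · have : (d (2 * i + 1)).testBit j = false := Nat.testBit_lt_two_pow
          ((hd (2 * i + 1) (by omega)).trans_le (Nat.pow_le_pow_right (by norm_num) (by omega)))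
        simp [hjs, this]
    · simp [hi]
  calc fold s (pk s d (2 * N))
      = (pk s d (2 * N) &&& mask s) + ((pk s d (2 * N) >>> s) &&& mask s) := rfl
    _ = _ := by rw [h0, h1, pk_add]

theorem pop_pk {d : ℕ → ℕ} (hd : ∀ i, d i ≤ 1) :
    pop (pk 1 d 32768) = ∑ i ∈ Finset.range 32768, d i := by
  have key : ∀ N : ℕ, ∀ e : ℕ → ℕ, ∑ i ∈ Finset.range (2 * N), e i =
      ∑ i ∈ Finset.range N, (e (2 * i) + e (2 * i + 1)) := by
    intro N e
    rw [sum_range_mul]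
    simp [Finset.sum_range_succ]
  -- After the folds up to width `s` each digit counts the ones in a block of `s` binary digits, so
  -- it is at most `s < 2 ^ s` and fits into its place.
  have step : ∀ (s N : ℕ) (e : ℕ → ℕ), 0 < s → 2 * s * N = 32768 → s < 2 ^ s → (∀ i, e i ≤ s) →
      ∃ e' : ℕ → ℕ, (∀ i, e' i ≤ 2 * s) ∧ fold s (pk s e (2 * N)) = pk (2 * s) e' N ∧
        ∑ i ∈ Finset.range (2 * N), e i = ∑ i ∈ Finset.range N, e' i := by
    intro s N e hs hN h1 he
    refine ⟨fun i => e (2 * i) + e (2 * i + 1), fun i => ?_,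
      fold_pk hs hN fun i _ => (he i).trans_lt h1, key N e⟩
    have := he (2 * i)
    have := he (2 * i + 1)
    show e (2 * i) + e (2 * i + 1) ≤ 2 * s
    omega
  obtain ⟨e1, h1, f1, s1⟩ := step 1 16384 d (by norm_num) (by norm_num) (by norm_num) hd
  obtain ⟨e2, h2, f2, s2⟩ := step 2 8192 e1 (by norm_num) (by norm_num) (by norm_num) h1
  obtain ⟨e3, h3, f3, s3⟩ := step 4 4096 e2 (by norm_num) (by norm_num) (by norm_num) h2
  obtain ⟨e4, h4, f4, s4⟩ := step 8 2048 e3 (by norm_num) (by norm_num) (by norm_num) h3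
  norm_num only at f1 f2 f3 f4 s1 s2 s3 s4
  -- The total is at most `32768 < 2 ^ 16 - 1`, so the final reduction, which adds up the digits,
  -- returns the sum itself.
  have hle : ∑ i ∈ Finset.range 2048, e4 i ≤ 2048 * 16 := by
    simpa using Finset.sum_le_card_nsmul (Finset.range 2048) e4 16 fun i _ => h4 i
  have hm := pk_mod 16 0 2048 e4
  rw [pk_zero_eq] at hm
  calc pop (pk 1 d 32768) = fold 8 (fold 4 (fold 2 (fold 1 (pk 1 d 32768)))) % (2 ^ 16 - 1) := rfl
    _ = pk (16 + 0) e4 2048 % (2 ^ 16 - 1) := by rw [f1, f2, f3, f4]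
    _ = (∑ i ∈ Finset.range 2048, e4 i) % (2 ^ 16 - 1) := hm
    _ = ∑ i ∈ Finset.range 2048, e4 i := Nat.mod_eq_of_lt (by norm_num; omega)
    _ = _ := by rw [s1, s2, s3, s4]

theorem pop_pk_of_le {d : ℕ → ℕ} (hd : ∀ i, d i ≤ 1) {n : ℕ} (hn : n ≤ 32768) :
    pop (pk 1 d n) = ∑ i ∈ Finset.range n, d i := by
  have h : ∀ a : ℕ → ℕ, ∑ i ∈ Finset.range n, d i * a i =
      ∑ i ∈ Finset.range 32768, (if i < n then d i else 0) * a i := by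
    intro a
    rw [← Finset.sum_subset (Finset.range_subset_range.2 hn)]
    · exact Finset.sum_congr rfl fun i hi => by rw [if_pos (Finset.mem_range.1 hi)]
    · intro i _ hi
      rw [if_neg (by simpa using hi), zero_mul]
  have h1 := h fun _ => 1
  have h2 := h fun i => 2 ^ (1 * i)
  simp only [mul_one] at h1
  rw [pk_eq, h2, h1, ← pk_eq, pop_pk]
  intro i
  split_ifs
  · exact hd i
  · simp

/-! ### Packed sets and relations -/

/-- The packed form of a subset of `{0, …, n - 1}`. -/
def row (n : ℕ) (p : ℕ → Bool) : ℕ := pk 1 (fun j => (p j).toNat) n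

/-- The packed form of a subset of `{0, …, n - 1}`, with digits at distance `n + 1`. -/
def column (n : ℕ) (p : ℕ → Bool) : ℕ := pk (n + 1) (fun i => (p i).toNat) n

/-- The packed form of a relation on `{0, …, n - 1}`. -/
def relation (n : ℕ) (P : ℕ → ℕ → Bool) : ℕ := pk (n + 1) (fun i => row n (P i)) n

theorem toNat_lt_two_pow (b : Bool) {w : ℕ} (hw : 0 < w) : b.toNat < 2 ^ w :=
  (Bool.toNat_lt b).trans_le (by simpa using Nat.pow_le_pow_right (n := 2) (by norm_num) hw)

theorem row_lt (n : ℕ) (p : ℕ → Bool) : row n p < 2 ^ n := by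
  have := pk_lt (w := 1) (n := n) fun i _ => toNat_lt_two_pow (p i) one_pos
  rwa [one_mul] at this

theorem row_lt' (n : ℕ) (p : ℕ → Bool) : row n p < 2 ^ (n + 1) :=
  (row_lt n p).trans_le (Nat.pow_le_pow_right (by norm_num) (by omega))

theorem testBit_row (n : ℕ) (p : ℕ → Bool) (j : ℕ) :
    (row n p).testBit j = (decide (j < n) && p j) := by
  have := testBit_pk (w := 1) (n := n) (fun i _ => toNat_lt_two_pow (p i) one_pos) j one_pos
  rwa [one_mul, add_zero, Nat.testBit_bool_toNat, decide_eq_true rfl, Bool.true_and] at this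

theorem testBit_column (n : ℕ) (p : ℕ → Bool) (i : ℕ) {j : ℕ} (hj : j < n + 1) :
    (column n p).testBit ((n + 1) * i + j) = (decide (i < n) && (decide (j = 0) && p i)) := by
  rw [column, testBit_pk (fun i _ => toNat_lt_two_pow (p i) (by omega)) i hj,
    Nat.testBit_bool_toNat]

theorem testBit_relation (n : ℕ) (P : ℕ → ℕ → Bool) (i : ℕ) {j : ℕ} (hj : j < n + 1) :
    (relation n P).testBit ((n + 1) * i + j) = (decide (i < n) && (decide (j < n) && P i j)) := by
  rw [relation, testBit_pk (fun i _ => row_lt' n (P i)) i hj, testBit_row]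

theorem row_congr {n : ℕ} {p q : ℕ → Bool} (h : ∀ i < n, p i = q i) : row n p = row n q :=
  pk_congr fun i hi => by rw [h i hi]

theorem relation_congr {n : ℕ} {P Q : ℕ → ℕ → Bool} (h : ∀ i < n, ∀ j < n, P i j = Q i j) :
    relation n P = relation n Q :=
  pk_congr fun i hi => row_congr fun j hj => h i hi j hj

theorem ones_eq_row (n : ℕ) : ones n = row n fun _ => true := by
  refine Nat.eq_of_testBit_eq fun j => ?_
  rw [testBit_ones, testBit_row, Bool.and_true]

theorem row_land (n : ℕ) (p q : ℕ → Bool) : row n p &&& row n q = row n fun j => p j && q j := by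
  refine Nat.eq_of_testBit_eq fun j => ?_
  rw [Nat.testBit_and, testBit_row, testBit_row, testBit_row]
  cases decide (j < n) <;> simp

theorem row_lor (n : ℕ) (p q : ℕ → Bool) : row n p ||| row n q = row n fun j => p j || q j := by
  refine Nat.eq_of_testBit_eq fun j => ?_
  rw [Nat.testBit_or, testBit_row, testBit_row, testBit_row]
  cases decide (j < n) <;> simp

theorem relation_land_right (n : ℕ) (P : ℕ → ℕ → Bool) (B : ℕ) :
    relation n P &&& B = relation n fun i j => P i j && B.testBit ((n + 1) * i + j) := by
  refine testBit_ext_digits (w := n + 1) (by omega) fun i j hj => ?_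
  rw [Nat.testBit_and, testBit_relation _ _ _ hj, testBit_relation _ _ _ hj]
  simp only [Bool.and_assoc]

theorem relation_land (n : ℕ) (P Q : ℕ → ℕ → Bool) :
    relation n P &&& relation n Q = relation n fun i j => P i j && Q i j := by
  rw [relation_land_right]
  refine relation_congr fun i hi j hj => ?_
  rw [testBit_relation _ _ _ (by omega)]
  simp [hi, hj]

theorem relation_lor (n : ℕ) (P Q : ℕ → ℕ → Bool) :
    relation n P ||| relation n Q = relation n fun i j => P i j || Q i j := by
  refine testBit_ext_digits (w := n + 1) (by omega) fun i j hj => ?_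
  rw [Nat.testBit_or, testBit_relation _ _ _ hj, testBit_relation _ _ _ hj,
    testBit_relation _ _ _ hj]
  cases decide (i < n) <;> cases decide (j < n) <;> simp

theorem relation_xor (n : ℕ) (P Q : ℕ → ℕ → Bool) :
    relation n P ^^^ relation n Q = relation n fun i j => P i j ^^ Q i j := by
  refine testBit_ext_digits (w := n + 1) (by omega) fun i j hj => ?_
  rw [Nat.testBit_xor, testBit_relation _ _ _ hj, testBit_relation _ _ _ hj,
    testBit_relation _ _ _ hj]
  cases decide (i < n) <;> cases decide (j < n) <;> simp

/-- Multiplying a digit `0` or `1` by `2 ^ n - 1` fills its row with that bit, while multiplying a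
row by a column of ones copies the row into every place. Together they give the two cylinders whose
intersection is a product of sets. -/
theorem column_mul_ones (n : ℕ) (p : ℕ → Bool) :
    column n p * ones n = relation n fun i _ => p i := by
  rw [column, pk_mul]
  refine pk_congr fun i _ => ?_
  cases h : p i
  · simp [row, pk_eq, h]
  · simp [ones_eq_row, h]

theorem row_mul_column (n : ℕ) (q : ℕ → Bool) :
    row n q * column n (fun _ => true) = relation n fun _ j => q j := by
  rw [column, mul_pk]
  exact pk_congr fun i _ => by simp

theorem row_lt_ones {n : ℕ} {p : ℕ → Bool} (h : ∃ i < n, p i = false) : row n p < ones n := by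
  obtain ⟨i, hi, hp⟩ := h
  have h1 := row_lt n p
  have h2 : row n p ≠ ones n := by
    intro e
    have := congrArg (fun x => x.testBit i) e
    simp only [testBit_row, testBit_ones, hp] at this
    simp [hi] at this
  rw [ones_eq] at h2 ⊢
  omega

/-- The residue modulo `2 ^ n - 1` recovers the row unless all its `n` bits are ones, since that
number is congruent to `0`. -/
theorem column_mod {n : ℕ} {p : ℕ → Bool} (h : ∃ i < n, p i = false) :
    column n p % ones n = row n p := by
  have : column n p % ones n = row n p % ones n := pk_mod n 1 n _
  rw [this, Nat.mod_eq_of_lt (row_lt_ones h)]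

/-- Bit `n`, the top bit of every place of width `n + 1`, is moved to the bottom and kept. -/
theorem shift_land_column {n : ℕ} {h : ℕ → ℕ} (hh : ∀ i < n, h i < 2 ^ (n + 1)) :
    (pk (n + 1) h n >>> n) &&& column n (fun _ => true) = column n fun i => (h i).testBit n := by
  refine testBit_ext_digits (w := n + 1) (by omega) fun i j hj => ?_
  rw [Nat.testBit_and, testBit_column _ _ _ hj, testBit_column _ _ _ hj, Nat.testBit_shiftRight]
  rcases Nat.eq_zero_or_pos j with rfl | hj0
  · have e : n + ((n + 1) * i + 0) = (n + 1) * i + n := by ring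
    rw [e, testBit_pk hh i (by omega)]
    cases decide (i < n) <;> simp
  · simp [hj0.ne']

/-- This extracts a column of the relation; followed by `column_mod` it transposes it into a row. -/
theorem relation_shift_land_column {n : ℕ} (P : ℕ → ℕ → Bool) {p : ℕ} (hp : p < n) :
    (relation n P >>> p) &&& column n (fun _ => true) = column n fun i => P i p := by
  refine testBit_ext_digits (w := n + 1) (by omega) fun i j hj => ?_
  rw [Nat.testBit_and, testBit_column _ _ _ hj, testBit_column _ _ _ hj, Nat.testBit_shiftRight]
  rcases Nat.eq_zero_or_pos j with rfl | hj0
  · have e : p + ((n + 1) * i + 0) = (n + 1) * i + p := by ring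
    rw [e, testBit_relation _ _ _ (by omega)]
    simp only [hp, decide_true]
    cases decide (i < n) <;> simp
  · simp [hj0.ne']

theorem field_pk {w n : ℕ} {f : ℕ → ℕ} (h : ∀ i < n, f i < 2 ^ w) {i : ℕ} (hi : i < n) :
    field w (pk w f n) i = f i := by
  refine Nat.eq_of_testBit_eq fun j => ?_
  have e : field w (pk w f n) i = (pk w f n >>> (w * i)) % 2 ^ w := rfl
  rw [e, Nat.testBit_mod_two_pow, Nat.testBit_shiftRight]
  by_cases hj : j < w
  · rw [testBit_pk h i hj]; simp [hi, hj]
  · have := Nat.testBit_lt_two_pow ((h i hi).trans_le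
      (Nat.pow_le_pow_right (by norm_num) (not_lt.1 hj)))
    simp [hj, this]

theorem pop_row {n : ℕ} (hn : n ≤ 32768) (p : ℕ → Bool) :
    pop (row n p) = ∑ j ∈ Finset.range n, (p j).toNat :=
  pop_pk_of_le (fun i => Bool.toNat_le (p i)) hn

theorem pop_relation {n : ℕ} (hn : (n + 1) * n ≤ 32768) (P : ℕ → ℕ → Bool) :
    pop (relation n P) = ∑ i ∈ Finset.range n, ∑ j ∈ Finset.range n, (P i j).toNat := by
  -- The relation is read as one string of bits of length `(n + 1) n`; the spare bit of each place
  -- is `0` and does not affect the count.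
  let f : ℕ → ℕ := fun t => (decide (t % (n + 1) < n) && P (t / (n + 1)) (t % (n + 1))).toNat
  have hf : ∀ i, ∀ j < n + 1, f ((n + 1) * i + j) = (decide (j < n) && P i j).toNat := by
    intro i j hj
    simp only [f, Nat.mul_add_mod, Nat.mod_eq_of_lt hj, Nat.mul_add_div (Nat.succ_pos n),
      Nat.div_eq_of_lt hj, add_zero]
  have e : relation n P = pk 1 f ((n + 1) * n) := by
    rw [← pk_pk]
    refine pk_congr fun i _ => ?_
    rw [pk_succ, hf i n (by omega)]
    simp only [lt_irrefl, decide_false, Bool.false_and, Bool.toNat_false, zero_mul, add_zero]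
    refine pk_congr fun j hj => ?_
    rw [hf i j (by omega)]
    simp [hj]
  rw [e, pop_pk_of_le (fun i => Bool.toNat_le _) hn, sum_range_mul]
  refine Finset.sum_congr rfl fun i _ => ?_
  rw [Finset.sum_congr rfl fun j hj => hf i j (Finset.mem_range.1 hj), Finset.sum_range_succ]
  simp only [lt_irrefl, decide_false, Bool.false_and, Bool.toNat_false, add_zero]
  refine Finset.sum_congr rfl fun j hj => ?_
  rw [decide_eq_true (Finset.mem_range.1 hj), Bool.true_and]

/-! ### Drawings with integer coordinates -/

/-- The coordinates of `A`, with digits at distance `n + 1`. -/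
def lanes (n A : ℕ) : ℕ := pk (Nat.succ n) (field 32 A) n

/-- The number with `n` digits `1` in base `2 ^ (n + 1)`. -/
def unit (n : ℕ) : ℕ := pk (Nat.succ n) (fun _ => 1) n

/-- All orientations with respect to the points `(ax, ay)` and `(bx, c)` at once. -/
def posAux (n X Y J ax ay bx c : ℕ) : ℕ :=
  Nat.land (Nat.shiftRight (Nat.sub
    (Nat.add (Nat.add (Nat.mul bx Y) (Nat.mul ay X)) (Nat.mul (Nat.add (Nat.mul ax c) (ones n)) J))
    (Nat.add (Nat.add (Nat.mul ax Y) (Nat.mul c X)) (Nat.mul (Nat.mul bx ay) J))) n) J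

/-- The points to the left of the line from `a` to `b`, with digits at distance `n + 1`. -/
def posLanes (n xs ys a b : ℕ) : ℕ :=
  posAux n (lanes n xs) (lanes n ys) (unit n) (field 32 xs a) (field 32 ys a) (field 32 xs b)
    (field 32 ys b)

/-- The points to the left of the line from `a` to `b`. -/
def posMask (n xs ys a b : ℕ) : ℕ := Nat.mod (posLanes n xs ys a b) (ones n)

/-- The pairs `(b, c)` such that `c` is to the left of the line from `a` to `b`. -/
def posMatrix (n xs ys a : ℕ) : ℕ := pk (Nat.succ n) (posMask n xs ys a) n

/-- The point `c` is to the left of the line from `a` to `b`. -/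
def leftOf (xs ys a b c : ℕ) : Bool :=
  decide (field 32 xs a * field 32 ys c + field 32 ys b * field 32 xs c +
      field 32 xs b * field 32 ys a <
    field 32 xs b * field 32 ys c + field 32 ys a * field 32 xs c + field 32 xs a * field 32 ys b)

theorem leftOf_self_outer (xs ys a b : ℕ) : leftOf xs ys a b a = false := by
  simp only [leftOf, decide_eq_false_iff_not, not_lt]
  apply le_of_eq; ring

theorem unit_eq (n : ℕ) : unit n = column n fun _ => true := rfl

/-- In the place of `c` the difference equals the signed area of `a b c` plus `2 ^ n - 1`. Its bit
`n` is therefore set exactly when the signed area is at least `1`, so one subtraction treats all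
points `c`. -/
theorem posLanes_eq {n : ℕ} (hn : 67 ≤ n) (xs ys a b : ℕ) :
    posLanes n xs ys a b = column n (leftOf xs ys a b) := by
  set x := field 32 xs with hx
  set y := field 32 ys with hy
  have hprod : ∀ {u v : ℕ}, u < 2 ^ 32 → v < 2 ^ 32 → u * v < 2 ^ 64 := fun hu hv => by
    have := Nat.mul_lt_mul'' hu hv
    simpa [← pow_add] using this
  have hxl : ∀ i, x i < 2 ^ 32 := fun i => field_lt 32 xs i
  have hyl : ∀ i, y i < 2 ^ 32 := fun i => field_lt 32 ys i
  have hbig : 2 ^ 67 ≤ 2 ^ n := Nat.pow_le_pow_right (by norm_num) hn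
  have h1 : posLanes n xs ys a b =
      ((x b * pk (n + 1) y n + y a * pk (n + 1) x n +
          (x a * y b + ones n) * pk (n + 1) (fun _ => 1) n -
        (x a * pk (n + 1) y n + y b * pk (n + 1) x n + x b * y a * pk (n + 1) (fun _ => 1) n))
        >>> n) &&& column n (fun _ => true) := rfl
  let h : ℕ → ℕ := fun c => x b * y c + y a * x c + (x a * y b + ones n) * 1 -
    (x a * y c + y b * x c + x b * y a * 1)
  -- Coordinates are below `2 ^ 32`, so a sum of three products is below `2 ^ 67 ≤ 2 ^ n`. Hence
  -- every place neither borrows from nor overflows into the next one.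
  have hbound : ∀ c, x a * y c + y b * x c + x b * y a * 1 ≤
      x b * y c + y a * x c + (x a * y b + ones n) * 1 ∧ h c < 2 ^ (n + 1) ∧
      (2 ^ n ≤ h c ↔ x a * y c + y b * x c + x b * y a < x b * y c + y a * x c + x a * y b) := by
    intro c
    have b1 := hprod (hxl a) (hyl c)
    have b2 := hprod (hyl b) (hxl c)
    have b3 := hprod (hxl b) (hyl a)
    have b4 := hprod (hxl b) (hyl c)
    have b5 := hprod (hyl a) (hxl c)
    have b6 := hprod (hxl a) (hyl b)
    have e : 2 ^ (n + 1) = 2 * 2 ^ n := by ring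
    simp only [h, ones_eq, mul_one, e]
    generalize 2 ^ n = M at *
    norm_num at b1 b2 b3 b4 b5 b6 hbig
    omega
  rw [h1, mul_pk, mul_pk, mul_pk, mul_pk, mul_pk, mul_pk, pk_add, pk_add, pk_add, pk_add,
    pk_sub fun c _ => (hbound c).1, shift_land_column fun c _ => (hbound c).2.1]
  refine pk_congr fun c _ => congrArg Bool.toNat ?_
  have e1 : (h c).testBit n = decide (2 ^ n ≤ h c) := by
    by_cases hc : 2 ^ n ≤ h c
    · rw [decide_eq_true hc]
      exact Nat.testBit_of_two_pow_le_and_two_pow_add_one_gt hc (hbound c).2.1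
    · rw [decide_eq_false hc]
      exact Nat.testBit_lt_two_pow (not_le.1 hc)
  exact e1.trans (decide_eq_decide.2 (hbound c).2.2)

/-- The point `a` is not to the left of a line through itself, so the row is not all ones and the
reduction is faithful. -/
theorem posMask_eq {n : ℕ} (hn : 67 ≤ n) (xs ys : ℕ) {a : ℕ} (ha : a < n) (b : ℕ) :
    posMask n xs ys a b = row n (leftOf xs ys a b) := by
  have : posMask n xs ys a b = posLanes n xs ys a b % ones n := rfl
  rw [this, posLanes_eq hn, column_mod ⟨a, ha, leftOf_self_outer xs ys a b⟩]

theorem posMatrix_eq {n : ℕ} (hn : 67 ≤ n) (xs ys : ℕ) {a : ℕ} (ha : a < n) :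
    posMatrix n xs ys a = relation n (leftOf xs ys a) :=
  pk_congr fun b _ => posMask_eq hn xs ys ha b

/-- The sum over all pairs `a < b < n`. -/
def sumPairs (f : ℕ → ℕ → ℕ) (n : ℕ) : ℕ := sumTo (fun b => sumTo (fun a => f a b) b) n

theorem sumPairs_eq (f : ℕ → ℕ → ℕ) (n : ℕ) :
    sumPairs f n = ∑ b ∈ Finset.range n, ∑ a ∈ Finset.range b, f a b := by
  simp only [sumPairs, sumTo_eq]

/-- This number is `0` if and only if no three points are on a line. -/
def degeneracy (n xs ys : ℕ) : ℕ :=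
  sumPairs (fun a b => Nat.xor (ones n)
    (Nat.lor (Nat.lor (posMask n xs ys a b) (posMask n xs ys b a))
      (Nat.lor (Nat.pow 2 a) (Nat.pow 2 b)))) n

/-- A sum of natural numbers is `0` only if every term is. A vanishing xor with the full mask says
that the two sides of `a b`, together with `a` and `b`, exhaust all points. -/
theorem leftOf_or_leftOf {n : ℕ} (hn : 67 ≤ n) {xs ys : ℕ} (h : degeneracy n xs ys = 0) {a b c : ℕ}
    (hab : a < b) (hb : b < n) (hc : c < n) (hac : a ≠ c) (hbc : b ≠ c) :
    leftOf xs ys a b c = true ∨ leftOf xs ys b a c = true := by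
  rw [degeneracy, sumPairs_eq, Finset.sum_eq_zero_iff] at h
  have h1 := Finset.sum_eq_zero_iff.1 (h b (Finset.mem_range.2 hb)) a (Finset.mem_range.2 hab)
  have h2 : ones n ^^^ ((posMask n xs ys a b ||| posMask n xs ys b a) ||| (2 ^ a ||| 2 ^ b)) = 0 :=
    h1
  have h3 := congrArg (fun x => x.testBit c) h2
  rw [posMask_eq hn _ _ (hab.trans hb), posMask_eq hn _ _ hb] at h3
  simp only [Nat.testBit_xor, testBit_ones, Nat.testBit_or, testBit_row, Nat.testBit_two_pow,
    Nat.zero_testBit] at h3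
  simp only [hc, hac, hbc, decide_true, decide_false, Bool.true_and, Bool.or_false, Bool.true_xor,
    Bool.not_eq_false', Bool.or_eq_true] at h3
  exact h3

/-! ### Colourings given by bit planes -/

/-- The digit at `(i, j)` of a bit plane. -/
def bitAt (n B i j : ℕ) : ℕ := Nat.mod (Nat.shiftRight B (Nat.add (Nat.mul (Nat.succ n) i) j)) 2

/-- The colour of the edge between `i` and `j`, where `i < j`. -/
def digit (n : ℕ) (planes : List ℕ) (i j : ℕ) : ℕ :=
  List.rec 0 (fun B _ s => Nat.add (Nat.mul 2 s) (bitAt n B i j)) planes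

/-- The pairs `i < j`. -/
def upper (n : ℕ) : ℕ := pk (Nat.succ n) (fun i => Nat.sub (Nat.pow 2 n) (Nat.pow 2 (Nat.succ i))) n

/-- The pairs `i < j` of colour `c`. -/
def colorClass (n : ℕ) (planes : List ℕ) : ℕ → ℕ :=
  List.rec (fun _ => upper n)
    (fun B _ F c => Nat.land (F (Nat.div c 2))
      (Nat.xor B (Nat.mul (Nat.sub 1 (Nat.mod c 2)) (upper n))))
    planes

theorem upper_eq (n : ℕ) : upper n = relation n fun i j => decide (i < j) := by
  refine pk_congr fun i hi => Nat.eq_of_testBit_eq fun j => ?_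
  -- The difference has ones exactly at the positions `i + 1, …, n - 1`.
  have e : Nat.sub (Nat.pow 2 n) (Nat.pow 2 (Nat.succ i)) = 2 ^ (i + 1) * ones (n - (i + 1)) := by
    rw [ones_eq, Nat.mul_sub, ← pow_add, Nat.add_sub_cancel' hi, mul_one]; rfl
  rw [e, testBit_row, Nat.testBit_two_pow_mul, testBit_ones]
  rw [Bool.eq_iff_iff]; simp; omega

theorem digit_cons (n B : ℕ) (l : List ℕ) (i j : ℕ) :
    digit n (B :: l) i j = 2 * digit n l i j + bitAt n B i j := rfl

theorem colorClass_cons (n B : ℕ) (l : List ℕ) (c : ℕ) :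
    colorClass n (B :: l) c = colorClass n l (c / 2) &&& (B ^^^ ((1 - c % 2) * upper n)) := rfl

theorem bitAt_eq (n B i j : ℕ) : bitAt n B i j = (B.testBit ((n + 1) * i + j)).toNat := by
  rw [Nat.toNat_testBit, ← Nat.shiftRight_eq_div_pow]; rfl

theorem digit_lt (n : ℕ) (l : List ℕ) (i j : ℕ) : digit n l i j < 2 ^ l.length := by
  induction l with
  | nil => simp [digit]
  | cons B l ih =>
    have : bitAt n B i j < 2 := Nat.mod_lt _ two_pos
    rw [digit_cons, List.length_cons, pow_succ]
    omega

/-- The head of the list is the lowest bit of the colour. Pairs whose bit must be `1` are selected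
by the plane, and those whose bit must be `0` by its complement within the upper triangle, which is
the xor with `upper`. -/
theorem colorClass_eq (n : ℕ) (l : List ℕ) {c : ℕ} (hc : c < 2 ^ l.length) :
    colorClass n l c = relation n fun i j => decide (i < j) && decide (digit n l i j = c) := by
  induction l generalizing c with
  | nil =>
    have hc0 : c = 0 := by simpa using hc
    subst hc0
    simp only [digit, decide_true, Bool.and_true]
    exact upper_eq n
  | cons B l ih =>
    rw [List.length_cons, pow_succ] at hc
    rw [colorClass_cons, ih (by omega), relation_land_right]
    refine relation_congr fun i hi j hj => ?_
    rw [digit_cons, bitAt_eq, Nat.testBit_xor]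
    by_cases hij : i < j
    · have h1 : ((1 - c % 2) * upper n).testBit ((n + 1) * i + j) = decide (c % 2 = 0) := by
        rcases Nat.mod_two_eq_zero_or_one c with h | h
        · rw [h, upper_eq]
          simp only [tsub_zero, one_mul]
          rw [testBit_relation _ _ _ (by omega)]
          simp [hi, hj, hij]
        · simp [h]
      rw [h1]
      rcases Nat.mod_two_eq_zero_or_one c with h | h <;>
        cases B.testBit ((n + 1) * i + j) <;> simp [h, hij] <;> omega
    · simp [hij]

/-- This number is `0` if and only if all colours are less than `k`. -/
def excess (n k : ℕ) (planes : List ℕ) : ℕ :=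
  sumTo (fun d => colorClass n planes (Nat.add k d)) (Nat.sub (Nat.pow 2 planes.length) k)

/-- A colour of at least `k` would put the pair into one of the classes `k, …, 2 ^ planes.length -
1`, all of which are empty. -/
theorem digit_lt_of_excess {n k : ℕ} {l : List ℕ} (h : excess n k l = 0) {i j : ℕ} (hij : i < j)
    (hj : j < n) : digit n l i j < k := by
  by_contra hk
  rw [not_lt] at hk
  have hlt := digit_lt n l i j
  rw [excess, sumTo_eq, Finset.sum_eq_zero_iff] at h
  have h1 : colorClass n l (k + (digit n l i j - k)) = 0 :=
    h (digit n l i j - k) (Finset.mem_range.2 (by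
      show digit n l i j - k < 2 ^ l.length - k
      omega))
  rw [Nat.add_sub_cancel' hk, colorClass_eq n l hlt] at h1
  have h2 := congrArg (fun x => x.testBit ((n + 1) * i + j)) h1
  simp only [testBit_relation n _ i (show j < n + 1 by omega), Nat.zero_testBit] at h2
  simp [hij, hj, hij.trans hj] at h2

/-! ### Counting crossings and evaluating the potential -/

/-- The pairs `(i, j)` separated by the line through `a` and `b`. -/
def splitMatrix (n xs ys a b : ℕ) : ℕ :=
  Nat.lor
    (Nat.land (Nat.mul (posLanes n xs ys a b) (ones n)) (Nat.mul (posMask n xs ys b a) (unit n)))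
    (Nat.land (Nat.mul (posLanes n xs ys b a) (ones n)) (Nat.mul (posMask n xs ys a b) (unit n)))

/-- The number of edges of the same colour crossing the edge between `a` and `b`. -/
def pairCount (n xs ys : ℕ) (planes : List ℕ) (a b : ℕ) : ℕ :=
  pop (Nat.land (Nat.land (colorClass n planes (digit n planes a b)) (splitMatrix n xs ys a b))
    (Nat.xor (posMatrix n xs ys a) (posMatrix n xs ys b)))

/-- Twice the number of monochromatic crossings. -/
def crossCount (n xs ys : ℕ) (planes : List ℕ) : ℕ := sumPairs (pairCount n xs ys planes) n

/-- The vertices joined to `p` by an edge of colour `c`. -/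
def neighbours (n : ℕ) (planes : List ℕ) (c p : ℕ) : ℕ :=
  Nat.lor (field (Nat.succ n) (colorClass n planes c) p)
    (Nat.mod (Nat.land (Nat.shiftRight (colorClass n planes c) p) (unit n)) (ones n))

/-- The number of edges of colour `c` at `p` to the left of the line from `a` to `b`. -/
def sideCard (n xs ys : ℕ) (planes : List ℕ) (p a b c : ℕ) : ℕ :=
  pop (Nat.land (neighbours n planes c p) (posMask n xs ys a b))

/-- `x * (3 * x - 1)`. -/
def quadWeight (x : ℕ) : ℕ := Nat.mul x (Nat.sub (Nat.mul 3 x) 1)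

/-- The colour of the edge between `i` and `j`. -/
def edgeDigit (n : ℕ) (planes : List ℕ) (i j : ℕ) : ℕ :=
  Bool.rec (digit n planes j i) (digit n planes i j) (Nat.ble i j)

/-- Twelve times the potential of a vertex `p` with partner `q`, up to a constant. -/
def vertexWeight (n k xs ys : ℕ) (planes : List ℕ) (p q : ℕ) : ℕ :=
  Nat.add (sumTo (fun c => Nat.add (quadWeight (sideCard n xs ys planes p p q c))
      (quadWeight (sideCard n xs ys planes p q p c))) k)
    (Nat.add (Nat.mul 3 (sideCard n xs ys planes p p q (edgeDigit n planes p q)))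
      (Nat.mul 5 (sideCard n xs ys planes p q p (edgeDigit n planes p q))))

/-- Twelve times the potential, up to a constant. -/
def totalWeight (n k xs ys : ℕ) (planes : List ℕ) (ms : ℕ) : ℕ :=
  sumTo (fun p => vertexWeight n k xs ys planes p (field 8 ms p)) n

theorem splitMatrix_eq {n : ℕ} (hn : 67 ≤ n) (xs ys : ℕ) {a b : ℕ} (ha : a < n) (hb : b < n) :
    splitMatrix n xs ys a b = relation n fun i j => (leftOf xs ys a b i && leftOf xs ys b a j) ||
      (leftOf xs ys b a i && leftOf xs ys a b j) := by
  have e : splitMatrix n xs ys a b =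
      (posLanes n xs ys a b * ones n) &&& (posMask n xs ys b a * unit n) |||
      (posLanes n xs ys b a * ones n) &&& (posMask n xs ys a b * unit n) := rfl
  rw [e, posLanes_eq hn, posLanes_eq hn, posMask_eq hn _ _ ha, posMask_eq hn _ _ hb, unit_eq,
    column_mul_ones, column_mul_ones, row_mul_column, row_mul_column, relation_land, relation_land,
    relation_lor]

/-- The edges `a b` and `i j`, where `i < j`, cross and have the same colour. -/
def crossBit (n xs ys : ℕ) (planes : List ℕ) (a b i j : ℕ) : Bool :=
  ((decide (i < j) && decide (digit n planes i j = digit n planes a b)) &&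
    ((leftOf xs ys a b i && leftOf xs ys b a j) || (leftOf xs ys b a i && leftOf xs ys a b j))) &&
    (leftOf xs ys a i j ^^ leftOf xs ys b i j)

/-- The split matrix holds the pairs separated by the line `a b`. The xor of the two orientation
matrices compares the triples `a i j` and `b i j`, that is, the sides of the line `i j` on which `a`
and `b` lie. -/
theorem pairCount_eq {n : ℕ} (hn : 67 ≤ n) (hn' : (n + 1) * n ≤ 32768) (xs ys : ℕ)
    (planes : List ℕ) {a b : ℕ} (ha : a < n) (hb : b < n) :
    pairCount n xs ys planes a b = ∑ i ∈ Finset.range n, ∑ j ∈ Finset.range n,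
      (crossBit n xs ys planes a b i j).toNat := by
  have e : pairCount n xs ys planes a b =
      pop ((colorClass n planes (digit n planes a b) &&& splitMatrix n xs ys a b) &&&
        (posMatrix n xs ys a ^^^ posMatrix n xs ys b)) := rfl
  rw [e, colorClass_eq n planes (digit_lt n planes a b), splitMatrix_eq hn _ _ ha hb,
    posMatrix_eq hn _ _ ha, posMatrix_eq hn _ _ hb, relation_land, relation_xor, relation_land,
    pop_relation hn']
  rfl

theorem crossCount_eq {n : ℕ} (hn : 67 ≤ n) (hn' : (n + 1) * n ≤ 32768) (xs ys : ℕ)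
    (planes : List ℕ) : crossCount n xs ys planes =
      ∑ a : Fin n, ∑ b : Fin n, ∑ i : Fin n, ∑ j : Fin n,
        if a < b then (crossBit n xs ys planes a b i j).toNat else 0 := by
  have h1 : ∀ f : ℕ → ℕ → ℕ, ∑ b ∈ Finset.range n, ∑ a ∈ Finset.range b, f a b =
      ∑ a ∈ Finset.range n, ∑ b ∈ Finset.range n, if a < b then f a b else 0 := by
    intro f
    rw [Finset.sum_comm]
    refine Finset.sum_congr rfl fun b hb => ?_
    rw [← Finset.sum_filter]
    refine Finset.sum_congr ?_ fun _ _ => rfl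
    ext a
    have := Finset.mem_range.1 hb
    simp; omega
  rw [crossCount, sumPairs_eq, h1, Finset.sum_range]
  refine Finset.sum_congr rfl fun a _ => ?_
  rw [Finset.sum_range]
  refine Finset.sum_congr rfl fun b _ => ?_
  simp only [Fin.val_fin_lt]
  split_ifs with h
  · rw [pairCount_eq hn hn' xs ys planes a.2 b.2, Finset.sum_range]
    exact Finset.sum_congr rfl fun i _ => Finset.sum_range _
  · simp

theorem edgeDigit_comm (n : ℕ) (planes : List ℕ) (i j : ℕ) :
    edgeDigit n planes i j = edgeDigit n planes j i := by
  rcases lt_trichotomy i j with h | rfl | h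
  · have h1 : Nat.ble i j = true := Nat.ble_eq_true_of_le h.le
    have h2 : Nat.ble j i = false := by rw [Bool.eq_false_iff, Ne, Nat.ble_eq]; omega
    simp only [edgeDigit, h1, h2]
  · rfl
  · have h1 : Nat.ble j i = true := Nat.ble_eq_true_of_le h.le
    have h2 : Nat.ble i j = false := by rw [Bool.eq_false_iff, Ne, Nat.ble_eq]; omega
    simp only [edgeDigit, h1, h2]

theorem edgeDigit_of_le (n : ℕ) (planes : List ℕ) {i j : ℕ} (h : i ≤ j) :
    edgeDigit n planes i j = digit n planes i j := by
  have h1 : Nat.ble i j = true := Nat.ble_eq_true_of_le h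
  simp only [edgeDigit, h1]

/-- Classes contain only pairs in increasing order, so larger neighbours are found in the row of `p`
and smaller ones in its column. The column misses `p`, so `column_mod` applies. -/
theorem neighbours_eq {n : ℕ} (planes : List ℕ) {c p : ℕ} (hc : c < 2 ^ planes.length)
    (hp : p < n) : neighbours n planes c p =
      row n fun q => decide (q ≠ p) && decide (edgeDigit n planes p q = c) := by
  have e : neighbours n planes c p = field (n + 1) (colorClass n planes c) p |||
    ((colorClass n planes c >>> p) &&& unit n) % ones n := rfl
  rw [e, colorClass_eq n planes hc, unit_eq, relation_shift_land_column _ hp,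
    column_mod ⟨p, hp, by simp⟩]
  rw [relation, field_pk (fun i _ => row_lt' n _) hp, row_lor]
  refine row_congr fun q _ => ?_
  rcases lt_trichotomy p q with h | rfl | h
  · rw [edgeDigit_of_le n planes h.le]
    simp [h, h.ne', h.le]
  · simp
  · rw [edgeDigit_comm, edgeDigit_of_le n planes h.le]
    simp [h, h.ne, h.le]

theorem toNat_eq_ite {x : Bool} {p : Prop} [Decidable p] (h : x = true ↔ p) :
    x.toNat = if p then 1 else 0 := by
  cases x
  · rw [if_neg fun hp => by simpa using h.2 hp]; rfl
  · rw [if_pos (h.1 rfl)]; rfl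

theorem sideCard_eq {n : ℕ} (hn : 67 ≤ n) (hn' : n ≤ 32768) (xs ys : ℕ) (planes : List ℕ)
    {p a b c : ℕ} (hc : c < 2 ^ planes.length) (hp : p < n) (ha : a < n) :
    sideCard n xs ys planes p a b c = (Finset.univ.filter fun q : Fin n =>
      (q.1 ≠ p ∧ edgeDigit n planes p q = c) ∧ leftOf xs ys a b q = true).card := by
  have e : sideCard n xs ys planes p a b c =
    pop (neighbours n planes c p &&& posMask n xs ys a b) := rfl
  rw [e, neighbours_eq planes hc hp, posMask_eq hn xs ys ha, row_land, pop_row hn',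
    Finset.sum_range, Finset.card_filter]
  refine Finset.sum_congr rfl fun q _ => ?_
  refine toNat_eq_ite ?_
  simp

/-! ### The configuration given by packed data -/

/-- The points with the given coordinates. -/
noncomputable def gridPts (n xs ys : ℕ) (i : Fin n) : Plane :=
  !₂[(field 32 xs i : ℝ), (field 32 ys i : ℝ)]

theorem orient_gridPts (n xs ys : ℕ) (a b c : Fin n) :
    orient (gridPts n xs ys a) (gridPts n xs ys b) (gridPts n xs ys c) =
      (field 32 xs b * field 32 ys c + field 32 ys a * field 32 xs c +
        field 32 xs a * field 32 ys b : ℕ) -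
      ((field 32 xs a * field 32 ys c + field 32 ys b * field 32 xs c +
        field 32 xs b * field 32 ys a : ℕ) : ℝ) := by
  simp only [orient, gridPts, PiLp.toLp_apply, Matrix.cons_val_zero, Matrix.cons_val_one,
    Matrix.cons_val_fin_one]
  push_cast
  ring

theorem sg_gridPts_eq_one {n xs ys : ℕ} {a b c : Fin n} :
    sg (gridPts n xs ys) a b c = 1 ↔ leftOf xs ys a b c = true := by
  rw [sg, sign_eq_one_iff, orient_gridPts, sub_pos, Nat.cast_lt, leftOf, decide_eq_true_iff]

theorem sg_gridPts_eq_neg_one {n xs ys : ℕ} {a b c : Fin n} :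
    sg (gridPts n xs ys) a b c = -1 ↔ leftOf xs ys b a c = true := by
  rw [← sg_gridPts_eq_one, sg_swap_left, neg_eq_iff_eq_neg, neg_neg]

theorem inGeneralPosition_gridPts {n xs ys : ℕ} (hn : 67 ≤ n) (h : degeneracy n xs ys = 0) :
    InGeneralPosition (gridPts n xs ys) := by
  refine inGeneralPosition_of_sg ?_ ?_
  · have key : ∀ a b c : Fin n, a < b → a ≠ c → b ≠ c → sg (gridPts n xs ys) a b c ≠ 0 := by
      intro a b c hab hac hbc h0
      rcases leftOf_or_leftOf hn h hab b.2 c.2 (Fin.val_ne_of_ne hac) (Fin.val_ne_of_ne hbc)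
        with h1 | h1
      · rw [← sg_gridPts_eq_one, h0] at h1
        exact absurd h1 (by decide)
      · rw [← sg_gridPts_eq_neg_one, h0] at h1
        exact absurd h1 (by decide)
    intro a b c hab hac hbc
    rcases lt_or_gt_of_ne hab with h1 | h1
    · exact key a b c h1 hac hbc
    · rw [sg_swap_left, Ne, neg_eq_iff_eq_neg, neg_zero]
      exact key b a c h1 hbc hac
  · intro a b _
    obtain ⟨c, hc⟩ := Finset.exists_mem_notMem_of_card_lt_card (s := {a, b})
      (t := (Finset.univ : Finset (Fin n)))
      (by rw [Finset.card_univ, Fintype.card_fin]; exact (Finset.card_le_two).trans_lt (by omega))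
    simp only [Finset.mem_insert, Finset.mem_singleton, not_or] at hc
    exact ⟨c, hc.2.1, hc.2.2⟩

/-- The colouring given by bit planes. -/
def planeCol (n k : ℕ) [NeZero k] (planes : List ℕ) : Sym2 (Fin n) → Fin k :=
  Sym2.lift ⟨fun i j => Fin.ofNat k (edgeDigit n planes i j), fun i j =>
    congrArg (Fin.ofNat k) (edgeDigit_comm n planes i j)⟩

/-- The reduction modulo `k` in `planeCol` is harmless: off the diagonal all digits are below `k`.
-/
theorem planeCol_eq_iff {n k : ℕ} [NeZero k] {planes : List ℕ} (h : excess n k planes = 0)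
    {i j : Fin n} (hij : i ≠ j) {c : Fin k} :
    planeCol n k planes s(i, j) = c ↔ edgeDigit n planes i j = c := by
  have hlt : edgeDigit n planes i j < k := by
    rcases lt_or_gt_of_ne hij with h1 | h1
    · rw [edgeDigit_of_le _ _ (le_of_lt (show i.1 < j.1 from h1))]
      exact digit_lt_of_excess h h1 j.2
    · rw [edgeDigit_comm, edgeDigit_of_le _ _ (le_of_lt (show j.1 < i.1 from h1))]
      exact digit_lt_of_excess h h1 i.2
  rw [planeCol, Sym2.lift_mk, Fin.ext_iff, Fin.val_ofNat, Nat.mod_eq_of_lt hlt]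

theorem mul_eq_neg_one_iff (s t : SignType) :
    s * t = -1 ↔ (s = 1 ∧ t = -1) ∨ (s = -1 ∧ t = 1) := by
  revert s t; decide

/-- A false left bit means "right" only for a nondegenerate triple. The separation by `a b` forces
`i` and `j` to differ from `a` and `b`, and general position then turns differing left bits into
opposite orientations. -/
theorem crossBit_eq_true_iff {n k xs ys : ℕ} [NeZero k] {planes : List ℕ} (hn : 67 ≤ n)
    (hg : degeneracy n xs ys = 0) (he : excess n k planes = 0) {a b i j : Fin n} (hab : a < b) :
    crossBit n xs ys planes a b i j = true ↔
      i < j ∧ (a, b, i, j) ∈ crossQuads (gridPts n xs ys) (planeCol n k planes) := by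
  have hP := inGeneralPosition_gridPts hn hg
  rw [mem_crossQuads, Crosses, mul_eq_neg_one_iff, mul_eq_neg_one_iff]
  simp only [crossBit, Bool.and_eq_true, Bool.or_eq_true, decide_eq_true_eq,
    ← sg_gridPts_eq_one (n := n)]
  have flip : ∀ x : Fin n, sg (gridPts n xs ys) b a x = 1 ↔ sg (gridPts n xs ys) a b x = -1 := by
    intro x
    rw [sg_swap_left, neg_eq_iff_eq_neg]
  rw [flip, flip]
  by_cases hij : i < j
  swap
  · simp [hij]
  have hcol : digit n planes i j = digit n planes a b ↔
      planeCol n k planes s(a, b) = planeCol n k planes s(i, j) := by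
    rw [planeCol_eq_iff he hab.ne,
      ← edgeDigit_of_le n planes (le_of_lt (show a.1 < b.1 from hab)),
      ← edgeDigit_of_le n planes (le_of_lt (show i.1 < j.1 from hij)),
      (planeCol_eq_iff he hij.ne (c := planeCol n k planes s(i, j))).1 rfl, eq_comm]
  by_cases hs : (sg (gridPts n xs ys) a b i = 1 ∧ sg (gridPts n xs ys) a b j = -1) ∨
      (sg (gridPts n xs ys) a b i = -1 ∧ sg (gridPts n xs ys) a b j = 1)
  swap
  · simp [hs]
  have hne : ∀ x : Fin n, sg (gridPts n xs ys) a b x ≠ 0 → a ≠ x ∧ b ≠ x := by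
    intro x hx
    refine ⟨?_, ?_⟩ <;> rintro rfl
    · exact hx (sg_self_outer _ _ _)
    · exact hx (sg_self_right _ _ _)
  have hi := hne i (by rcases hs with h | h <;> rw [h.1] <;> decide)
  have hj := hne j (by rcases hs with h | h <;> rw [h.2] <;> decide)
  have ha := hP.sg_ne_zero hi.1 hj.1 hij.ne
  have hb := hP.sg_ne_zero hi.2 hj.2 hij.ne
  rw [hcol, sg_rotate _ a, sg_rotate _ b]
  have hx : (leftOf xs ys a i j ^^ leftOf xs ys b i j) = true ↔
      (sg (gridPts n xs ys) a i j = 1 ∧ sg (gridPts n xs ys) b i j = -1) ∨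
      (sg (gridPts n xs ys) a i j = -1 ∧ sg (gridPts n xs ys) b i j = 1) := by
    have t : ∀ s : SignType, s ≠ 0 → (s = -1 ↔ ¬ s = 1) := by decide
    rw [t _ ha, t _ hb, sg_gridPts_eq_one, sg_gridPts_eq_one]
    cases leftOf xs ys a i j <;> cases leftOf xs ys b i j <;> simp
  rw [hx]
  exact ⟨fun ⟨⟨⟨h1, h2⟩, h3⟩, h4⟩ => ⟨h1, ⟨h3, h4⟩, h2⟩,
    fun ⟨h1, ⟨h3, h4⟩, h2⟩ => ⟨⟨⟨h1, h2⟩, h3⟩, h4⟩⟩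

/-- Each of the two edges is listed in both directions, and exactly one of these is increasing. -/
theorem card_crossQuads_eq_four_mul {n k : ℕ} (P : Fin n → Plane) (χ : Sym2 (Fin n) → Fin k) :
    (crossQuads P χ).card =
      4 * ((crossQuads P χ).filter fun t => t.1 < t.2.1 ∧ t.2.2.1 < t.2.2.2).card := by
  classical
  have h1 : ((crossQuads P χ).filter fun t => ¬ t.1 < t.2.1).card =
      ((crossQuads P χ).filter fun t => t.1 < t.2.1).card := by
    refine Finset.card_bij' (fun t _ => (t.2.1, t.1, t.2.2)) (fun t _ => (t.2.1, t.1, t.2.2))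
      ?_ ?_ (fun _ _ => rfl) (fun _ _ => rfl)
    · rintro ⟨a, b, c, d⟩ h
      obtain ⟨h, h'⟩ := Finset.mem_filter.1 h
      have := (mem_crossQuads.1 h).1.ne.1
      refine Finset.mem_filter.2 ⟨crossQuads_swap_left.2 h, ?_⟩
      exact lt_of_le_of_ne (not_lt.1 h') this.symm
    · rintro ⟨a, b, c, d⟩ h
      obtain ⟨h, h'⟩ := Finset.mem_filter.1 h
      exact Finset.mem_filter.2 ⟨crossQuads_swap_left.2 h, not_lt.2 (le_of_lt h')⟩
  have h2 : (((crossQuads P χ).filter fun t => t.1 < t.2.1).filter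
      fun t => ¬ t.2.2.1 < t.2.2.2).card =
      (((crossQuads P χ).filter fun t => t.1 < t.2.1).filter fun t => t.2.2.1 < t.2.2.2).card := by
    refine Finset.card_bij' (fun t _ => (t.1, t.2.1, t.2.2.2, t.2.2.1))
      (fun t _ => (t.1, t.2.1, t.2.2.2, t.2.2.1)) ?_ ?_ (fun _ _ => rfl) (fun _ _ => rfl)
    · rintro ⟨a, b, c, d⟩ h
      obtain ⟨h, h'⟩ := Finset.mem_filter.1 h
      obtain ⟨h, h''⟩ := Finset.mem_filter.1 h
      obtain ⟨-, -, -, -, -, this⟩ := (mem_crossQuads.1 h).1.ne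
      refine Finset.mem_filter.2 ⟨Finset.mem_filter.2 ⟨crossQuads_swap_right.2 h, h''⟩, ?_⟩
      exact lt_of_le_of_ne (not_lt.1 h') this.symm
    · rintro ⟨a, b, c, d⟩ h
      obtain ⟨h, h'⟩ := Finset.mem_filter.1 h
      obtain ⟨h, h''⟩ := Finset.mem_filter.1 h
      exact Finset.mem_filter.2
        ⟨Finset.mem_filter.2 ⟨crossQuads_swap_right.2 h, h''⟩, not_lt.2 (le_of_lt h')⟩
  have h3 := Finset.card_filter_add_card_filter_not (s := crossQuads P χ) fun t => t.1 < t.2.1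
  have h4 := Finset.card_filter_add_card_filter_not
    (s := (crossQuads P χ).filter fun t => t.1 < t.2.1) fun t => t.2.2.1 < t.2.2.2
  rw [Finset.filter_filter] at h2 h4
  rw [Finset.filter_filter] at h2 h4
  omega

/-- Eight quadruples per crossing, of which one in four has both edges increasing, leave two: the
edges can still be exchanged. -/
theorem two_mul_monoCr {n k xs ys : ℕ} [NeZero k] {planes : List ℕ} (hn : 67 ≤ n)
    (hn' : (n + 1) * n ≤ 32768) (hg : degeneracy n xs ys = 0) (he : excess n k planes = 0) :
    2 * monoCr (gridPts n xs ys) (planeCol n k planes) = crossCount n xs ys planes := by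
  have h1 := card_crossQuads (inGeneralPosition_gridPts hn hg) (planeCol n k planes)
  rw [card_crossQuads_eq_four_mul] at h1
  have h2 : ((crossQuads (gridPts n xs ys) (planeCol n k planes)).filter
      fun t => t.1 < t.2.1 ∧ t.2.2.1 < t.2.2.2).card = crossCount n xs ys planes := by
    classical
    rw [crossCount_eq hn hn', ← Finset.univ_inter (crossQuads _ _), ← Finset.filter_mem_eq_inter,
      Finset.filter_filter, Finset.card_filter, Fintype.sum_prod_type]
    refine Finset.sum_congr rfl fun a _ => ?_
    rw [Fintype.sum_prod_type]
    refine Finset.sum_congr rfl fun b _ => ?_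
    rw [Fintype.sum_prod_type]
    refine Finset.sum_congr rfl fun i _ => Finset.sum_congr rfl fun j _ => ?_
    by_cases hab : a < b
    · rw [if_pos hab]
      refine (toNat_eq_ite ((crossBit_eq_true_iff hn hg he hab).trans ?_)).symm
      simp [hab, and_comm]
    · rw [if_neg hab]
      exact if_neg fun h => hab h.2.1
  omega

/-- The configuration given by packed data. -/
noncomputable def packedConfig (n k : ℕ) [NeZero n] [NeZero k] (xs ys : ℕ) (planes : List ℕ)
    (ms : ℕ) : Config (Fin n) k where
  pts := gridPts n xs ys
  col := planeCol n k planes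
  mat p := Fin.ofNat n (field 8 ms p)
  det p := ⟨planeCol n k planes s(p, Fin.ofNat n (field 8 ms p)), .left, .left⟩

/-- The matching property of packed data. -/
def PackedMatching (n ms : ℕ) : Prop :=
  ∀ p < n, field 8 ms p < n ∧ field 8 ms p ≠ p ∧ field 8 ms (field 8 ms p) ≠ p

instance (n ms : ℕ) : Decidable (PackedMatching n ms) := by
  unfold PackedMatching; infer_instance

section

variable {n k xs ys ms : ℕ} [NeZero n] [NeZero k] {planes : List ℕ}

theorem packedConfig_mat_val (hm : PackedMatching n ms) (p : Fin n) :
    ((packedConfig n k xs ys planes ms).mat p : ℕ) = field 8 ms p :=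
  Nat.mod_eq_of_lt (hm p p.2).1

theorem regular_packedConfig (hn : 67 ≤ n) (hg : degeneracy n xs ys = 0)
    (hm : PackedMatching n ms) : (packedConfig n k xs ys planes ms).Regular where
  pos := inGeneralPosition_gridPts hn hg
  mat p := by
    have h := hm p p.2
    refine ⟨fun e => h.2.1 ?_, fun e => h.2.2 ?_⟩
    · rw [← packedConfig_mat_val (k := k) (xs := xs) (ys := ys) (planes := planes) hm, e]
    · rw [← packedConfig_mat_val (k := k) (xs := xs) (ys := ys) (planes := planes) hm p,
        ← packedConfig_mat_val (k := k) (xs := xs) (ys := ys) (planes := planes) hm, e]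
  det _ := rfl

theorem sideCard_eq_card_filter (hn : 67 ≤ n) (hn' : n ≤ 32768) (he : excess n k planes = 0)
    (hk : k ≤ 2 ^ planes.length) (p a b : Fin n) (c : Fin k) (s : SignType)
    (hs : ∀ q : Fin n, sg (gridPts n xs ys) p (Fin.ofNat n (field 8 ms p)) q = s ↔
      leftOf xs ys a b q = true) (hs0 : s ≠ 0) :
    sideCard n xs ys planes p a b c = (packedConfig n k xs ys planes ms).sideCount s p c := by
  rw [sideCard_eq hn hn' xs ys planes (c.2.trans_le hk) p.2 a.2, Config.sideCount]
  congr 1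
  ext q
  simp only [Finset.mem_filter, Finset.mem_univ, true_and]
  show _ ↔ sg (gridPts n xs ys) p (Fin.ofNat n (field 8 ms p)) q = s ∧
    planeCol n k planes s(p, q) = c
  rw [hs q]
  -- The vertex `p` is excluded explicitly in the packed count; in `sideCount` it is excluded
  -- because it lies on its own matching line and `s ≠ 0`.
  by_cases hq : q = p
  · subst hq
    constructor
    · intro h; exact absurd rfl h.1.1
    · intro h
      have := (hs q).2 h.1
      rw [sg_self_outer] at this
      exact absurd this.symm hs0
  · rw [planeCol_eq_iff he (Ne.symm hq)]
    have : q.1 ≠ p.1 := Fin.val_ne_of_ne hq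
    tauto

/-- Truncated subtraction matters only for `x = 0`, where the factor `x` removes it. -/
theorem quadWeight_cast (x : ℕ) : (quadWeight x : ℝ) = 3 * (x : ℝ) ^ 2 - x := by
  have h : quadWeight x = x * (3 * x - 1) := rfl
  rcases Nat.eq_zero_or_pos x with rfl | hx
  · simp [quadWeight]
  · rw [h, Nat.cast_mul, Nat.cast_sub (by omega)]
    push_cast; ring

/-- Multiplication by 12 clears all denominators of the potential except that of the constant `4 /
21`, which is kept apart. -/
theorem vertexPotential_packedConfig (hn : 67 ≤ n) (hn' : n ≤ 32768) (he : excess n k planes = 0)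
    (hk : k ≤ 2 ^ planes.length) (hm : PackedMatching n ms) (p : Fin n) :
    (packedConfig n k xs ys planes ms).vertexPotential p =
      (vertexWeight n k xs ys planes p (field 8 ms p) : ℝ) / 12 + 4 / 21 := by
  set C := packedConfig n k xs ys planes ms with hC
  have hval : (C.mat p : ℕ) = field 8 ms p := packedConfig_mat_val hm p
  have hne : p ≠ C.mat p := fun e => (hm p p.2).2.1 (by rw [← hval, ← e])
  have hL : ∀ c : Fin k, sideCard n xs ys planes p p (field 8 ms p) c = C.sideCount 1 p c := by
    intro c
    rw [← hval]
    exact sideCard_eq_card_filter hn hn' he hk p p (C.mat p) c 1 (fun q => sg_gridPts_eq_one)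
      (by decide)
  have hR : ∀ c : Fin k, sideCard n xs ys planes p (field 8 ms p) p c = C.sideCount (-1) p c := by
    intro c
    rw [← hval]
    exact sideCard_eq_card_filter hn hn' he hk p (C.mat p) p c (-1)
      (fun q => sg_gridPts_eq_neg_one) (by decide)
  have hc0 : edgeDigit n planes p (field 8 ms p) = (C.col s(p, C.mat p) : Fin k) := by
    rw [← hval]
    exact (planeCol_eq_iff he hne).1 rfl
  have e : vertexWeight n k xs ys planes p (field 8 ms p) =
      sumTo (fun c => quadWeight (sideCard n xs ys planes p p (field 8 ms p) c) +
        quadWeight (sideCard n xs ys planes p (field 8 ms p) p c)) k +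
      (3 * sideCard n xs ys planes p p (field 8 ms p) (edgeDigit n planes p (field 8 ms p)) +
        5 * sideCard n xs ys planes p (field 8 ms p) p (edgeDigit n planes p (field 8 ms p))) := rfl
  rw [e, sumTo_eq, Finset.sum_range, hc0, hL, hR]
  simp only [hL, hR]
  rw [Config.vertexPotential]
  push_cast
  simp only [quadWeight_cast]
  rw [add_div, add_div, Finset.sum_div]
  have : ∀ c : Fin k, (((C.sideCount 1 p c : ℝ) ^ 2 + (C.sideCount (-1) p c : ℝ) ^ 2) / 4 -
      ((C.sideCount 1 p c : ℝ) + C.sideCount (-1) p c) / 12) =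
      (3 * (C.sideCount 1 p c : ℝ) ^ 2 - C.sideCount 1 p c +
        (3 * (C.sideCount (-1) p c : ℝ) ^ 2 - C.sideCount (-1) p c)) / 12 := fun c => by ring
  simp only [this]
  ring

theorem potential_packedConfig (hn : 67 ≤ n) (hn' : n ≤ 32768) (he : excess n k planes = 0)
    (hk : k ≤ 2 ^ planes.length) (hm : PackedMatching n ms) :
    (packedConfig n k xs ys planes ms).potential =
      (totalWeight n k xs ys planes ms : ℝ) / 12 + 4 * n / 21 := by
  rw [Config.potential,
    Finset.sum_congr rfl fun p _ => vertexPotential_packedConfig hn hn' he hk hm p,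
    Finset.sum_add_distrib, totalWeight, sumTo_eq, Finset.sum_range, Nat.cast_sum, Finset.sum_div]
  simp; ring

end

/-! ### The limits of the best matchings -/

namespace Config

variable {ι : Type} {k : ℕ} {C : Config ι k}

/-- The optimal details need not be the left ones, so `Regular.iter` is not available for them;
general position and the matching property persist for arbitrary details. -/
theorem inGeneralPosition_iter (hP : InGeneralPosition C.pts) (hm : IsMatching C.mat) {ε : ℕ → ℝ}
    (hε : C.SmallEnough ε) (t : ℕ) :
    InGeneralPosition (C.iter ε t).pts ∧ IsMatching (C.iter ε t).mat := by
  induction t with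
  | zero => exact ⟨hP, hm⟩
  | succ t ih =>
    have h : (C.iter ε t).Admissible (ε t) := hε t
    exact ⟨(h.canonicalSigns ih.1 ih.2).inGeneralPosition ih.1 ih.2, isMatching_childMat ih.2 (ε t)⟩

theorem HasDoublingLimit.exists_isCrossingConstant_le [Fintype ι] {l : ℝ}
    (h : C.HasDoublingLimit l) (hι : 0 < Fintype.card ι) (hk : 0 < k)
    (hP : InGeneralPosition C.pts) (hm : IsMatching C.mat) :
    ∃ L, IsCrossingConstant k L ∧ L ≤ l := by
  obtain ⟨ε, hε⟩ := h.1
  refine ColoredCrossing.exists_isCrossingConstant_le hk (N := fun t => Nat.card (Level ι t))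
    ?_ (fun t => ?_) (h.2 ε hε)
  · simp only [Level.card]
    exact (tendsto_pow_atTop_atTop_of_one_lt one_lt_two).atTop_mul_const' hι
  · exact geomCr_le_of_card (inGeneralPosition_iter hP hm hε t).1 _ Nat.card_eq_fintype_card.symm

end Config

/-- A regular configuration of small potential has a matching and details as required. -/
theorem exists_optimal_config {n k : ℕ} {C : Config (Fin n) k} (h : C.Regular) (hn : 0 < n)
    (hk : 0 < k) {b : ℝ} (hb : 24 * (monoCr C.pts C.col + C.potential) / (n : ℝ) ^ 4 < b) :
    ∃ L l : ℝ, ∃ C' : Config (Fin n) k, IsCrossingConstant k L ∧ InGeneralPosition C'.pts ∧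
      monoCr C'.pts C'.col = monoCr C.pts C.col ∧ IsMatching C'.mat ∧ C'.HasDoublingLimit l ∧
      C'.IsOptimal l ∧ L ≤ l ∧ l < b := by
  obtain ⟨l₀, h0, hle⟩ := h.exists_hasDoublingLimit (by simpa using hn)
  obtain ⟨m, D, l, hm, hl, hopt, hll⟩ := Config.exists_isOptimal h.mat h0
  obtain ⟨L, hL, hLl⟩ := hl.exists_isCrossingConstant_le (by simpa using hn) hk h.pos hm
  rw [Fintype.card_fin] at hle
  exact ⟨L, l, { C with mat := m, det := D }, hL, h.pos, rfl, hm, hl, hopt, hLl,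
    hll.trans_lt (hle.trans_lt hb)⟩

/-- The conclusion for packed data that pass the numerical checks. -/
theorem exists_optimal_of_packed {n k N W xs ys ms : ℕ} {planes : List ℕ} (hn : 67 ≤ n)
    (hn' : (n + 1) * n ≤ 32768) (hk : 0 < k) (hkl : k ≤ 2 ^ planes.length)
    (hg : degeneracy n xs ys = 0) (he : excess n k planes = 0) (hm : PackedMatching n ms)
    (hN : crossCount n xs ys planes = 2 * N) (hW : totalWeight n k xs ys planes ms = W) {b : ℝ}
    (hb : 24 * (N + ((W : ℝ) / 12 + 4 * n / 21)) / (n : ℝ) ^ 4 < b) :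
    ∃ L l : ℝ, ∃ C : Config (Fin n) k, IsCrossingConstant k L ∧ InGeneralPosition C.pts ∧
      monoCr C.pts C.col = N ∧ IsMatching C.mat ∧ C.HasDoublingLimit l ∧ C.IsOptimal l ∧
      L ≤ l ∧ l < b := by
  have : NeZero n := ⟨by omega⟩
  have : NeZero k := ⟨hk.ne'⟩
  have h1 : monoCr (gridPts n xs ys) (planeCol n k planes) = N := by
    have := two_mul_monoCr (k := k) hn hn' hg he
    omega
  have h2 := potential_packedConfig (xs := xs) (ys := ys) hn (by nlinarith) he hkl hm
  rw [hW] at h2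
  obtain ⟨L, l, C, hC⟩ := exists_optimal_config (b := b)
    (regular_packedConfig (k := k) (planes := planes) hn hg hm) (by omega) hk (by
      rw [h2]; exact (congrArg (fun x : ℕ => 24 * ((x : ℝ) + _) / (n : ℝ) ^ 4) h1).trans_lt hb)
  refine ⟨L, l, C, hC.1, hC.2.1, hC.2.2.1.trans h1, hC.2.2.2⟩

/-! ### The data -/

/-- The abscissas of the points for two colours. -/
def xsTwo : ℕ :=
  0x82c22e00d7100400831c41008a422300bb01f500ec4d7e00c1444c00c1129200d7304700beeaf000b3a6af00b391fc00c8c5710094396500d6bc7c0090560d0039e26d00987a7900b6a23c00185b650095257d0046e600009499a300b753fc007cb5ad00c3901500c06620001837ea008bb287007c9f2000bfb4e60099171d001cac5800e60853008612a700d84a050083088e00c21968008862120098859500bf1e8b00bebefb00e55ea300c0b80700b82c9700b4a0bb00c5f50b008ec17c00c1be2100930ba20031f25400ca065800b730e900953172000f78dd003db78e00996dbe0007a28e007d465a00b43fb500c21b540004da8d0087cb06007dacb100026773008a81320091f10f008a85590082d53200d70f330083266c008a042b00b980b200ec4bd200c1483c00c0cf1700d72e5800bbcb0200b3c1a300b3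8b6000c8be0f00987aca00d6c000008a865c0038eb9f00987c4b00b6d726001b1b9a0095285600458f5e00948f5f00b75d6a007ce40400c382ca00c06df3001835e1008b8d6f007ca8e000bfe0fc00996b1c001ca40000e34dab0085fdc300d84b420082fb8500c1f0260088399900987dfc00bf1c5c00bed2e100e55d4200c0c24100b86c3a00b3d13a00c5e152008ec33400c1d83e00930a1c0032682900ca057600b7291f00952c110011427a003d9eec00d6b719000cc669007d9d4700b3c9b700c222800004c10700873ed3007df0440002c7bf008a7b2f009271ed

/-- The ordinates of the points for two colours. -/
def ysTwo : ℕ :=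
  0x7c3a36002c3b96007bf9930076f95300b16c15001797bc005b27a4005bbac2002c1c4700b7717900a480ca00a46eb400c707d60067c0a1002c8c5a006761d90060343c00679e2600aae932005b7f2c0072010d0061ec5a0067c8f500abb78b007fd37600bee2fc005df950005b798a0075a2d5007fe1c40060c2910067928e005c2b7a00f4c0050079ce74002b0afd007c07a700bc92bd007835d900679d7b0063466200652e3c001e54c9005cd0bc00ad0a6d00a6871e00c29f28006737120059f3780067a64b005f41ff00c8fd9000ab8d2b0071f068005a06020060b2ac006783370058ac58007f7816009f2d6800591ffb00582d4f00789f56007f39f00057bd200076cde6007371b40076cb16007c2c9c002c3c60007bf2250077224900af19120017995c005b1c2f005c8526002c1e2700b2a1e800a4bd3600a4417700c6fc5e00679e21002c88f20076ca640060160d00679e1000ab2442005bee8d0071fffc0061bdc70067c81200abc64b007fb66100becda1005ddbcf005b79360075c6f6007fdb9900600b70006783ab005c2a4400f07d6b0079dccb002b09c9007c111900bc51920078507d00679df7006350970064c65a001e5620005cad0a00ad6df700a4de1600c28041006739ed0059b7550067a628005f500a00c8fc3200ab83af0071f214005a51910060af7c002c919000599068007f4407009ee2ce00591048005828bb0079005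d007f0dc70057ce580076d213007337a5

/-- The two-colour drawing has its own point set; the drawings for all larger numbers of colours
share another one. -/
theorem degeneracy_two : degeneracy 135 xsTwo ysTwo = 0 := by decide +kernel

/-- The abscissas of the points for three or more colours. -/
def xsMany : ℕ :=
  0x69d1dc00b4abf80012c125006ec8280070919600faf83200e0e7e100ccc75800de279d00c4aab9000193fd00c40f37002982710012e94200c4d80500b4d4060070450900c38ca6006d3bdf006f66170072e78300c8e7ce00b4820600cc189600c4d8d700b5478900169b770074004400685c5500bf43bb0074078c00f1258200cb138f00705c6a0071b4b300b77a520073b7080069470f00b61ea900fa89aa00e638230073c7e200e03ac500c2d24f000423e000c38df70024cd2e00111fdf00c4e45700c9bc2d00709b5a00b5ee270073d4e600d01b37007105090075b0ae003259fd00c79c0500eca0a700b4a55a00215104006fcbb700caa7e600bf4db0007600bb006e21ff00b544b4007076c90069b2ab00b4a75a0012d49c006ed22c007041bf00faf9ad00e0d9fe00cd29a600dd9e8400c4f4020001962000c40ddb0029581900144f2300c4d81600b4a16e0070474200c38c85006db688006f8f290072f4ff00c8f7a800b4729400cb4f7a00c4d8e800b4c91d00178afd0073ffad0068630800bf4343007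407da00f11e1200cb41a3007048bf0071cee000b7ac150073b9c9006952c000b7481500fa864300e654580073bfd300e037ed00c2fcb000042b4100c38deb0024ad0c00112f8a00c4e3c600c9bafb0070a7da00b5e2aa0073cd0e00ce88c100710db50075ac03003108fe00c646ba00ec918b00b4748e00210f83006fc41200c9833d00bf4d520076008c006e3f9b00b571e3

/-- The ordinates of the points for three or more colours. -/
def ysMany : ℕ :=
  0x52158900aaa6b8003f6abf00596d87005bda010012d2500022aa69003eadcb00242880005029ae0038df0d00f088240047738f003f794b00f1e9e600a2edca006b34f000efa229005715d1005a48ef0069b484004565b100a56541003fa55700f1eb5800add14d0040d694006923fa004fecce00e8183f006920780019173200412b8c005b9520005d5e2d00da6f670069498a005146d2009a151a001318e2001fa5ee0069409200230bcd0059762d0039d76000efa47a00461afa003ec10f00f1ffa200fa8db1006b0469009b3759006939ad003af9ee006ac88f0067ed190049e89d0048fb9f001bf96500aa47580044cfb9005ad7ba0041e9dc00e829c00067d2260058875f009eff65005bb71e0051e70f00aa8bdc003f723500597c1d006b36c50012d15e0022b242003e32ed0024713b004f760c0038dfdc00f085bf0047674f003ffd6500f1ea0400a4afff006b33b300efa1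ef0057d853005a805b0069acd00045364b00a685430040c32800f1eb7600ab4fae00412f3900692444004ff6ab00e8176c0069205300191bf10040dcd9005b7c8e005d811c00dac6c60069482700515806009269ac00131b0e001f95e0006944cb00230d5f0058a4db0039da2c00efa46500460eee003ec74900f1fea200fa8b94006afd75009b7bbd00693dd4003cb05b006ac3c00067ee94004989da004c331d001c030900a71f180044b751005acda80043d16b00e8291b0067d2130058b06f009dfe05

theorem degeneracy_many : degeneracy 135 xsMany ysMany = 0 := by decide +kernel

/-- The bit planes of the colouring with 2 colours. -/
def planes2 : List ℕ :=
  [0x40000000000000000000000000000000002000000000000000000000000000000000300000000000000000000000000000000020000000000000000000000000000000005c000000000000000000000000000000005c000000000000000000000000000000005c000000000000000000000000000000005c0000000000000000000000000000000027c000000000000000000000000000000071c000000000000000000000000000000073d0000000000000000000000000000000066000000000000000000000000000000072400000000000000000000000000000005c3a0000000000000000000000000000007243000000000000000000000000000000463e8000000000000000000000000000007a4100000000000000000000000000000023d9400000000000000000000000000000063ef000000000000000000000000000007bc1000000000000000000000000000000767e9800000000000000000000000000007a434a000000000000000000000000000023c54a000000000000000000000000000023dbf7800000000000000000000000000027c5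4a80000000000000000000000000005cb814c000000000000000000000000000043efba0000000000000000000000000007bc120100000000000000000000000000023dbf790000000000000000000000000005d9814d6000000000000000000000000007b41044600000000000000000000000000063edbea00000000000000000000000000062c18a8400000000000000000000000002bdba515800000000000000000000000005c3ef7e69000000000000000000000000023dbe7158800000000000000000000000027c54a886800000000000000000000000023c32d15980000000000000000000000007a41204e1d0000000000000000000000005d9814c715000000000000000000000000599814d7150000000000000000000000005c3ef7e6d78000000000000000000000005c3814d71760000000000000000000000023e54a7b6a78000000000000000000000063d15a5b6c78000000000000000000000026654aa86a1400000000000000000000007243894a4c1000000000000000000000005c3814e697e700000000000000000000007241ca4a5d108000000000000000000000063e99ea2217a000000000000000000000062458a86217100000000000000000000023c54a7b6a7958000000000000000000007bc104531d784000000000000000000000043efba8e287bc00000000000000000000567e99ea4e172d000000000000000000007b4104469d104200000000000000000000043efba8e287bdc000000000000000000023dbf791c8faf6c000000000000000000059985edb556a55b00000000000000000005c3c34e697a70658000000000000000000043efba8e287bde80000000000000000002bc3a51599f8624c00000000000000000063dbf71588faf6cc000000000000000000043efba8e287bdc80000000000000000003bc121159df8424d0000000000000000007bc100539df8425da0000000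00000000003bc120159df8424d30000000000000000023dbe71588fae2cc1000000000000000005c3ab5e69787a651bc00000000000000002bdba71588f8e24c3a00000000000000002bc3251599f8424d3a000000000000000027e54a3b6a5959a64200000000000000005c3ef7e6d787bed1bdc0000000000000005c3814e797e70659bdc0000000000000005c3814d717660619bdc0000000000000005c3eb7e69787a6d1bdc00000000000000027e54a196a1959a6427c0000000000000073c15a5b687851bec73c0000000000000071c95a5b5c6851bfc71c0000000000000026644aa86a145da64266000000000000007a41284e1d904137efa4000000000000005c3ab5e69787a651bdc3a00000000000003bc120119df8424d2fbc30000000000000463e99ea6217bd3ac463c00000000000007a41284e1d904137ffa43800000000000023d54a7b687a59bec23dd4000000000000063efbaa6207bdaa4043e50000000000007bc104531d78425d87bc10000000000000767e99ea4e17253ac567c18000000000007a434b4a5d1091b3c7a414a0000000000023e54a7b6a7959be423c54a0000000000023dbf791c8fef6cc123db778000000000027c54aa868155da6427c54a800000000005c3814d7156e0619bdcb894c0000000000043efba86287bdaa4043e7ba00000000007bc120159df840452fbc3201000000000023dbf791c8fef6cc123db7f900000000005db814d7152e0619bdcb894d60000000007b4104461d104377ffb418446000000000063efbea6207bdaa4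063c5baa000000000062458a862171d224062458a84000000002bdba71589f8e24c3abdba5158000000005c3ef7e69787aed1bdc3ef7e690000000023dbe71588fae2cc1a3dbe71588000000027c54a886a1d59a6427e54a986800000002bc3251599f8624d3abc3a5159800000007a41204e1d904137ffa43a04e1d0000000599814d7154e4619bdd9894d7150000000599814d7156e061dbdd9894d71500000005c3ef7e69787bed1bdc3ef7e69780000005c3814d7176e0619bdc3894d717600000023e54a3b6a7959a6423e54a3b6a780000073c15a5b6c7851bec73c15a5b6c780000027654a886a155da6427614aa86a14000007243c94a5c10b1b2c7241494a5c10000005c3c34e697a70659bdc3eb4e697e7000007241ca4a5d10b1b3c72414a4a5d1080000463e99ea6217bd3ac063c19ea6217a000006245aa86a151da6406245aa86a151000023d54a7b687b59bec23d54a7b687b580007bc104539d784255bfbc180539d7848000043efba8e287bdaa4043e7ba86287bc000567e99ea4e172d3ac463c19ea6e17ad0005c3a35e697872651bdc3ab5e69787a6000043efba8e287bcea0043e7ba8e287bd80023dbf79588faf6cc123db771188faf6c0059985edb556a55b7fd998de5b556a55b005c3c35e697a70e59bdc3eb4e697870e180043efba8e287bde80043e7ba8e287bda802bd3a51599f8624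d3abcba51589f8624c063dbf71588fae2cc163db771588f8f6cc0043efba8e287bdca4043e7ba8e287bd8803bc125159df8424d3bbc3a51599f8424d05bc100539df8425db7bc100539d78425da]

/-- The matching for 2 colours. -/
def partners2 : ℕ :=
  0x3344840393d7f3b1f001b1b0e543466325f2b2f242d2c2b037b24274e255e5e1036043d840f62311a0763282b2c0e131266760e000d6b0b240504070609602a02200064483a1c1c165c80170a7d357b611b3a4310353e22724f1016646d6c50204c681a545364411c0f6231195d1f5b5a380e294a22703600190976344d03030a0948040d045e

/-- One bit plane encodes exactly two colours, so no class has to be checked. The same happens for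
four and eight colours. -/
theorem excess_2 : excess 135 2 planes2 = 0 := by decide +kernel

theorem packedMatching_2 : PackedMatching 135 partners2 := by decide +kernel

/-- The factor 2 appears because a crossing is found from each of its two edges. -/
theorem crossCount_2 : crossCount 135 xsTwo ysTwo planes2 = 2 * 1468394 := by
  decide +kernel

/-- Only an upper bound on the limit is drawn from this number, so no optimality of the listed
matching is needed. -/
theorem totalWeight_2 : totalWeight 135 2 xsTwo ysTwo planes2 partners2 = 1846639 := by
  decide +kernel

/-- The bit planes of the colouring with 3 colours. -/
def planes3 : List ℕ :=
  [0x4000000000000000000000000000000000000000000000000000000000000000000020000000000000000000000000000000006800000000000000000000000000000000200000000000000000000000000000000012000000000000000000000000000000001100000000000000000000000000000000128000000000000000000000000000000053c000000000000000000000000000000001e00000000000000000000000000000006c20000000000000000000000000000000002000000000000000000000000000000000e00000000000000000000000000000006c800000000000000000000000000000004f4000000000000000000000000000000010120000000000000000000000000000004c004000000000000000000000000000002029a000000000000000000000000000002409a00000000000000000000000000000101b40000000000000000000000000000010d60000000000000000000000000000004f0118000000000000000000000000000011720200000000000000000000000000006c00cd00000000000000000000000000006e0918400000000000000000000000000000e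0068000000000000000000000000000101d605000000000000000000000000000202da378000000000000000000000000004c00b80c00000000000000000000000000501f605600000000000000000000000000237081200000000000000000000000000001e60294000000000000000000000000002809a962000000000000000000000000002809b962000000000000000000000000004c08380730000000000000000000000000101b4450000000000000000000000000002029a37b080000000000000000000000004bd0188482000000000000000000000000237081208000000000000000000000000003b08380c1800000000000000000000000101f64500400000000000000000000000012b28380c98000000000000000000000005bd6109482d0000000000000000000000001e04689447800000000000000000000006c00382f3e20000000000000000000000000a6029dc6a8000000000000000000000001e44689447800000000000000000000006c00dd2d362000000000000000000000002c00dd2d37200000000000000000000000101244590424c0000000000000000000004bc0180482d06000000000000000000000101f64540607f00000000000000000000011328210415c8800000000000000000000101344190424f400000000000000000000501f30560a07c0000000000000000000000024020d5829048000000000000000000051d60094c25582400000000000000000002370832081dc08200000000000000000004f091844b2c0601000000000000000000001a0069d4e280ca00000000000000000002c09a9622800400800000000000000000011f60294105582640000000000000000004c00380f3a020482000000000000000000581f30560a07e0448000000000000000002429a162390a688ac000000000000000004b401844a3d06a122000000000000000002909a9622800680ab000000000000000002029836b090a68a8d000000000000000006e091864b2c262122c000000000000000001e04689443817a1400000000000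0000002409a162390a680a9a0000000000000000101204494425f5000100000000000000002340812081d80e1812000000000000000012b08380c1cc8a3111200000000000000010720210415c892501100000000000000012b20290c18c883111280000000000000051d61094c2d58255251c0000000000000001e04689447817b1405e000000000000006c00182d3e20048a6e80000000000000000024028d443904e140020000000000000000e0468d442917e5400e000000000000002c00d52d3620158a6e80000000000000004f011944b2d060123cb01000000000000010124c590424f5000001300000000000004c00180f3a020482ec80000000000000002429a162090a2888fa029a0000000000002409a1623902680a9a009a000000000000101b44500425f5040141b400000000000011c6029442518255011d600000000000004f091844b2d060122cb01180000000000011f60210005c9025811f602000000000004c00dd2d3620158a7ec00dd000000000006e091a64b28260122ca08184000000000000a0068d462105a5400e00680000000000101f64560207f1448141f6050000000000202da37b090b6cedd202da3780000000004c00380f3a020082ecc003804000000000501f70560a0770448541f60560000000002370832081d8082812370812000000000011f60290005d8065011f60a900000000002801a9626802600a92809a9620000000006809396218026008a4809b9620000000004c00380f3a021082ac8083805300000000101f44500427f5040141f40500000000002029a36b090a68acd2029a37b0800000004fc01884a3d02a1034bc010848200000002370012181d8081812360812081000000023b08380c1cc0a39123b08380c18000000101f44500427f1040141f445004000000012b2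8280c9848a31112b20280c180000005bd61094c2d58254253d61094c2d00000001e04689447817a1405e046890478000004c00180d3a2204826c808180d3e200000000a6069d462804a540022069d40680000011e04689557817a1415e046894438000002c00dd2d3620158a7ec00d52d2620000006c005d2d37201d8a3ec00dd2d362000000101344590424f4000141344590424c00004b401804a3d06a1224bc8180483d160000101f64d40407f1440141e64540407f000011720210415c8821111322210515c88000101b44590424f50601413445804a4f4000501f30560a07e0448501f20570a07e00000024020dc02904e140024028d40280480051d61094c2558255051d61094c2d5824002370832081dc083912370812081dc082004f091844b2c0601a2cb090944b2c06010000a0069d442807a5440a0068d4e2807a002c09a1722802680a9a809a16228026808015d6029440558265011d682940057825404c00380f3a0204c2ec800380f3a0000820501730560a07e040a501f30560a07e0448242da162390a680ada209a162390a680ac4b40180493d06a1224b401844a3d062162,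
   0x100000000000000000000000000000000060000000000000000000000000000000006c0000000000000000000000000000000028000000000000000000000000000000002c000000000000000000000000000000001200000000000000000000000000000000134000000000000000000000000000000043d80000000000000000000000000000001318000000000000000000000000000000134600000000000000000000000000000000a0000000000000000000000000000000680900000000000000000000000000000013c600000000000000000000000000000041c440000000000000000000000000000008a20000000000000000000000000000006804b800000000000000000000000000004d0098000000000000000000000000000000e08600000000000000000000000000006c04390000000000000000000000000000134710000000000000000000000000000001c4468000000000000000000000000000131ba040000000000000000000000000006c2099200000000000000000000000000001c044800000000000000000000000000003844480000000000000000000000000002c20992000000000000000000000000000100f2052000000000000000000000000006c1099220000000000000000000000000004a006894000000000000000000000000004a002896000000000000000000000000003c446a8c00000000000000000000000006c04b9263800000000000000000000000001444484400000000000000000000000000420830970000000000000000000000000100f205209000000000000000000000000300f20760a0000000000000000000000006c0099263b000000000000000000000000680d30760000000000000000000000000004008b0971200000000000000000000000121700508080000000000000000000000013c6441080d000000000000000000000005359346208560000000000000000000000121b0050808500000000000000000000001356005080d580000000000000000000005356001080d58000000000000000000000688d39260a03000000000000000000000004288389752800000000000000000000006c209922390808000000000000000000006c4c39263a0300000000000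00000000000680cb9660a0300000000000000000000002c208b2971080c000000000000000000006bd974e286d273000000000000000000002c20992139080880000000000000000000100f20560a03e04000000000000000000000e04689443817a0000000000000000000525b104280d6f11000000000000000000000a00689552a0fa00000000000000000006c0099222b08088a00000000000000000003c44490c4f1135400000000000000000024208b21710808ab00000000000000000001c456894430136100000000000000000004a08789542804a140000000000000000004a00689552a06a140000000000000000001c444800471174500000000000000000001e04689443815e1400000000000000000121b205081c7e01400000000000000000008e04e89442017a1400000000000000000680970260a020048a68000000000000000101f20520807e044890000000000000000600f30720a03604ca600000000000000006c04b9263a03004abe8000000000000000680db9660a03620ca680000000000000002c208909310808aa5a8000000000000000121600508085e006812000000000000000134e441080d19354017c0000000000000043d934628ac6f310a03d80000000000000131b205080d6e0108131800000000000005347085080d5805400746000000000000000e0068945280fa1400e00000000000000680d30260b000048a7c08000000000000003c6449084f11354017c6400000000000001c4568944311761005c4400000000000008b00e89442817a160ea000000000000004c04b9262a02004abe804b8000000000006c0019223908288a7e800980000000000000e0068945281fa1400e046000000000006c00b9261b0008ca3e800b9000000000003347005080d5805401357000000000000001c44489447017e1405e14680000000000135b205280d6f2108131b60400000000006c2099203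908088a3e820992000000000001c0448446701310005c0448000000000003c44680c4f11755002c446880000000002c2089213108882a7a8209920000000000100f20520807e0548100f20520000000006c0099263b00088abe800b12600000000004a8068915280ea1680a0068940000000004a0c28961280ea3580a0028960000000003d44680c4f10771407c44688c000000006c00b9263b00084abe800b92638000000041c4448444711741045c4448044000000000008329502804ab480208b09700000000100fa0520807e0448101f2052080000000500f20760a03e0448500f20760a00000006c00b9263b00084abe800b9263b0000000680d317602036048a680d31760a00000000420ab0931000cabda8208b09300000000121f00508085e014012170050c0800000013c6449084d11354017c6441080d0000005359304280d6f310853d920428a9600000021b00508087e0140021f005280c5000005356005080d5c05401356081090d5800001356801080d5a05401356001080d580000680c39260a03014ca680cb9260a030000004a08389542804a15802086897428000006c0099223b08080abe80199223b08080006c0cb9243a03004eae84c99262a03000006804b9260a0300483680cb9262a03000002c208ba971080c2b7a8209ba871080c00063d974e20ed27310a47d974628ed2730002c008929390808aa7a8008921310808800500b20564a03e0448500f22560a02e040000e04689453817a1400e05689453817a00135b204283d6f0108135b604281d6f010000a00e89552807a1400a00e89552817a00680099223908088a7e80019223b08088a003c44490c4f11315007444490c4f1175402c208b29710808ab1a8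208b21710808ab000c05689443017e1005604e89443017e1004a28789642804a1580a0068954280ca14]

/-- The matching for 3 colours. -/
def partners3 : ℕ :=
  0x2f252873493d5e3c1809385928402a003225110110170f222a31280d74036f1b04212f61541d0f811a523c1c13254a062a1210600e2e2e575809231f0643665984735365302528011e72805e7e7d137b146c2a44101f3f65620907227b0335191d630d672d6d641d0c05775f085d5c6006374a282a552e001962190258710c7020212d47164544

/-- Two planes could encode four colours; the fourth class is empty. -/
theorem excess_3 : excess 135 3 planes3 = 0 := by decide +kernel

theorem packedMatching_3 : PackedMatching 135 partners3 := by decide +kernel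

theorem crossCount_3 : crossCount 135 xsMany ysMany planes3 = 2 * 732746 := by
  decide +kernel

theorem totalWeight_3 : totalWeight 135 3 xsMany ysMany planes3 partners3 = 1229484 := by
  decide +kernel

/-- The bit planes of the colouring with 4 colours. -/
def planes4 : List ℕ :=
  [0x400000000000000000000000000000000000000000000000000000000000000000002000000000000000000000000000000000680000000000000000000000000000000060000000000000000000000000000000004a000000000000000000000000000000001d000000000000000000000000000000005a8000000000000000000000000000000031c000000000000000000000000000000001e00000000000000000000000000000007dd00000000000000000000000000000006a3000000000000000000000000000000010b80000000000000000000000000000007dd20000000000000000000000000000006a2000000000000000000000000000000068108000000000000000000000000000005cc6000000000000000000000000000000214fe0000000000000000000000000000025cd6000000000000000000000000000003c12c8000000000000000000000000000035d62000000000000000000000000000004a24de00000000000000000000000000001ddb2a00000000000000000000000000007dd21980000000000000000000000000006e2d56c00000000000000000000000000052a932a000000000000000000000000000147fc25000000000000000000000000000332fa1700000000000000000000000000058a66a9400000000000000000000000000147f425c00000000000000000000000000696493040000000000000000000000000035db20bb0000000000000000000000000028c93eeb4000000000000000000000000068893ee94000000000000000000000000048ad7ab6400000000000000000000000003c32cd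1030000000000000000000000000332fe172880000000000000000000000006340952d8e00000000000000000000000063648134c30000000000000000000000004bb99ac4c38000000000000000000000001432cf50350000000000000000000000004ab93ac1c38000000000000000000000007356953b8ef0000000000000000000000001efe6d9443800000000000000000000005dd61a9f7a1400000000000000000000007a3e3a3f8a8e000000000000000000000000ff66dd443b00000000000000000000006d519d6db6f400000000000000000000006f59dd6db7f040000000000000000000006810dd2b2c24e0000000000000000000006700952d8ff82000000000000000000000147bc650350df8000000000000000000000d393a42715ec0000000000000000000007c10dd293d24fc0000000000000000000010bf22dd532fe6000000000000000000006a34fb2b888f108000000000000000000035d621bf987586c00000000000000000004b649b4483d868600000000000000000004a25df44a78979600000000000000000007a39323f4aae84a000000000000000000024c964e26432770800000000000000000035da20bb38d7869e0000000000000000005ce63a967a0382e700000000000000000050ff22df4a0fe0e5800000000000000000254de562b8d37b5c8000000000000000006ba0d50d87e87d1820000000000000000028892eeb64627723a00000000000000000234fe17289db7814d000000000000000004e2ddf44f78979673c000000000000000010ab26cf662b85a1c0000000000000000025cde5e2bc5373588a000000000000000068109d2f0e24b54aa680000000000000002346813001d9a85c1300000000000000004bb91ac4c38e6a3324a0000000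000000001dfb6a62785680a3e9900000000000000052b93ac9e08ee433e5a80000000000000031d6813f9ef586dcd31c0000000000000001ed46c9447b77e540de000000000000005dd6189d7a5582876d9d000000000000007a3c3a2f8a8f84e8e6a38000000000000052a936ff4e2f84a5c422800000000000007dd218bd3274e69a6f9d200000000000004a20dd0487e87d7836e2100000000000006810dd2b2e24e54a3681080000000000005cc61a967a0182e76d8e60000000000000254df57299d37b5c9a54de00000000000025cd65e27c72735a8a5c960000000000003c12cd30312cfd0a3bc12c80000000000035d620bb3877869ccb1de20000000000004a24df4487a8797834e24de0000000000015db2a7278569083c99db2a000000000007dd019adb674e69a6e9d099000000000004e2d5e64778979672ce255ec0000000000523932af4eae84a5c423932a0000000000147fc650310df9a75947fc250000000000332fe17689dbe89cd352fa17000000000048e67a964b0b1267e5ca67a94000000000147f6254511ff8e54147f42540000000004b64934483d8687836b64934400000000035db28b278568087c91db2ab300000000028c96cea4432770ba28c96eea40000000068a93ee9442266a1248a93ee940000000048ae7a964b0b1965e4cae7a944000000001c32cd10352cfd0a1bc32cd50300000000216fe17689db789cd750fe1728800000006340952d8ff00e9876300952f8e00000006164910483d9685c3616491248300000004bb99bc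4c3c86a3134aa19ac4cb80000001432cf50352cfdae19c32cd503500000004ab93ac9c38eea3324eb93ac1e380000007356813f8ef58edc571d6853f8ef00000000ef66d9443b57a5505ef66d94438000005cc61a957a1582e76d9de1a977a14000007a3b323fcaae84ade6a3a323f0a8e0000000ef26dd462b17a5c10ef66dd443b000007d51992db674e69a7e9d09d6db6f4000006f59dd6db6f43d9a7ed51dd6db6f0400007c10dd292c247c4a3ec10dd2b2c24a00006300952d8ff83d1836300952d87e8100001433c750350df9a619473cf50352df80001d792a42705ec2a3a99393a42795ec00003c12dd291d24fd0a3bc10dd283524bc00014bf22dc532fee65490bf22dc552fe60006a347b2f988f10f8e6e3cf92b888e0080034d6a1bf987586dcc31d6a13f9cf586c004b719b44c3d86a7134be19b4483d86a2004a24df4487a9797234e25df4487a8796007239322f4aae84a5e423a32bf4aaf84a8025c964e26472770b8a7c965e26c327718035d220bb3857869fcb1de20bb3857869e05ca67a966a030267edce63a966a098267010bf22df430fe465c50ff22dd530fe0e5825cdf562bc53735c9a74de562b8d37b5886320950d87e87d1836304d52d87e83d182,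
   0x6000000000000000000000000000000000500000000000000000000000000000000010000000000000000000000000000000004c000000000000000000000000000000004c000000000000000000000000000000000e000000000000000000000000000000004d0000000000000000000000000000000022000000000000000000000000000000006c0000000000000000000000000000000011f00000000000000000000000000000007e100000000000000000000000000000007c1c00000000000000000000000000000011fa000000000000000000000000000000303f0000000000000000000000000000006fe480000000000000000000000000000030ff8000000000000000000000000000001f564000000000000000000000000000005bd65000000000000000000000000000002fe08800000000000000000000000000002629640000000000000000000000000000303f6600000000000000000000000000000e096c000000000000000000000000000011f2a280000000000000000000000000001036ef80000000000000000000000000007e0db9200000000000000000000000000007e08680000000000000000000000000005f1218000000000000000000000000000030bfd3f00000000000000000000000000007e00688000000000000000000000000004c845c8d000000000000000000000000002609646b8000000000000000000000000053d6569dc000000000000000000000000013d6469dc000000000000000000000000030b6c3f0400000000000000000000000002fe08b89f00000000000000000000000005f125814b0000000000000000000000000305fe57b0c0000000000000000000000004e845e9d760000000000000000000000004d495c4d3600000000000000000000000007e08b89f1c000000000000000000000004d497c49366000000000000000000000002029e56b8d2000000000000000000000006c0fb9763b00000000000000000000000031ff83f0411c00000000000000000000006e18f922bb8600000000000000000000006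c1fb9763b03000000000000000000000001f922c2c9de000000000000000000000003f922c2c8da40000000000000000000006fe01ba2f9d80000000000000000000000341fe57b0c2fd00000000000000000000007e08389f1f808000000000000000000000e897ccbb4b274000000000000000000006fe09ba0f9d80a0000000000000000000003e04689d5f817000000000000000000007e12f932b98698000000000000000000002609676b1ca275800000000000000000004c844ccd762077c0000000000000000000303ee6320d0f99600000000000000000007e1fb9223b87884800000000000000000053d65494c6f597540000000000000000002609646bf422758a00000000000000000030ff83f0410dea6d00000000000000000003e04689c4f817b10000000000000000005b564c1482d5975400000000000000000030bfe47b0c2f954c80000000000000000053d6569de6f597750000000000000000005f565814b2d590162800000000000000001036e6324d0f996d9000000000000000007c0fb9663b02884abe00000000000000005bd65c9486d593542500000000000000006fe49ba6fbd90afffe80000000000000004ea65e9d76a1b7e76dc0000000000000004d495c4d367275826cc0000000000000000e896ccbbca27792e8e0000000000000004d497c4934727582ecd0000000000000002229e76b1c227588d260000000000000006c0db9663b03684ebe800000000000000031f7a3b2415fea2d931f000000000000006e1af932b986880ebfe1800000000000007e0db9763b06884abea0c000000000000011faa3924d5eea31911fa0000000000000303f65720d2f9d6c8343e00000000000006fe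49ba2fbd80afb7ebe4800000000000030ff83f0410dea6d930ff80000000000005b565c14a2d5935605f5640000000000005bd65494c6f59354257d650000000000002fe08ba9f1d80ebb7abe088000000000002629646bfca275a8ca6296400000000000303fe7320d2f99649343fe40000000000006096cebbca26792c8e096c0000000000011f8a282c95eea31901f922800000000001036e7124d0f996d9343ee7800000000007e1db9323b87884abea1fb92000000000007e08289f5f80eb3583e086800000000005f125814b2d480122df12181000000000030bfc3f0410dfa6d134bfc3f000000000007e00689d5f80f31403e006880000000004c845ccd762077d36cc845ccd00000000026096e6bbca27792c86096c6b80000000053d6549cc6f59755057d6569cc0000000013f6469dc6f596f5017f6469dc0000000030b7c3f0410df96d134b7c3f24000000000fe08b89f1d80abb5abe08b89f000000005f565814b2d590162df165814b00000000303fa57b0c27f5ccc341fe57b0c00000004c845e8df6a177e76cc845e8d7600000004cc95ccd363075826cdc15c4d3e000000007e08b8971f80ebb58be08b89f5c0000004d497c49367277826cd497c493660000002009e56b0c2a7d88d2609e56b0d20000006c0fb9763b03484eae80fb9763b000000030ff83f2411dea6d931f7a3f0411c000007e1df922bb87884abee1cb9223b86000006c0fb9763b03084ebf80fb9763b0300000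11f92282c95eea31801f922c2c9de0000003f922c2c9de2231801f922c2c9da400006f609ba0f9d80afb7ebe09ba2f9d800000301fe57b0c2fd54c9341fe57b0c2df000007e08389f1f80eb3583e08f99f1f8080000e896ccbb4a27792e8e897ccbbca2740002fe09fa0d9d80abb7abe09ba1f1d80a00007e04688d5f81fb1487e04688d5f8170007e12f932ad86981ebfe1af932b987880002629e76b1ca275a8c2609e72b1c22758004c815ccd362075d26cc815ccdf62077800303fe7320d2f996c9343ee6320d2f996007e1db9323b87884abee1eb9263b868840053d65494c6f59755055d65c94c6f5975402629646bfca2758acae29646bfca275aa030bfc3f0410dea6d134ff83f0410fea6d003e04689c5f81731407e04689d5f817b105bd65c1486d5935425dd65c1482d593500303fe47b0c2f954c9341be57b0c2fd54c8]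

/-- The matching for 4 colours. -/
def partners4 : ℕ :=
  0x261f130143023c2218391359067a342c62154545321777185931353b73250d022b43822c541d1c2e80623c1c79032813111110600e1e540b3639081f14306625043f532130257921765f5e5d7e71137b14387b771e597383194d4b3a344b060d1d4204083a6d6431502f774608725c00793128792a122e445d1e1e4d7a4d674b14732d254d3f0f

theorem excess_4 : excess 135 4 planes4 = 0 := by decide +kernel

theorem packedMatching_4 : PackedMatching 135 partners4 := by decide +kernel

theorem crossCount_4 : crossCount 135 xsMany ysMany planes4 = 2 * 413342 := by
  decide +kernel

theorem totalWeight_4 : totalWeight 135 4 xsMany ysMany planes4 partners4 = 943035 := by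
  decide +kernel

/-- The bit planes of the colouring with 5 colours. -/
def planes5 : List ℕ :=
  [0x50000000000000000000000000000000005000000000000000000000000000000000040000000000000000000000000000000040000000000000000000000000000000006e00000000000000000000000000000000490000000000000000000000000000000024000000000000000000000000000000005c0000000000000000000000000000000011f00000000000000000000000000000003758000000000000000000000000000000341c00000000000000000000000000000011d600000000000000000000000000000020240000000000000000000000000000006b4880000000000000000000000000000011f64000000000000000000000000000000dd04000000000000000000000000000005a921000000000000000000000000000006b209800000000000000000000000000002409a0000000000000000000000000000020244600000000000000000000000000006e8938000000000000000000000000000011d602800000000000000000000000000010a6c78000000000000000000000000000361f20600000000000000000000000000026a08ba0000000000000000000000000004d505c000000000000000000000000000010e6c6900000000000000000000000000026a083880000000000000000000000000004044459000000000000000000000000002c09296b000000000000000000000000005292129dc000000000000000000000000017b6529dc000000000000000000000000010e6c7b0400000000000000000000000006a209b22880000000000000000000000004d505c04340000000000000000000000002020a52b1c00000000000000000000000004844499b4000000000000000000000000454d4444120000000000000000000000002e209b20e9800000000000000000000000414d7046024000000000000000000000002418a52b1d2000000000000000000000005c0f38503000000000000000000000000011f64290415c00000000000000000000002719a16298c6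00000000000000000000000c0f28523007000000000000000000000011df00d0c0d1000000000000000000000013cf00d0c0d300000000000000000000006b40b3268bd200000000000000000000002020e52b1c2810000000000000000000002ea28ba0f18808000000000000000000004e89384f2a8264000000000000000000006b00b9268bd8080000000000000000000006a0c789f1c81b00000000000000000000775be1769ad4f2000000000000000000000409a56b3c22048000000000000000000004054444142175c00000000000000000002024c51945291d60000000000000000000361d2162b8c7e0580000000000000000005a921a9d46a486200000000000000000002c09296b7822648a00000000000000000010e64690411d9b6500000000000000000006a0c780d58839b100000000000000000048d04c84063493020000000000000000002024462b0c281de8c0000000000000000052b2129dd2ac86f50000000000000000004dd04c04365013422800000000000000002024c79905291c65100000000000000000141d28723806e04688000000000000000058d01c84462497032500000000000000006749b1269ad200d8fe000000000000000006865c9d742137c648c000000000000000414d7044025371408440000000000000004e89386b3a826282aca000000000000000494970468a527050a4d0000000000000002409a52b3c220c88da00000000000000005c0f3850300380462d800000000000000011f64290405dfa65015f00000000000000371ba17298d6e01c933180000000000000361f2072b886e0428f21c000000000000011d602904055e275011f600000000000002024462b0d281de94242400000000000006b40b1268bd208d8f6348800000000000011e64690411d9b65015f6400000000000048d04c8426349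3020cdd040000000000005a921e8d46a4860125a9210000000000006a209b268bc8083af6a2098000000000002409a96b3c22448aca009ac000000000002024c7094f291ded12424c6000000000002e0938eb3822648aeaa09380000000000011d702d0c055e275011d7028000000000000a6c79945291d6d114a6c780000000000361f2062b886e05a8b21d206000000000026a08ba0f1880aab1aaa08ba00000000004d505c00325013522cd405c0000000000010e6c79045099b65114e6c69000000000006a0838171880a2b1a2a083800000000000404445c342175d44844544580000000002c09286b382264caeaa09396b0000000005292129dc6a48621252b2129d40000000013b6429dc3dd8cf5457b6429dc0000000010e4c7b045291b65114e6c4904000000006a209b22a988083b76a209b22a800000002dd05c00345013422cdd05c003400000002400a52b1d2a1588c2008a52f1c000000004044419b4a177c6484864459340000000054d4444065371c40d54d44441200000006a209b20e9a80c3b7aa209b22e98000000494d704602527040a454d70460240000002408a52b3d220d88da008a52b1c20000001c1f285330078046a981f385030000000011f66290415fbb65015f64290411c000003719216298c7e05c0a21da16298c6000000c1f28523007a046a981f281238070000011de0290c0516255211d70290c0d10000013cf00d0c0d30255011cf00d0c0d1c00006b40b1268bda08d8f6b00b1260bd2000002020e52b0c281dc8d2420e52b1c28100002e208ba0f988083b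3aa208ba0f1a8080004e89386f3a826282a4a89384f2a82600006b20b9268bc80898f6b20b9268bc80800006a0c789f1c81f3b586a0c388f1c81b000375be17298d6e01c9b35ba17698d6e00002409a56b3c22048ada009a52b3c230d800040d444c162171d4404454444962171c002024c70945291de110424c73945291de00361f2062b887e0588921d2162b8c7e05805292169d46a4862325292168d4624860002409a96b7c22448aca809a9eb7c22648a010e6c690451d9b61114e64690411d9b65006a0c780d5881931186a0c781d5881b31058d05c844634970224cd05c844634970002020c42b0c2815e8d2420e52b0c281ce8c,
   0x6000000000000000000000000000000000500000000000000000000000000000000050000000000000000000000000000000005c000000000000000000000000000000000c000000000000000000000000000000000300000000000000000000000000000000050000000000000000000000000000000002000000000000000000000000000000006c0000000000000000000000000000000030b00000000000000000000000000000007c000000000000000000000000000000006e0c0000000000000000000000000000003098000000000000000000000000000000301f00000000000000000000000000000027e4800000000000000000000000000000303b8000000000000000000000000000005e160000000000000000000000000000005b5650000000000000000000000000000007e08000000000000000000000000000000229640000000000000000000000000000301f640000000000000000000000000000038944000000000000000000000000000000b0a38000000000000000000000000000103fa100000000000000000000000000006c04b9200000000000000000000000000003e00680000000000000000000000000005e1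2181000000000000000000000000000303b83700000000000000000000000000003c00688000000000000000000000000004ca05e8d00000000000000000000000000020164498000000000000000000000000053765414800000000000000000000000001356541480000000000000000000000000303681700000000000000000000000000007e08289f00000000000000000000000005e121814b0000000000000000000000000321f64720c0000000000000000000000005ca25e8d770000000000000000000000000dc05c897400000000000000000000000003e00289d1c000000000000000000000000d404c0934600000000000000000000000223964620ca000000000000000000000006c09b9663b000000000000000000000000303ba370410c00000000000000000000006c00d922390000000000000000000000006e19b9663b02000000000000000000000000b9a2c2490a000000000000000000000000a922c2490a000000000000000000000007e48980f1d90000000000000000000000321f64720c27f00000000000000000000003e00289c4f80000000000000000000000028044c9d4e0740000000000000000000007e48380f1d80a0000000000000000000003c0448084f017000000000000000000003c028d30310689000000000000000000002209664b84a275000000000000000000004c805e89762017a0000000000000000000301fe372090798400000000000000000006c04d9223b0118480000000000000000005b565c1482d5915400000000000000000002096449c4e27710000000000000000000703b8370010ee82c00000000000000000003c04489c4f017110000000000000000005b16081482c58056000000000000000000301f64720c07f14c8000000000000000005356541486d591540000000000000000001e121814b2858016280000000000000000301fe132090798449000000000000000006e2fb9263b82084abe00000000000000005b16581482d5805625000000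00000000002fe48b90f1d90abf5a80000000000000005ca05e8d772c9fa36dc0000000000000000d404c093470158268c000000000000000038144c984e0779040600000000000000005404c09b47015924850000000000000000209664b8ca275108060000000000000006c19b9663b02080abea0000000000000003033a3b2410ee0299303000000000000007c02d9323900190e3bc0000000000000006c0cb9263b02084aba80c000000000000030b8a382490ee829920b80000000000000301f64720806d14c8341f000000000000027e48b80f1d90abf5abe48000000000000303b8370010ee82dd303b80000000000005b160814a2c580162da1600000000000005b56501482d5b15425756500000000000007e08289f1d80ab1583e080000000000000229644984e27530806296400000000000301fe1720a07914c9341fe000000000000038944c984e2779040689440000000000000b9a3c2490eea21900b9a380000000000101fe112090f884c9141ea1000000000006c04f9223b00084abec06b92000000000003e00689c4f80631403e006800000000005e121814b28480022da121810000000000303f8170090de82c13037817000000000003c00689c4f007b1403c006880000000004ca01e89762017a36cce05e8d0000000000309444984e277504060944498000000005356541482d591542575654148000000001756441496f593540d756441480000000030358170090de80c13037817200000000007e00289d1d80ab1583e00689d000000007e121814b284801629a121814b00000000323f64720ca7f5448361f64720c00000004ca25e8d762817a36cca05e8d7700000004dc05e896470178368dc05e8974000000007e00289d1f80eb1403e0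0289d1c00000005404c093470158248d404c093460000000209646a8caa750080609646a0da0000006e09b9663b02084abea09b9663b0000000303ba372410ce82993033a370410c000006c00d9223901184e3ec04d9623b00000006e0db9663b82084abea09b9263b020000000b8a382490a6a21b00b9a382490a0000000a9a2c2490a0a21900a922c2490a4000007e48b80f1d90abb583e48b8071d800000301f64720c27f14c8361f64720c27f000003e00289c1f80eb1403e02289c1f800000028044c9c4e077904068144c9d4e07400007e48381f1d80af3583e08381f1d80a00003c0448084f01390007c0440084f0170003c0289303900990e3b802d9303304990000229664b84a2751080629664b8ca3750004c805e81742017a36ccc05e89742017a00301fe172080799409341fe1720807994006c04f9223b01084abcc04f9263b01084805356501482d5915625756501482d59154002296449c4e275118062964c9c4e275300303b8372010de82c1303b8370010fe82c003c0448984f01710407c04488c4f0171005b16081482c5805625b16181482c580540301f64720c07f14c8341f657a0c27f04c8,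
   0x20000000000000000000000000000000000000000000000000000000000000000000300000000000000000000000000000000000000000000000000000000000000000003000000000000000000000000000000000480000000000000000000000000000000002000000000000000000000000000000000200000000000000000000000000000000008000000000000000000000000000000001c000000000000000000000000000000002200000000000000000000000000000000cc00000000000000000000000000000001003000000000000000000000000000000060000000000000000000000000000000000200000000000000000000000000000000020800000000000000000000000000000100f200000000000000000000000000000480418000000000000000000000000000005c088000000000000000000000000000000268100000000000000000000000000000209440000000000000000000000000000214000000000000000000000000000000001c0448000000000000000000000000000480c30000000000000000000000000000000800288000000000000000000000000000700000800000000000000000000000000480c382600000000000000000000000000121b202200000000000000000000000000402492040000000000000000000000000024008102000000000000000000000000002000a102200000000000000000000000000f000809b0000000000000000000000000100f20540000000000000000000000000000a40289400000000000000000000000000c801a806000000000000000000000000002192042080000000000000000000000003002203208000000000000000000000000400d205602000000000000000000000000300281300800000000000000000000000048801a80600000000000000000000000000310400080c000000000000000000000000200140984a0000000000000000000000000c00488463000000000000000000000001140440080d000000000000000000000000200440004048000000000000000000000001004000004c000000000000000000000100b00500004e0000000000000000000000cc00a8060000000000000000000000000400d30060a0300000000000000000000003046813000018800000000000000000000100b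00500003e000000000000000000000680038220a00000000000000000000000000801289442004000000000000000000004860180443080840000000000000000000301a20320806800000000000000000000005c000803050028000000000000000000001c00480443007000000000000000000000020810219080888000000000000000000402492040309086400000000000000000007000009b4e00490000000000000000000680018222800000a8000000000000000000020120941080ca14000000000000000000cc00880701002030000000000000000002000a10209000808d0000000000000000000240289402004a140000000000000000005c000003050029a48000000000000000001c044008450131000000000000000000000208309090808a0500000000000000000100240400004c0000100000000000000000019204288824010800000000000000000300281320804800c030000000000000000300681140109084c1300000000000000003006813001010a0c13000000000000000048201800430800232480000000000000000300400080c460100040000000000000000208044984a0051000200000000000000000c0068846200601040c0000000000000001c0448004701310005c000000000000000201444084a0150000600000000000000005c0098070100202089c00000000000000100b00500004f00001013000000000000006000009b4e004900820000000000000000020120941080ce140020000000000000000208102090808a0500208000000000000100f2050000340440100f2000000000000480412040309084034804100000000000005c0088030500202481c0080000000000040248114030908441402481000000000000200440004a0110000600440000000000025400020105002904a140000000000000001c0048004701700001c04480000000000480d30060a030044a400c30000000000000084028944200421000a4028800000000007000809b0f00492483000808000000000680038260a020040a48083826000000000121b2022080680008121a202200000000040249114030908241402480140000000002420810219080888d2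00081020000000002000a1022802000a92000a12220000000007000809b0d0049248b000a09b00000000000f2054020340448100f205400000000000240289402104a100024028940000000008801a8060000023288a01a8060000000012192042080680008121920020800000003012203208048008820122032080000000000f2056020300448400f2054020000000300281300801820c13002813008000000048a01a8040000023248201a806200000000100400080d0711000500400080c0000000600040994a0049000200040994e00000000c0048046300701001c00488443000000114044008050531000540444080d0000000201444004849100006004440142480000001044000004f100006104400000400000100b00500004e1040101b00508005e00000cc00a8070000223288c00a80601000000400d3056020300448400d10560a0300000300681100101084c130468130000188000100b00500003e0040100f00500007e0000680038220a020000a680038270a02000004080168946200601044800688442006000480018044308082124800188443080000030122032080680088301a203208068000005c0008030500202481c0088030500200001c0048044701700001c004804430170000820890219080888508208102190808a80480412040309086034004120403090840007000009b0e00492483000009b4e004920680038222800008aa680038222a00008a800200209010a08a1500200209010808a340cc00a8070100203088c00a80701002032]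

/-- The matching for 5 colours. -/
def partners5 : ℕ :=
  0x2f0313014b723c1e3a092859200634441e032145501777045903066f1d7b6f812d4320290e267767801e181c5775284a4512100f0e620c1358090c8558212b15131d2c4b49036c0132815c1e3c7d576e20792a4419371105724d07666e690622746d2b086643412c0c0560675e723c5306376c2834450e005d620e132071674b4a30487b467344

/-- Three planes serve for five to eight colours; here the classes 5, 6 and 7 are empty. -/
theorem excess_5 : excess 135 5 planes5 = 0 := by decide +kernel

theorem packedMatching_5 : PackedMatching 135 partners5 := by decide +kernel

theorem crossCount_5 : crossCount 135 xsMany ysMany planes5 = 2 * 264459 := by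
  decide +kernel

theorem totalWeight_5 : totalWeight 135 5 xsMany ysMany planes5 partners5 = 758845 := by
  decide +kernel

/-- The bit planes of the colouring with 6 colours. -/
def planes6 : List ℕ :=
  [0x2000000000000000000000000000000000300000000000000000000000000000000078000000000000000000000000000000007c0000000000000000000000000000000078000000000000000000000000000000006cc000000000000000000000000000000013000000000000000000000000000000005b4000000000000000000000000000000003f800000000000000000000000000000013d80000000000000000000000000000005b4e0000000000000000000000000000000de000000000000000000000000000000068090000000000000000000000000000004bc640000000000000000000000000000041e960000000000000000000000000000000e9800000000000000000000000000000681cf800000000000000000000000000002c849800000000000000000000000000000de00e00000000000000000000000000007c26bb00000000000000000000000000005f5f58000000000000000000000000000027c446800000000000000000000000000013db20c0000000000000000000000000007432d9300000000000000000000000000001ed66c00000000000000000000000000043c47084000000000000000000000000003c32db7000000000000000000000000000321fa176000000000000000000000000006c269b320000000000000000000000000024b087e94000000000000000000000000024a083b96000000000000000000000000043cc768fc00000000000000000000000006c14fd262800000000000000000000000001e966c6cc0000000000000000000000004de09b8970000000000000000000000000321f217288000000000000000000000000721fb1760b0000000000000000000000007c10dd263f400000000000000000000000782db9760b0000000000000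000000000004cc09b89733000000000000000000000001356045984f000000000000000000000005bc67c168ed0000000000000000000000013df2672c8d6000000000000000000000013df005984f500000000000000000000005f56183db2d580000000000000000000007f56183db2f1c000000000000000000000781d7d2f0e2300000000000000000000004de09b89757800000000000000000000007c32dd263b0cf8000000000000000000007c6fb1363b0f8800000000000000000000680dfd2f0e23140000000000000000000034bf8bfd710dec0000000000000000000063fd66e2cedf73000000000000000000006ca489ad7b0948c0000000000000000000721fa1768a87e04000000000000000000007e04e89f4f837f000000000000000000013db22d2c0d6f2b000000000000000000020a9a7e955286fa80000000000000000006c249b367b0908ee0000000000000000004bc47496cef31354000000000000000000343f8375730de8ef00000000000000000001e9e7cb457a7f218000000000000000000de01e89747a06b360000000000000000024a083e975286ea950000000000000000001e966ca4d7a7f7180000000000000000027e04e89f4f837f348000000000000000013db00d980f7e69440000000000000000008e9e7c9453a7fa91000000000000000006809746f0e221548a60000000000000000331f207288c7e05c830000000000000000781fb1760b0fe84cb780000000000000007c26bb363b0b8aeebf8000000000000000782fb9760b8bea6eb780000000000000006ce499ad73090ceb7c8c000000000000001316045984f5c7d44930000000000000005b465c548ad1135465fc0000000000000013fd26e2c8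d6f3f1c03f8000000000000013db20d9c0d7e295413d800000000000005b465854a2d590d66df4600000000000000de00e89f5780fb3689e00000000000000680d7c6f0e23054ca6c0d00000000000004bc454968ef31354a47c6400000000000001e9f6cb457a7f21905e9e00000000000020e987c9452a3fa9520e980000000000006814fd262f26154abec1c78000000000006c849bb67b0908cf7e80498000000000000fe00e89f5f81fb3489e04e000000000007c26bb363b0908efbf826bb000000000005f56581db2d5a0d66df56180000000000007e446a9f4f077f3487e4468000000000013db22d1c056e295c13db62c00000000007c32d9203b0cf98a3fc32d92000000000001e966c2ce727771c05e966c800000000043d47686c6f31755a47c2768c0000000003c32cb70310cf8ae7bc33cb70000000000321fa1768a87e05c9721fa1760000000006c269b367b0908efff826bb3600000000024a187e975287ea95a0a187e940000000024a0c3a961286eab5a0a083e960000000043cc768cc6f31771847cc768cc000000006c10fd263f24bd4abec10f92628000000001e9668a4d7a7771845e966cacc00000004dc09b8b703806ab6c9e09b89720000000321f217688a7e05c8321fa172880000000721fb1760a87e84cb721fb1760a80000007c10fd263f04b90abec10fd263f4000000782fb9760b0fea4cb783fb9760b00000006ce09b8973300eeb7e8e09b8d7210000001357045984f56694413d7045984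f0000004bc65c948ed1115425fce54168ed00000013db22d2c0d6f3b5c13db62d2c8d60000013df00d980f5e694413d7005988f5000005f56183db2d5e0d66db56185d92d5800007f56183db2f5e4d66fb56186db2d5c0000681d7d2f0e23054ca6c0dbd2f0e23000004de09b89747806a3789e09f897478000007c30dd263f0cb90abfc10dd263f0cb80007c2eb9363b0f884ebf866b9363b0f88000681cf92e0e23154ab6c1cf92e2e22140003cb38bfd710dec2f5b8b38bf97109ee00023fd26e6ced6f331c27fd66e6cede730006ee499ad7b0908cb7e8c499ad73090ac00721fb1768a87e04c9721fb1760a87e84000fe04e89f5f817b348be04e89f5f817b0013db22d0c0d6f291c13db62d1c4d6e290020e987c955286fa9520e98fe955287fa806c049bb63b0908ee5e8069b363b0908ca043c47486eef31755a47c47496c6f107550343f8bfd710de86f5b43f89f5710de8ef001e9e749057a7f21905e9e7c9453a7f2184de09f89747806b3799e09e89747806b36,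
   0x60000000000000000000000000000000001000000000000000000000000000000000000000000000000000000000000000000048000000000000000000000000000000006c000000000000000000000000000000002c000000000000000000000000000000006c000000000000000000000000000000000200000000000000000000000000000000000000000000000000000000000000000012300000000000000000000000000000002a100000000000000000000000000000007808000000000000000000000000000000123a000000000000000000000000000000008d0000000000000000000000000000006c0480000000000000000000000000000032168000000000000000000000000000005b4240000000000000000000000000000003c64000000000000000000000000000002c60980000000000000000000000000000060084000000000000000000000000000000c46400000000000000000000000000002e00890000000000000000000000000000123b0200000000000000000000000000001146450000000000000000000000000000781939600000000000000000000000000005e002800000000000000000000000000013105000000000000000000000000000003306c1300000000000000000000000000005e0028000000000000000000000000000488d3a86000000000000000000000000000600810d8000000000000000000000000001c444894000000000000000000000000000c046994000000000000000000000000033464010800000000000000000000000002d608b007000000000000000000000000013124004800000000000000000000000000029664944000000000000000000000000488d1ac64a000000000000000000000000688038ae2e00000000000000000000000005e08b80714000000000000000000000006c001c2b3e2000000000000000000000000009064944200000000000000000000000400f30560200000000000000000000000012168110818c00000000000000000000002a18a9a2a8860000000000000000000000400f30562a0300000000000000000000001239a240010e800000000000000000000000392240400a40000000000000000000006c2099223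b080000000000000000000000000d66c94422100000000000000000000005e08380715808000000000000000000006c8091a0b80000000000000000000000006c6099203908080000000000000000000001e04289457814000000000000000000006310e922abc408000000000000000000000620044915a86d800000000000000000004c8c388f6a03024000000000000000000000c664b2041113400000000000000000002a19b922a886800800000000000000000001c44480c471175400000000000000000006008109b5a86c920000000000000000003316813080c5805c00000000000000000001e00289407806a10000000000000000001342541084d19314000000000000000000008d668a4423156580000000000000000001c44689447117510000000000000000005342501080d4915000000000000000000011c664b204111344800000000000000000780b38660a028008a6000000000000000003c6449084d113540100000000000000006c0499263b0008cafe8000000000000000482d32564a034065a480000000000000006c001c2f3e20048aee80000000000000002c8089a9b0c0049a7a80000000000000006c001d293c20158a6e80000000000000000229044905286da0402000000000000000000f30560203404484000000000000000012328950818de8141121000000000000003a10a922a887801a9aa180000000000000781b38620a068008a78180000000000000123b0050818ce8201123a0000000000000008c64a244231745804cc00000000000006c0099a63b0808ca3e80080000000000003316813080c5a85c1321600000000000001342541080d0931421742400000000000003c6449084f11354005c640000000000002d608b00301808ab3a960180000000000006008409b5a86c8058200840000000000000c460b244231345804ce640000000000006008909b1e00e9a5a2008900000000000123b0250018ee8200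123b020000000000011c644120051134c835c665000000000006a1939720806800aa6a19b92000000000005e08280715808b3581e082800000000001312400482d490500171440000000000003346c13088d5905c03702c13000000000005e00280d15808b1481e00280000000000488d388f6a030243a488c3a8700000000006008109b1a02e9a58200890980000000001c44488c4710755005c44488c0000000000c0068954301721000e046894000000003346411088d1915c0374641308000000000d608b00715808ab1a9608b007000000005350405482d4915005712400480000000000090649442255a1400294649440000000488d3ac64a030267a488d3a864a0000000488438af6e220642e488038af6e000000005608b80715808eb189608b807100000006c001c2b3e20078a6e8001d2b3e200000000290649042275a1402290649042000000400f30560203c0048400f30560a00000001216811081cdea5c11216811081c4000002a18a922a886800ab2a18b922a88600000600f30760a034004a500f30760a0300000123b0240018ee820012390240010e8000000392240400e6021002392240000e400006c6099203b08080a3e86099223b0800000008d66c9442215618042d66c944221000005e08380715808a3581e08a807158080002c8089a1b800029a7a88899a1b0c0000006c609b203908082a3a8609b2031180800005e0468955380c21405e04688553c060002a10e926aac7881a92e10a926aac6080000021044917a86d8040201044905287d8004c8438af7a020643ac88c388f6a020240000c664b244331344804c664b24c33134006e19b9220886800aa2a19b92228868008001c444d0c4f11714005c44490c4f11754006008509b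5a86c90582008409b5a86c8003306c13080d5805c13716c13080c5805c001e0028940780621401e20089417806a1013c25410c4d11314017c6541080d193140008d66c9442315618048d6688442315618,
   0x4000000000000000000000000000000000000000000000000000000000000000000020000000000000000000000000000000006800000000000000000000000000000000200000000000000000000000000000000012000000000000000000000000000000001100000000000000000000000000000000128000000000000000000000000000000051c000000000000000000000000000000001e00000000000000000000000000000006c00000000000000000000000000000000402000000000000000000000000000000000e00000000000000000000000000000006c000000000000000000000000000000004b4000000000000000000000000000000010120000000000000000000000000000004c00000000000000000000000000000000202da000000000000000000000000000002409a00000000000000000000000000000101340000000000000000000000000000051d60000000000000000000000000000004f0998000000000000000000000000000011f20200000000000000000000000000006c009d00000000000000000000000000006e0938400000000000000000000000000000e0068000000000000000000000000000101f605000000000000000000000000000202ba378000000000000000000000000004c003c0c00000000000000000000000000501f605600000000000000000000000000277081200000000000000000000000000011f60290000000000000000000000000002819a962000000000000000000000000006c093862000000000000000000000000004c08380630000000000000000000000000101b445000000000000000000000000000202da37b080000000000000000000000004bc01884820000000000000000000000002370a1208100000000000000000000000012308300c1800000000000000000000000101f64500400000000000000000000000012b28380c18000000000000000000000005bd6109482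d0000000000000000000000001e04689447800000000000000000000006c0038af3a20000000000000000000000050a6121d4628000000000000000000000001e04689447800000000000000000000006c005d2d362000000000000000000000006c00dd2d37240000000000000000000000001244590424e0000000000000000000004bc0180482d06000000000000000000000101f64500007f00000000000000000000011720a10415c8800000000000000000000101244590424f400000000000000000000581f30560a07e0000000000000000000000824120d4029048000000000000000000051d61094c25582400000000000000000002370832081dc08200000000000000000004f091844b2c2601000000000000000000040a0069d462805a00000000000000000002c0989622802600800000000000000000011f60294405582640000000000000000000c00380f3b120482000000000000000000581f38560a07e044800000000000000000242da162390a68c8c000000000000000004b40994483d06a12200000000000000000280929620802600aa00000000000000000202da363190b68acd000000000000000006e091844b2c260122c000000000000000001e04689443917a14000000000000000002409a162390a680ada0000000000000000101204090424e500010000000000000000214081208158081812000000000000000012b28380c18c8a3111200000000000000011720210411c8a2501100000000000000012b28290c18c8a3111280000000000000051d61094c2d58255271c0000000000000001e04689c47837b1405e000000000000006c00102d3e20048a6e80000000000000004024128d462804e164020000000000000000e0468d443917a5400e000000000000006c009d2d3620058a6e80000000000000004b411844a2d060123cb010000000000000101244190424f5000101200000000000004c00180f3a020482ec8000000000000000242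da162190b68c8da02da0000000000002409a9623902680a9a809a000000000000101b44500525f50401413c00000000000011d6029442558255011d600000000000004f091c44b2d060122cb01180000000000011f60290401d8025011f602000000000006c009d2d3620158a7e800dd000000000004e093864b28260122ca09184000000000000a0068d46a817a5400e00680000000000101f60560007f1448141f6010000000000202da37b090b68add202ba3700000000004c10380f32020082ec8003804000000000501f70560a07f0448541f70560000000002370832081dc082812370812000000000011f60290405d8025011f602900000000002809a9622802700aba809a9620000000006c09386208026008ae80938620000000004c08380732020082ec8083807300000000101f44500427f5040141f4050000000000202da323090b68acd202da3730800000004bc0188483d02a1034bc010848200000002370812081d808181236081208100000002330830081cc8839123308300818000000101f44500407f1040141f445004000000012b28380c18c8831112b28280c180000005bd61094c2d58254251d61094c2d00000001e04689447817b1405e046894478000006c00182d3a2004826e808182f3a200000040a2169d462804a5440a2069d46280000001e04689447817a1405e046894478000006c00dd2d3620158a7ec00dd2d1620000006c00dd2d37201d8a76c00dd2d372000000101244590424f4000141244590424e00004b40180483d06a1024bc0180483d060000101f64500407f1440141f64500407f000011720210415c8825011720210411c88000101344580424f5040141344580425f4000501f30560a07e044a501f30560a03e000040241209402804e1640241209402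80580053d61094c0558255051d61094d2d5824002370830081dc882812370832081dc082004f091844b2c060122cb091844b2c06010000a0069d442807a1440a0069d462817a002c09a9222802600a9a009a16228026808011d6029402558264011d602940055825004c00380f3a020082ec800380f3a0010820581f34560a07e0c4a5c1d32560a07e0448242da162390a68cada009a162390a68c8c4b40180483d06a1225b40184483d06a922]

/-- The matching for 6 colours. -/
def partners6 : ℕ :=
  0x2f33130143725e225c71136e6c0a370032252a0119170f225925285d1d590e1b2b212015722653721a0e3c17380328355512191c0e2e0e574071672c28212d4284422c656370356a1e1b80045c7d7c59497a7b440c1f5601724d076f3025352e2f59514c7e6d826a0c05775f08523c535a371357742a5d44194d4f4d354d4c4b1421484716450f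

theorem excess_6 : excess 135 6 planes6 = 0 := by decide +kernel

theorem packedMatching_6 : PackedMatching 135 partners6 := by decide +kernel

theorem crossCount_6 : crossCount 135 xsMany ysMany planes6 = 2 * 183248 := by
  decide +kernel

theorem totalWeight_6 : totalWeight 135 6 xsMany ysMany planes6 partners6 = 629165 := by
  decide +kernel

/-- The bit planes of the colouring with 7 colours. -/
def planes7 : List ℕ :=
  [0x100000000000000000000000000000000078000000000000000000000000000000006c0000000000000000000000000000000068000000000000000000000000000000002c00000000000000000000000000000000120000000000000000000000000000000013d00000000000000000000000000000006bd8000000000000000000000000000000131800000000000000000000000000000013d600000000000000000000000000000004a0000000000000000000000000000000780b00000000000000000000000000000013c640000000000000000000000000000041c440000000000000000000000000000001e44000000000000000000000000000006c0db800000000000000000000000000006c0098000000000000000000000000000004e04600000000000000000000000000006c0db90000000000000000000000000000135740000000000000000000000000000001e4468000000000000000000000000000535b7440000000000000000000000000006c209b200000000000000000000000000011c244980000000000000000000000000003c446d8000000000000000000000000006c209b2200000000000000000000000000501f3076000000000000000000000000006c24b9270000000000000000000000000004a087894000000000000000000000000000a087896000000000000000000000000007e446a9d00000000000000000000000006c0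db9263800000000000000000000000001c24699c40000000000000000000000002ca08f8974000000000000000000000000121f20560a000000000000000000000000780f38760a0000000000000000000000006c24b9263b000000000000000000000000680f39760a0000000000000000000000002c008ba975200000000000000000000000121f00508080000000000000000000000013c66490c4f000000000000000000000006bd934e28ef60000000000000000000000121f405080c700000000000000000000001356405080d580000000000000000000001357005080d5c000000000000000000000780bb9762a02000000000000000000000024a08f89742800000000000000000000006c20bb263b0808000000000000000000006c4db9763a030000000000000000000000680fb9762a0300000000000000000000006ca09ba979280e000000000000000000004bd97de6cef277000000000000000000006c20992b39280c80000000000000000000700f30760a07e24000000000000000000001e4468955781fe000000000000000000053d934628ed6f31000000000000000000000e0c68955381ea00000000000000000006c20b92f3b0808ea00000000000000000003c64698c4f117550000000000000000002ca08ba9710808ab00000000000000000001e44689447917f500000000000000000004e08689742817a340000000000000000006a087897d280fa150000000000000000001c64699c471173500000000000000000001e4468945791fe1400000000000000000131b605482d6f01480000000000000000001e44e8945791fe1400000000000000000780b39760a02c04aa78000000000000000121f20d28887e044810000000000000000780f39760a03604ca780000000000000006c0db9663b0308cefe8000000000000000680db9762a03624eb680000000000000002c00992979280cab7a8000000000000000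121f00508085e05401200000000000000013ce449084d59354017c000000000000006bd93ce28cf6e318a6bd80000000000000535b605682d6f11085718000000000000013d7445480d5b354017d6000000000000004e0478975381fa3481e00000000000000780bb9760a02004ea780b800000000000013c64480c4f11757817c6400000000000001e44688447117f5005e4400000000000001e0468945381fe1405e040000000000006c0db9263b0b084ebe80db8000000000006c009b2b3b080c8afe800b80000000000005e0c68955381fe1585e0c6000000000006c08b9a63b0b08cafe80cb9000000000001357405080d5f21401756400000000000001e44689457917f5405e44680000000000535b745682d6f3108535b74400000000006c209b2e3b0808aabe820bb2000000000011c2449dc4f01755015c2469800000000003e44299c4f11575007e446980000000006c209b22790808ab7e8609a22000000000501f30768a07e044a501f30f60000000006c24b9263b0a08cafe80cb92600000000004e0c78955281fa1580e0c68940000000000b083896d280eab520a0879b60000000007e44689d4f117f5007e44699d000000006c2c99263b0b084ebe80cb92638000000001c24699c4711775005464699c400000002c808b89752804ab4a0208fa9740000000121f20560a87e0448521f20560a0000000780f30760a43e04ca780f30760a00000006c24b9263b0b084abe82cb9263f4000000680fb9760a03604eb680bbb762a00000002c208b297d200cab7a8209ba97c2000000121f00508087e0140121f005080c00000013c6449084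f39355017c64490c4f0000006bd934e28ed6f310a43d934628ef600000131b605490c7e0140161f405080c7000001356405080d5f05401756405080d5800001356005080d5e05401356005080d5c0000680bb9762a03004eb780fb9762a030000004a08f89742807ab5a0e08f897428000006c24bb263b2808eabe820b9263b0a080006c0db9663a0328cebe84db9763a03080006c0db9722a03084ebe80fb9362a03080006ca09ba979280a2b7e8a09bab79280e0006bd97ce2ccf66719a2fd974e2c4f2670006c00992b79280cab7e820992b39280c800780f30760a07e054a700f30760a07e040005e4468955781fe1505e0468955381fe00535934629ed6d310a53d974468ad6f300008e04e89553c1fa150de04e8955381fa006c00bb2f3b0808eafe800b92f3b08088a003c64699c4f117f5007c64698c4f1175502ca08ba9710808ab3a8a09ba971080aab001e44689447917f5405e446c9457917f3404e08689742807ab580e08f89742817ab4,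
   0x60000000000000000000000000000000005000000000000000000000000000000000100000000000000000000000000000000058000000000000000000000000000000004c0000000000000000000000000000000006000000000000000000000000000000000d0000000000000000000000000000000022000000000000000000000000000000006c0000000000000000000000000000000010f00000000000000000000000000000007c000000000000000000000000000000006e0c00000000000000000000000000000010fa000000000000000000000000000000305f0000000000000000000000000000002fe480000000000000000000000000000030bb8000000000000000000000000000005f160000000000000000000000000000005b5650000000000000000000000000000007e08800000000000000000000000000002229640000000000000000000000000000301a640000000000000000000000000000068964000000000000000000000000000001b82280000000000000000000000000001036e300000000000000000000000000006e0db9200000000000000000000000000003e00680000000000000000000000000005e12181000000000000000000000000000303f83b00000000000000000000000000003e00688000000000000000000000000004c825e9d000000000000000000000000000609644b8000000000000000000000000053d654948000000000000000000000000013d6449cc00000000000000000000000003036cb704000000000000000000000000007e08389f00000000000000000000000005e121814b0000000000000000000000000301fe5720c0000000000000000000000005c825e9d760000000000000000000000004c405c493400000000000000000000000007e00289f1c000000000000000000000000d495c49346000000000000000000000002029656a0c2000000000000000000000006e09b9663b00000000000000000000000010fb83d0410c00000000000000000000006c00f9223b0000000000000000000000006e19b9663b86000000000000000000000001f92282495a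000000000000000000000001e922c2c8da40000000000000000000002fe48b80f1d90000000000000000000000301fe5720c27900000000000000000000007e00289d1f808000000000000000000000e896cc9b4a274000000000000000000000fe08b81f1d80a0000000000000000000003c04689c4f037000000000000000000007c029930390489000000000000000000002209666b0ca275800000000000000000004c805c8d762075800000000000000000003036e132090f99600000000000000000006c04f9223b03080800000000000000000053d6549486d592540000000000000000000209646b9ca2759000000000000000000030bf83f0410de82d00000000000000000003c20689c4f017310000000000000000001b56481482d59456000000000000000000301fe4720c27914c80000000000000000051d65494c6f597540000000000000000005f161814b2c580160800000000000000003036e332090d996c9000000000000000006e0fb9263b82884abe00000000000000005356501482d593542500000000000000002fe49ba0f9d90a3f3a80000000000000005ea25e9d762497a36dc0000000000000004d415c493470758268c000000000000000068964c9b4a27792c860000000000000000d494c493472758248d0000000000000002229666b0c2275088260000000000000006c19b9663b02880abea00000000000000010f3a3d2410eea21910f000000000000007c02d9323900180ebfc0000000000000006e0db926bb82084abea0c000000000000011f8a282491eea21911f80000000000000301f65320d0f994c8341e00000000000002fe48ba0f1d90abb7abe4800000000000030bb83e0410de82d130bf80000000000001b16481482d5805625f16000000000000053565c1482d59354257d6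500000000000007e08389f1d80ab3583e088000000000002229646b8ca275a0c06296400000000000303ee532090f994c9341ee400000000000060964cbb4a27790c8609640000000000001f82282495e6a21801f922800000000001036e312090d986c93436e3000000000006e0cb926bb82084abec0cb02000000000007e00689d5f806b1403e006800000000005e121814b28480162da121810000000000303f8370410de86d1303783f000000000003e00689c4f007b1403e007880000000004c805c9df62077876cc805c9d0000000000609644bf4a27790c8609644b80000000053d6549486d59354057d6549480000000013c6449dc6f59755017d4448cc0000000030378370410de86d13437837240000000007e08289f1d80ab3583e08689f000000005e121814b2c580160da961814a00000000303fe57a0c27d54c83c1fe57a0c00000005c825e9d76a037a36d4825e9d7600000004cc05c89367075826ccc05cc936000000007e08289f1d80ab1583e00289f580000000d494c493470759268d495c493460000002009656b0c2a750882609e56b0d20000006e09b9663b06884abea09b9663b000000030bba3d0010cea2d930f3a3d0410c000006c04f9223b01884ebec04f9223b02000006e1db9663b82084abfa19b9263b020000001f92282495e2a21801f922c2495a0000001e922c2c85a4231801e922c2c95a400002fe48b80f1d80abb5abe08b80f1d800000301fe5720c27914c9341fe5720c279000007e00289f1f80eb1483e00289d1d80800006892cc9b4a25792486896cc9b4a2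7400007e08b85f1d80abb58be08b81f1d80a00003c04689c6f21791003e04688d4f0170007c02d9323900980e3bc02d9323105980002229666b0ca27508c2609666b0c22750004c804c89762077906cc805c8d7620778003036e532090f994c9343ee132090f996006c06f922ab00085abec0eb926bb830848053d6541486d1b354257d6541482d5935400229646b8ca27581c0629666bdca275a0030bf83f0410de82d1303f83f0410fe82d003c00689c4f017b1403c04689c4f0171105b56581482d5905625f56501482d590540301fe4720c27914c9341fe5720c2791cc8,
   0x200000000000000000000000000000000040000000000000000000000000000000003000000000000000000000000000000000240000000000000000000000000000000032000000000000000000000000000000001200000000000000000000000000000000310000000000000000000000000000000048c00000000000000000000000000000004f000000000000000000000000000000004a2000000000000000000000000000000010e000000000000000000000000000000025c40000000000000000000000000000004a080000000000000000000000000000006dc4000000000000000000000000000000134b8000000000000000000000000000004a3000000000000000000000000000000004298000000000000000000000000000006839900000000000000000000000000000033d60000000000000000000000000000048cd3400000000000000000000000000002fc618000000000000000000000000000010a683000000000000000000000000000058cb5a8000000000000000000000000000370281000000000000000000000000000025c4c7e0000000000000000000000000007a9050a0000000000000000000000000004ca90ec8000000000000000000000000005232b008000000000000000000000000007a9250aa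000000000000000000000000003410e52a00000000000000000000000000502f16dc00000000000000000000000000761291640000000000000000000000000036128134a0000000000000000000000000170ba11b90000000000000000000000000023d2616c00000000000000000000000004ca92ac9740000000000000000000000004dc47aa26a0000000000000000000000002718652bbc0000000000000000000000003252c5321980000000000000000000000042947686ce8000000000000000000000003172c1300940000000000000000000000049c07e826a5000000000000000000000000d50282bb0f000000000000000000000004a303e468eac000000000000000000000011c687904430000000000000000000000035c068abb85000000000000000000000005c8b78ed720680000000000000000000006c9838ad72268000000000000000000000132b045985fa00000000000000000000004dc478a27a501000000000000000000000429074a6ce84b00000000000000000000012b68119018dec00000000000000000000032f665885eb1c000000000000000000007a1219708885c00000000000000000000030a6869455258e0000000000000000000048ed3cc4470b11400000000000000000003212c5328ca491800000000000000000003f428911b0d1229000000000000000000021c68790545113a800000000000000000074399164130ce98800000000000000000040af16d4472b4c640000000000000000005230340a8daeac300000000000000000003e1fcd74a485f35e0000000000000000000839ab4d030e68a38000000000000000006dc458a2f851025e600000000000000000761291743b84e8085000000000000000000c292a4f732a6c239800000000000000003f428919b0d0229e58000000000000000025c440ebf85152db4a00000000000000006039bb45030ee8a87600000000000000001343845991f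0cf905100000000000000002599646bbce2179aca40000000000000003372e130095d990c1360000000000000001226831d012dee641120000000000000003166c310015d882c13580000000000000048cd3c86461b1361a49c000000000000000f40280bb4f66692e890000000000000004b391e444e80712124a30000000000000010e6879044310b65511e0000000000000025c441e0785113d54a5c400000000000004a0b5ed0620251a364e0a00000000000006dc418b0b8d102de6adc60000000000000136b045981f81d145132b00000000000004a3036128daeec32a423000000000000000839ab4e430a4ca394839a00000000000060399964030ee888760399000000000000023d6604c4e31575c063d6000000000000488d36d4472b0945240cf14000000000002fc60910b8d1029e6bbc618000000000005027825d07296c651522782000000000005c8b7ad4720290836de8b5a8000000000037428939b0d0ec9259302890000000000025c4c7a0585113fd521c4cfa0000000000729050a7ca84f301a469070a00000000004ca90ac9742a64636c8a91ec80000000005302b40b89ee8e109d21ab0080000000007a9258ab0884f60827e9259ea0000000003212e5221ca49598d3612e522000000000502f925d07296c6115027065d00000000076139164330ce88a5f211916400000000037128134bac4e05e1b6508126a00000000170ab13b99ee8c909130aa009900000000021c4686c6a71575c423c6286c000000000c292ac9712a6c63088293ac964000000049c07ea26a521363ac9c07a826a00000002610e52b9c669598ca618e52a9c00000003652c5329994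998c13652c53219800000042946686c6a71571c461c6686cac0000003176c130015d9a3c13576c13001400000049e03e8642121363a49e87e866210000000dd0282bb8f066d2c89d0282bb8f00000048301646cfae612024a3816460fac0000011c68790445113ad531e6879054700000035c440aba85066daca5c068ebf8d0000005c8b78cd7202d2836de8b5a857206800007c9938ad7206a682ee89938ad720680000032b065985fb0c344132f045985eb000006dc458a278511253acdc478a27a5110000429474a6ce84b151846907686cea6100001266811d018dee6c512f68119010dec000033d625885eb15754072f621885eb140007a1219708ac6e49827e12197288c4e100010e6879455208f61510e287905d2c8f00048cd3c84461b1365a48ed3c84471b134003212c5328d849d8ed3612c5328ca4998003f428910b0d1029e69bc68931b0d10290025c48790445213e9521c4c7b0505113480783999641308c88876a319964130ce8880408f16d4472b4d642404f1454072b4d4405230300b8daeac10b5230340a8dec8c3003a17cd74a485f31e23e17dd60a485f11e04839ab4d030e68aad4839a30d030a68ab46dc458a278511257aedc458a2f8510256a]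

/-- The matching for 7 colours. -/
def partners7 : ℕ :=
  0x4925354549023c185c39135964842a2c546921496b1777181131790d611f3b237e6d2031541d7767080e1839380328062a1110600e720c576509088506652d59025653654969350110815c5e4f715778826c7b77191f1221624d075c340379686175041b6f654375720560815e543a7d383728582a455d441e3b4f463639234b1386094216435b

theorem excess_7 : excess 135 7 planes7 = 0 := by decide +kernel

theorem packedMatching_7 : PackedMatching 135 partners7 := by decide +kernel

theorem crossCount_7 : crossCount 135 xsMany ysMany planes7 = 2 * 133405 := by
  decide +kernel

theorem totalWeight_7 : totalWeight 135 7 xsMany ysMany planes7 partners7 = 542181 := by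
  decide +kernel

/-- The bit planes of the colouring with 8 colours. -/
def planes8 : List ℕ :=
  [0x400000000000000000000000000000000020000000000000000000000000000000006000000000000000000000000000000000780000000000000000000000000000000024000000000000000000000000000000001200000000000000000000000000000000110000000000000000000000000000000013800000000000000000000000000000005bc00000000000000000000000000000000fe00000000000000000000000000000006c0000000000000000000000000000000050a000000000000000000000000000000025e40000000000000000000000000000006c080000000000000000000000000000006b4f00000000000000000000000000000011520000000000000000000000000000006c300000000000000000000000000000002429a000000000000000000000000000006c19b00000000000000000000000000000123b40000000000000000000000000000051df3400000000000000000000000000007f0b98000000000000000000000000000011f70200000000000000000000000000006c88dd80000000000000000000000000007e0bb8400000000000000000000000000025e4878000000000000000000000000000529f70d0000000000000000000000000002c2da378000000000000000000000000004c30380c00000000000000000000000000529f70de000000000000000000000000002370c7200000000000000000000000000011ff06d4000000000000000000000000007a1bb966000000000000000000000000007e1b3976a00000000000000000000000005e0bb82730000000000000000000000000121f66d0c00000000000000000000000002c2dab6b780000000000000000000000006bc458268a0000000000000000000000002770c7299500000000000000000000000013f2c790c1800000000000000000000000129f64d0c480000000000000000000000033f2c390c1c000000000000000000000005bd678b68a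d0000000000000000000000005e06eabfc7800000000000000000000006c303f6f7e20000000000000000000000010a6879d4738000000000000000000000025c046abbc7800000000000000000000006c88fdad362a80000000000000000000006cb0fdad372e80000000000000000000001332065985fce0000000000000000000006b4458668bd17000000000000000000000129f64d6c687f00000000000000000000013f00219415cec00000000000000000000133b465984ecf4000000000000000000005a1f74568a87e1000000000000000000001026129d512c8c80000000000000000000539f3494c6d793400000000000000000003370c700c5dc9ba00000000000000000005e0bb954b2c2e01000000000000000000000e6879d46290fa00000000000000000007c19b9663a06e80800000000000000000011df06d4c67783740000000000000000006c303a2f3b2ee4a20000000000000000005a1f7c768e87f3548000000000000000006c39b9663b0a68aac000000000000000006b4d1974abd1685e2000000000000000007e1bb9663a86e00ab000000000000000002c2dab6b390b68abf800000000000000007e0bb974b282e81a3c000000000000000025e447a97c7117f94a00000000000000006c39a9663b0e698afe00000000000000001750040995f4ed9041000000000000000025e0c529b5f81f9a5a400000000000000012f2c390c1dc9b31106000000000000000117602d9417dee2501300000000000000013b24290d1cd88251178000000000000005bd63496c2d7b355a538000000000000000de06eabf4f837b3e8de000000000000006c019f6f7e2064ab6e820000000000000050a686bd47290ce5550a0000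000000000025e4878d547917ad5a1e400000000000006c889ded7e22558b7e80800000000000006f1f9954aad1601e3eb0f00000000000001372444985fcedb44137300000000000006c303a2f3a2e64aaee83000000000000006c29bb673f0ae8eade829a0000000000006c19b9623b06e80afe819b000000000000121f4250c4a7f5354163f400000000000051df36d4c6f78355051df24000000000005f0b9954b2c2601e3db0b980000000000011ff02dc447dc665011f706000000000006c88fdad77221f8b7ec89dd800000000007e0bb864b386e812bfa0bb84000000000000e4879d543917ed521e48780000000000129f64df0287f3448569f60d0000000000682dab7b790b6ceffe82dbb780000000005838380f3b0e8882fc838380c000000000539f70df0a07f6c4a569f705e0000000003370c72045fc99b952770c72000000000011ff06d4047dc675011ff06dc0000000007c19b9663a06e00ebfa19b9660000000007a1b78769ac6e04ea7e5b39768000000005c29b80f3b0e8882fd8183c07300000000129f67d0c4a6f5754141f66d0c00000000242dab6b790b6cabfa82dab6b3800000004bc458a68ad07b50b4fc478668a00000002770c728957c1db852770c72895000000013f2c780d1dc9bb9137f2c780d18000000129f66d0c4a7f555c16df66d0c0800000013f2c290c1dc9a35117a2c290c1c0000005bd67c96cad5f354a5bd67096cad00000025e24eabfc7837f3ca5e0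6eabfcf8000006c301a673e2264ab6e8201f6f3e680000010e6879d46290ea5510e6879d46280000025e446abfc7857f34b5e047abfc78000006c88fdad772a1f8a7ec89fdad7722000006ca8fdad372e9f8afec98fda5372e800001333465985fcf5b041733465985fce00006b4458668bd16a5e26f455866abd160000129f64d4c4a7f1458169f64d5c4a7f000013f202d9417dee25013f202d9415dec000133b4658c4ecd5b54163b465884edf4000521f70568ac7f154a561f70568ac7f100050a6929d45288ce155026029d57288c80053de3496c6d79355a53de7494c2d7934003332c700c5dc9ba913730c780c5dc9ba005f0bb954b2ca601e3da0b9954b2c2e010000e4879d463907ad500e6879d54391fe806c19b9662b06e80afe819b9663b06e808051df26d486778374051df069486f7835404c30380f3b0eaca2ec830380f3b0e1ca205a1f7c568e87f154a5e1f74568e87f1d486c39a9663b0a688afe839a9663b0a68aac6b455976abd16a5e26f451876abd1685e2,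
   0x6000000000000000000000000000000000700000000000000000000000000000000010000000000000000000000000000000006c000000000000000000000000000000000e000000000000000000000000000000001600000000000000000000000000000000050000000000000000000000000000000020800000000000000000000000000000006d0000000000000000000000000000000058f00000000000000000000000000000003c200000000000000000000000000000006c8400000000000000000000000000000048f800000000000000000000000000000079560000000000000000000000000000000de080000000000000000000000000000050bb8000000000000000000000000000005a1fa000000000000000000000000000007b5750000000000000000000000000000007e4c00000000000000000000000000000222f6400000000000000000000000000007936780000000000000000000000000000162b66000000000000000000000000000049f83a800000000000000000000000000016368b00000000000000000000000000006c04fba00000000000000000000000000003f04680000000000000000000000000005e37184000000000000000000000000000303bb3f00000000000000000000000000013d04688000000000000000000000000006c805da900000000000000000000000000122b665b80000000000000000000000000735654348000000000000000000000000017d644b4a0000000000000000000000000323fa3724000000000000000000000000007f04689f00000000000000000000000005e3b1854b000000000000000000000000070dff5720e0000000000000000000000006d805cadf60000000000000000000000000f40cd493480000000000000000000000007f04689d5c000000000000000000000002d59cd493560000000000000000000000060ede5e60e2000000000000000000000006fc9b96f3bd0000000000000000000000050fbb2c2490c00000000000000000000007c26db30391000000000000000000000006ce9b9ef7b9200000000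000000000000004de93ac76b5200000000000000000000006dc93aeffad2000000000000000000000007e48f89f1f90000000000000000000000715ff5320e37900000000000000000000003f04689d4fc300000000000000000000016d964c9b5aefc0000000000000000000007e48789f5f91e0000000000000000000013d24499c4f4f7000000000000000000003c26c914310d8800000000000000000000208d66fb4c2375000000000000000000006e80dd89b4a075800000000000000000003a36c93289cd88700000000000000000006c26db327901186800000000000000000077565434f2d5f35c000000000000000000160b667b0ca275a400000000000000000050bbb3d2410ee82900000000000000000013d644d9c6f5f7150000000000000000005b1fa95482c7e05c0000000000000000007956f4320c57914ca0000000000000000017d65434b6d5f3560000000000000000005e1b9854a38ee8163800000000000000001a36cb12898d8876b000000000000000006c84b9a67b0b0acbfe0000000000000000731f597482d5e05c2700000000000000002fe28f99f1d90eff5a80000000000000006f905ead767417b36ec0000000000000000f51cd4935707d8258e00000000000000016ab6449b5aeff90c9600000000000000015694449357efd92585000000000000000208d66ef4c23554d8248000000000000006f49b96f3b720e8afebc0000000000000058f132c24b0eea21b50f000000000000003c26db303901196e7bc2000000000000006c04fba27b0108effec04000000000000049f83ac64b1eea21e49f8000000000000079167432095f995ca6d16000000000000007e48799f1f90fbb5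8be4800000000000050bbb3d2490ee821910bb80000000000005a1fa95482c7e81eb5a1fa0000000000007376507492d5f15c07755500000000000007f0c689f1f91fb1587e04000000000000222b667b5c237525c162f64000000000003936f932894d995cb3d36f800000000000122b66db94aaf5b0c162b660000000000049f83a864a5e62a3e69f93a800000000001e368b12a98da87e19a368b000000000006c04db327b0108effec24fba000000000003f04689c4f4b7b1407f046800000000005f3b1844b38ce8066da331840000000000303ba372490fe82d9303ba3f000000000013d04689c4f4f731417d046880000000006e805d29b6a0779a6ec80dda9000000000122b665bc4aaf5a0c162b665b80000000075565434b6d5f3560f756543480000000013d64cb496f5b756017d64c9cc00000000303ba352490fe82d1303fa77240000000003f00689f7f91fb1481e00689d000000005e3b1854b38ee8123da1b1854a0000000070fff5f20e37974c874dfe5360e00000006c805cadf6e0b79b6ec805dadf600000000e50dd09b4b0758a7af50dd49b4800000007f00689d5f81fb1483b00689d5c0000000559cc49357cfd8258d59cc4935600000020cd65e64e2b1748864cde5ee4f20000006ec9b9ef3b920ecafebc9b92f3b100000050bbb3c2490eea21b50ebb2c24b0c000007c26db323901196f7fc26db323900000006ccdb9af7b020ac2ee8c9b9a77b120000049e83a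866a5262a3e49e93a876a5a000004dc93aeffa5202b3ec9e93ac7fa524000007e48789f1f90eb7583e48f89f5f900000715ff5320e57934cb755ef5320e379000007f04689d5fc17b1407f04689d5f81000016bb6449b5aeff90496b96449b5aefc00007e48389f5f90eb3583e4c289f5f80e00013d2448cc4f4f790417d24488c4f4f70003c2289343109a86e7bc229934310988000208d66ff4c23757d8248d66fb4c23754006ed0dd89b4a0759a7eec0dd09b4a0758003936d93289c59854b3c36f83289cd887006c04db327901186bfec26db327b010868067565074a2d5f15c2f756507492d5f15c0126b667b4ca37525c162b667b4c237524030bbb3f2490ee82d9303ba3f2490ee82d013d244d9c4f5f715017d244d9c4f5f71407b1f995482c7e05c37f1f915482c5e05e0705ef4320e57934cb755ef5320e57914ca,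
   0x3000000000000000000000000000000000200000000000000000000000000000000078000000000000000000000000000000003600000000000000000000000000000000520000000000000000000000000000000030000000000000000000000000000000004dc000000000000000000000000000000073000000000000000000000000000000004e2000000000000000000000000000000005e80000000000000000000000000000000bc00000000000000000000000000000004e240000000000000000000000000000005fd000000000000000000000000000000004bd0000000000000000000000000000004a09c000000000000000000000000000001ab9a00000000000000000000000000000322ba0000000000000000000000000000051d46000000000000000000000000000004be65800000000000000000000000000004fd038000000000000000000000000000052a6d700000000000000000000000000006c253a000000000000000000000000000027710940000000000000000000000000001bc24a8000000000000000000000000000391b4c700000000000000000000000000040fd3ec0000000000000000000000000006a09bd6400000000000000000000000000391f4d74000000000000000000000000003e92a9bb000000000000000000000000005aa6da9480000000000000000000000000252da17080000000000000000000000000254dc160200000000000000000000000006119354e8000000000000000000000000050d2542f0800000000000000000000000040f936c64c0000000000000000000000005ddb3ad0f20000000000000000000000003b9aa9b2e90000000000000000000000003636813b3d8000000000000000000000007952547f0e4000000000000000000000001436873d1d2000000000000000000000004ded1ac4f250000000000000000000000079d09509877000000000000000000000004e09fc07ab88000000000000000000000015e742d9705000000000000000000000005bd09d89c5740000000000000000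0000006c241f3f7f2100000000000000000000007c06df3f7e21000000000000000000000000dd648d542720000000000000000000005ddb3a90f2d68000000000000000000000791b5c790c74f00000000000000000000030f6c79487bd980000000000000000000000d4648f5637b600000000000000000000355fe9742657f00000000000000000000004ed06c4641b738000000000000000000049e45ad46359624000000000000000000036b281bbb9ad8c000000000000000000002f50086bb8d4669000000000000000000015e24ad9f1d076f0000000000000000000262ba371b18b68fc0000000000000000005ea65a94438978640000000000000000004a09bd468e821918000000000000000000355fe1543277fc4e80000000000000000012abb3cb49aeec2b8000000000000000005fd23882f0d6a293e00000000000000000252d8170b15b68de50000000000000000040b9b6c64f2eee21d000000000000000002f50086bb8f4669ae800000000000000000bd08899c5f5ae97f00000000000000000322bb37bc18aec2993000000000000000000bb66d9442b37a5400000000000000000790bbbf2cad28039b78000000000000000373687393d2d8eec5a200000000000000052a6d714c78d997d15400000000000000030668714073d99fd13080000000000000049ed5ac4625942672cdc000000000000007150d5098ff49f98571c000000000000004e2c780f3b8a19c2fce00000000000000005ed42e9705073e3485e000000000000000b424a99e1f12eb740fc000000000000006e257a2f3b290ce2ece2400000000000005fc038a3b0d6e292ecbd00000000000000049d6e9d5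42337c5c049c00000000000004a09fd468f8a1992f4a09c00000000000012b9b3ca4dae6c29b1239a000000000000322ba37f918a68bd9322ba00000000000051d0708f0e75f7c0855d060000000000004ae65a9453197a6725fe658000000000002fd038abb8d4e292eabd038000000000005aa6d7948389b975356a6d2000000000006c251a6f3a2904eeeea243a000000000002f51096bb8f0649a4ab5109400000000001fc24a89e1f16eb749fe24a80000000000795b5c788c74f51c23d135c7000000000004f936c64f2a7ba1c02f926c00000000006f09b5668ee26518a6a09b564000000000391fcd7484f7f15e03d1fcd700000000003692a9bb398d9e1e9b292a9bb0000000005aa6d294c389b96535ea6d294800000000242fa370b1cb68fe5a02f8171800000000254d8d603119791a5a105c960200000000631935468ee26418a6309b56e9000000005552552f0e74f780a57d2546f08000000048b936c64f2e6b21d42f936c64c00000005dfb3ad0f25782372d9fb1a94f200000003a92a9b3e9460a1f9ba9aa9b3e900000003636813badad8c0e5b236813bad80000007152547f0e74f70025512546f0a40000003436873d1d2d8fed53066873c1520000004ded1ac4725b02732cded1ac4e3500000059d0958985748f98759d0950987f0000004a09fd0fab8a1982f4e09f8072bc00000015e242d9f15073f3495e34ad9f150000005bd09d89c5f4ae9870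bd09c89c5f4000006c251b6f3e2104efeea241b7f3e29000006c069f3f7e2145ef6f8269f377e210000000dc648f56273745804dc648d5427000005fdb3890f2d68213ed9da3a90f2d6800007953547b0e74f71067d13547a0e74f00005076c714878d997c17476c71487bd9800000d4648f06379740845d4648f5e36b6000395fed742417e0ce13d5fcd742017e000005e946c4701b73e7481e946c560197380049e55ad4625962772cde51ad463596240036f281bbb9ad8c0edb2f6813bb9ad8c0002fd0182bb8d4e292eabd0396bb8d46290017c24a99f1d07ed349de24ad9e1d066b00262ba379b18b68bc9b22ba371918b68bc05aa65a944399786525ee65a5443197a6606a09bd668ea25118b6a09bd668ee261180355fe1743277f04e9b51fe9743277ec4e0322bb3db41aeec299322bb3cb49aeec2985fda3080f2d68293edbda3880f2d68213e]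

/-- The matching for 8 colours. -/
def partners8 : ℕ :=
  0x2f07134543025e6f5c095a592036342c102521832717775c2a49280d1d153b237e4321750e0577671a50801c1369285a55110c600e2e0c0b6539088558052d590265536d052535861e815c5e4871167b14367b7710695621504d1f5c340735681d59221b7e4364590c05608108545c605775287c34120e441e2e0e02494d231f4a2148595a210f

theorem excess_8 : excess 135 8 planes8 = 0 := by decide +kernel

theorem packedMatching_8 : PackedMatching 135 partners8 := by decide +kernel

theorem crossCount_8 : crossCount 135 xsMany ysMany planes8 = 2 * 99638 := by
  decide +kernel

theorem totalWeight_8 : totalWeight 135 8 xsMany ysMany planes8 partners8 = 474188 := by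
  decide +kernel

/-- The bit planes of the colouring with 9 colours. -/
def planes9 : List ℕ :=
  [0x40000000000000000000000000000000007000000000000000000000000000000000340000000000000000000000000000000058000000000000000000000000000000002c0000000000000000000000000000000058000000000000000000000000000000006c800000000000000000000000000000001c0000000000000000000000000000000059d00000000000000000000000000000007b1800000000000000000000000000000013fc00000000000000000000000000000059d600000000000000000000000000000001640000000000000000000000000000006b4080000000000000000000000000000051c640000000000000000000000000000005ed60000000000000000000000000000048d0c000000000000000000000000000006e30d800000000000000000000000000006404a0000000000000000000000000000005244a00000000000000000000000000002c2d2800000000000000000000000000005bd218800000000000000000000000000012e646800000000000000000000000000002dd20e0000000000000000000000000001490c380000000000000000000000000000d4342500000000000000000000000000011e672900000000000000000000000000014b0c38000000000000000000000000000221d4474000000000000000000000000002c2dab2f000000000000000000000000006490978d4000000000000000000000000036b206ad4000000000000000000000000010ef66b2400000000000000000000000002e308f20b800000000000000000000000045494254b000000000000000000000000028e08d290c0000000000000000000000003007447494000000000000000000000000594df144020000000000000000000000002e308f0075800000000000000000000000590bf956034000000000000000000000006ac09dab1d200000000000000000000000150f20d93060000000000000000000000051d63292c8540000000000000000000000629f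31f2ca860000000000000000000000071d205b305700000000000000000000005bdb1814a2d480000000000000000000005f5b1a7db2d240000000000000000000006b009d2b8be0000000000000000000000028608d290c3810000000000000000000000630cf00750c98000000000000000000007c0b387b3b0aec000000000000000000006a00d92aada81c0000000000000000000016b20699d1acef000000000000000000007b1ee326cad680000000000000000000006400b1ae7e200cc0000000000000000000621d7544020771c000000000000000000004a4c680f5e91d70000000000000000000629930f2ca87820800000000000000000048d097885624f708000000000000000000242dab2f3a2304ee00000000000000000051e672924853926500000000000000000012b606ddc78deaa500000000000000000001fd6cc4075b7b430000000000000000002964ce09047815eb0000000000000000007090178d6624e7290000000000000000000d6d5a40b053737628000000000000000026a4c690f5a91d75180000000000000000175f206718d2e2c0c0000000000000000041d1ccc445387b423000000000000000006b40bd2f8ad20558b680000000000000003606443994a1f7d4494000000000000000590bf9460252f840b5c0000000000000006c2b387b390b688eef8000000000000000582b78760b4a6a02b5c000000000000000648095ab5f200c89fe0800000000000000140f2859b063c4d648800000000000000059d61090ca55a255251d000000000000007a9bb1b2ca87801de7218000000000000032dd20e61a97e2c0c13dc000000000000059d208d4c2d5e214259d6000000000000001244f0965791d6b0a5240000000000000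6b40bd2f8af00d1ab6b00800000000000051c6729248579265815e6400000000000049ed6cc0215b737280ded600000000000048d0ddc045347f01344d0d0000000000002e30d920b9a81d3a7ae20d8000000000002404a32f7a2204cbde04ca0000000000000524c78975691d7718520ce000000000002c2d2beb380b04aeea82d29000000000005bd3189482d4e216659d3188000000000006a64690d5a93b75046e6468000000000022dd20f68a87c28cc62dd20e000000000006b0c380710cbbab18630cb800000000000d4b4250b251707568d43425000000000010e66692401b1365815ee669000000000014b2c281710cf8a1594b0c280000000000621d4560068771cc0661d45640000000000c2d2b6b380b04eeca82dab3b000000000441097895624f7291e0d0978c40000000032b202bd47aca66b036b202bd40000000010ef6690451b1361814ee66904000000002e308f20bda81d2a7aa308b20b00000000056d4a50b05373762c56d4a50b0000000028c09da90d280788628e0952b1c0000000221f4474868171cc436074474140000000505de1440216f148b6e5df1441200000002e308f2035a81d2b1aa308f20318000000594bf8560b42680095c4bf8460b40000006c8095ab5d200f88768c095ab5c2000000050f20593047c6d6c830f205930400000051d6529248558275255de1292ca5400000629d31f2ca87801dc629b31f6ca8600000174f205b305742c4c931f205b1057000005bd3189482d4c296659d31854a2d4800005f5b185db2d422926dbd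b1855a0d0400006b00992babe00c1ab6a009d2bafe0000002960cf290c3817ea72d60cd290438100002630cf00759c19ab1aa30cf00752c180007c2b387b390a6a86efa0b387b3b0be80006e20d922ada80c9a7e800d92aada80c00016b28619d1acef31592b28289c1acff0007b1ab332c8c68039f7f1ab3a2d8c6800006480b58f7f200c89fe000b5af5e200c800601df5440227f1d82661df544020671c0005a4c788f1691d7718424c788f5e91d700629d20e3da86c28cc60dd20e6c287c208048d0d5c056647f01348d0d7c8d6347f080240ca30f3a2304eada00cab2b3e2304ca051e6729248539365815e6629240199365012b22699d58def25012b206d9d58de9a5049fd4cc4075a7b4204ded4cc447787b4202960ce09047817ea12d60cf2924381deb6,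
   0x60000000000000000000000000000000006000000000000000000000000000000000700000000000000000000000000000000064000000000000000000000000000000001200000000000000000000000000000000110000000000000000000000000000000014800000000000000000000000000000004a800000000000000000000000000000000d400000000000000000000000000000006890000000000000000000000000000000102000000000000000000000000000000069c40000000000000000000000000000006898000000000000000000000000000000494f00000000000000000000000000000017608000000000000000000000000000007410800000000000000000000000000000162ba000000000000000000000000000006914800000000000000000000000000000023b40000000000000000000000000000043062400000000000000000000000000005d0f7c0000000000000000000000000000116f04000000000000000000000000000048b8bd8000000000000000000000000000162b28000000000000000000000000000048c49fa00000000000000000000000000051f46080000000000000000000000000001e75024800000000000000000000000000343233380000000000000000000000000051d0708e000000000000000000000000006bb05ea000000000000000000000000000132f261d800000000000000000000000006554f1260000000000000000000000000036526026000000000000000000000000001c2b28123000000000000000000000000002fd06d0c0000000000000000000000000562f024d300000000000000000000000006acd5c608e00000000000000000000000069205620d700000000000000000000000013d0cb89e080000000000000000000000002fd2684448000000000000000000000001792c1997160000000000000000000000068c15ce68e80000000000000000000000025c9602f3a7000000000000000000000006411b3eb5c24000000000000000000000028a68f906520000000000000000000000065c4708f7a52000000000000000000000048a9fd04230a0000000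0000000000000004c29f86f330e000000000000000000000017228659b1e8e0000000000000000000006a4d5c600a93700000000000000000000003dd668d46579000000000000000000000110200d9416cec0000000000000000000016224658d5a85c000000000000000000005a5254128a84f30000000000000000000010269b0d612c8c0000000000000000000043063497c6e175400000000000000000002ab04f80c08413a00000000000000000001c0fa872b1c3881000000000000000000028a08fb04d210a280000000000000000006d14d1223a55e05c000000000000000000132f261d86f387740000000000000000007436b32b3806e4ab0000000000000000005bd65c568e95f704000000000000000000023bb954838a689e400000000000000000694f78500053714a200000000000000000755471262a14f00a8000000000000000001e2b9a59318ae8b27800000000000000003e4fa872b18f8816b8000000000000000065c4f7a34a5013c9e60000000000000000601589748949681e7200000000000000001744c509b1dded925800000000000000006520462d97f81fb15c40000000000000001792c38960f49e02596000000000000000112b00d9457dec1441100000000000000014e2409d356c8c80594000000000000000428454a6cea17155a428000000000000000549680fba7224d2c8d400000000000000689191e85f24ec0936010000000000000030a28b9065210c2f53c20000000000000068c497a25c1113e9769c400000000000006898bd84472a6908368980000000000000590f79502053504eafd0f000000000000017628609b1fcedb05932080000000000007410b32b7806e4a99b03080000000000005a2bb950a18a68aef1a2ba000000000000691499629945685c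76114900000000000002bf42d0c1a95d354066f400000000000013062616c6f337558530e24000000000005d0ff97230438056b9d0bb80000000000011ef06d9847b8634011af040000000000048a8bd84070a7b0a748a9fd800000000001e2b2812b98fa8168fa1a280000000000068c49fb04c010bad728e49fa000000000003dc628d4256b341c47dc62800000000001e3d024d338cec2169a71024800000000034322a13380e80aacb03b283000000000051d2708f4a74f410855d0708e0000000002ab05fa4448c13b922eb05fa000000000031af265984fb8774011af061980000000065d4d1223a55e04a9e514f126000000000325a6c360a86b1ca8365a6c360000000003c3b2812390e80a2c983a283330000000002fd06d0c4ab15f5402fd02d0c00000000562b8a49318eeca23d22b0a493000000006acd5ce08e81734826ec554668e00000006b305e2045c819b966e2056a0d700000001ad0cb89e094933b12ef0cb89f0800000002fd06c044b31565002fd069044800000015d2c09d7566cc03796d2c0897560000006a8454e6ce81735024ac554e6cea00000025cc60af3a5216dace5c860af7a50000007410136b5824e4293e01993eb5a240000028a48fb04521082e728a28fb064200000065c471af7a5213c9ce5c461af5a520000048a9fd84070a5b82f48a9fd44230a000004c29fa4f330a9ba2fcca9fa45210e400001722865991e8ccb159222065985e8e00006b4d5c700a93734e26f4d597402137000002dd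668546871365403fd668544371000011a300d9417cee154130300d9c16dec00012234650d5a84cb54122342d8d5a96c000525274128a84f110a565270069a84f100010228b1c67248c2b510228b8c772c8c000428474b6cee17155a42067496cee1754002ab0cf81c08493ab02eb0cf81e08413a001d0fb972b0438856b980fb852b0c3c850028849fa15c200bad72ae49fa04c210b2806d1499621a55685c7ed1499621a45685c0130e263c8ef337748130e261c86e3975407432332b3806e0aacb032a32b308ca0ab05a524c128c95f384a5fd254528e95f50486a3b89548b8b689e5682b89548389689e46b4d78500253734e26f4fd9702213714e2,
   0x400000000000000000000000000000000000000000000000000000000000000000002000000000000000000000000000000000280000000000000000000000000000000030000000000000000000000000000000005a0000000000000000000000000000000014000000000000000000000000000000001a800000000000000000000000000000007bc000000000000000000000000000000001e00000000000000000000000000000007c40000000000000000000000000000000682000000000000000000000000000000003c80000000000000000000000000000007d420000000000000000000000000000004b4000000000000000000000000000000038100000000000000000000000000000006c82000000000000000000000000000000612da000000000000000000000000000002449e00000000000000000000000000000141bc0000000000000000000000000000071d60000000000000000000000000000004f299c000000000000000000000000000015f62200000000000000000000000000007d429d00000000000000000000000000006e0d7a400000000000000000000000000002e8268000000000000000000000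000000501f625000000000000000000000000000202fa378000000000000000000000000004c84388c00000000000000000000000000503f725600000000000000000000000000237081340000000000000000000000000011f602b6000000000000000000000000002c89ade2000000000000000000000000006c893ce2400000000000000000000000004c0d7a0670000000000000000000000000141fc55030000000000000000000000000202d837b880000000000000000000000004bc0990c8200000000000000000000000033628134810000000000000000000000005a309340c1800000000000000000000000141fe454150000000000000000000000001abb9bd0c18000000000000000000000005bd6999d82f0000000000000000000000001e046c9447800000000000000000000007cc23c3f3e20000000000000000000000040a616bf4e28000000000000000000000003f946c9447c00000000000000000000006d50dd2d367480000000000000000000006d50dd2db7fc400000000000000000000038124d590424e0000000000000000000004b40990487f06000000000000000000000143f6454170ff800000000000000000000157b2a10715e88000000000000000000003012c9582424f400000000000000000000589f32df4a27e400000000000000000000682c522d4829248000000000000000000071d610bcca5582400000000000000000006370930483dc68200000000000000000004e295e44b2ca717000000000000000000040a0369fc6a906a000000000000000000024c9ade23c02730800000000000000000031f602b64a5582e40000000000000000004c84389f7a030686000000000000000000581f3adf4a07e065800000000000000000656df162395b68c9c000000000000000004b409d4487f868162000000000000000002c892de22c22630aa00000000000000000212da36b894b68bcd000000000000000006e697a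44b28271722c000000000000000003e946cd54fa97a14000000000000000002549e162391a7b48da000000000000000038105c290c24f5082280000000000000003342813081d888181300000000000000005abb9bc0c18cea3031a00000000000000014f22292711f88a78910000000000000001afb2ad0c18ee82311a80000000000000071d6119dc2d5865d271c0000000000000001e046c9c478f7b1405e000000000000007c42183d3e30068a6f8c0000000000000048a012af4e2804e1e4020000000000000002e9268d46fb17a1c03e800000000000007d429d2d3674878a6f94000000000000004b219c44a7d869123cb21000000000000038120d290424e50a23c1000000000000004c82389f3a030686ec8c20000000000000252de1621d5b68f8fa52da0000000000002449e56239127b0adacc9e000000000000141fc5503425f5061941fc00000000000031d600bd4a5582dd4719600000000000004f291c44b7c879322cb2d5c0000000000015f62202781d80a5c91f622000000000007d519d2d3674958a7e950dd000000000004e0d7a44f28270732ce2d7a4000000000002e0268fc6ab07a5c42e82680000000000103f6054130ff9e48543f6050000000000202fa37b890b6cbdd202fa3780000000004c843887720300c7ec80c3a84000000000503f72560a07f0e5c543f72560000000006370832483dc683c16370832400000000015f622b2585d80e5c11f622920000000002c89ade23c02730aba8c9ad62000000000688938ea4c22660ba688938ea4000000004c0d3a84720300c7ecc0c3a8570000000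0141fc5503527fd441941fc050b00000000202da37b894b6cbcd202da37b8800000004bc0998d82f02e1034bc0910c8200000002372813483d8281c13362813481000000053309300c3cce839361309340838000000141fc450350ff9441941fc4501100000001abb8ad0c18caa3111abb9ac0c180000005bd6919dc2f5865c27bd6919dc2d00000001e146c9447cd7b1407e146c94478000006cc218bf3a20068e6f8ca183f3a200000040a0369fce2904f1c40a2369fce280000013eb46c9447857a1417e946c94478000006d50dd2d3674959a7e950dd2d3674800006d50dd2db774bd9a7ed50dd2db67400000381249592424f40a03c12cd592424e00004b40990487f06e1234b409c0487f060000143f6454171ff9c41141f6454150ff8000157a2a10715e88a78913a2a10711f880001413c9502424f50e1b613cd582425f4000509f305f4a27e645a50bf32de4a27e60006824122f4e2904a16682412af4e280480071d611bdc255865d671d611bdc2d5824006330930083fce83936330930583dc682004f295e44b3ca71322ce295c44b3c87130042a0268fc6ab07a1c42e0268fceaa07a002449ed6238027b0ada0c9ed62b8127b08031d602970a5582f4431d602b31a5582d404c84389f7a030087ec884389f7a8102860589f2adf4a07e4e5a581f32df4a07e2458256de162395a78c8da56de162395a68c8c4b409d0487f06e1234b401c44a7f06c122,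
   0x20000000000000000000000000000000004000000000000000000000000000000000200000000000000000000000000000000000000000000000000000000000000000000200000000000000000000000000000000020000000000000000000000000000000000c0000000000000000000000000000000000000000000000000000000000000000002000000000000000000000000000000000480000000000000000000000000000000000d0000000000000000000000000000000200000000000000000000000000000000000000000000000000000000000000000000200000000000000000000000000000000000200000000000000000000000000000080018000000000000000000000000000000c0000000000000000000000000000000400091000000000000000000000000000000054000000000000000000000000000000100000000000000000000000000000000110200000000000000000000000000000028001820000000000000000000000000000080048000000000000000000000000000020004000000000000000000000000000028000820000000000000000000000000001002200200000000000000000000000000400010000000000000000000000000000000200000000000000000000000000000000000810020000000000000000000000000030000098000000000000000000000000040003006000000000000000000000000000080048044000000000000000000000000040002807000000000000000000000000000182002080000000000000000000000002002003208000000000000000000000000400010220a00000000000000000000000020040020080000000000000000000000000400020060000000000000000000000000021000008080000000000000000000000002004000008000000000000000000000001140000000500000000000000000000000100200008080000000000000000000000000040040000100000000000000000000000004000000018000000000000000000000000d2004000200000000000000000000000480028070000000000000000000000000680010220800000000000000000000000000048104000100000000000000000000000009200402020000000000000000000000200089202000000000000000000000000000c104c0040053000000000000000000000820080001080000000000000000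00000010020032080080000000000000000000000140000900100280000000000000000000114200000050601000000000000000000000200001010808a000000000000000000048001000010808000000000000000000000200040084a00110000000000000000000240081203000000a00000000000000000000000209402004200000000000000000000480008070000200400000000000000000002080001108088050000000000000000000800480442004010000000000000000000100000900500280400000000000000000000000108005001400000000000000000000200209000004a100000000000000000000090040000000000000000000000000000019204208060000800000000000000000200400300801000c0200000000000000000004810402000040100000000000000000200481000001004c0200000000000000000820080020080022008000000000000000021000000084000001200000000000000002084400008011000060000000000000000140404000506200001c000000000000000102001080000014000000000000000000020540000000104000600000000000000004c0008010000280400c00000000000000000d4040000210400000900000000000000200040084a00110002000000000000000000002094020040100000000000000000000200209000800a00002000000000000004000200602020040840002000000000000480018000108080020800180000000000000c0000000100280400c000000000000004000900403000840140009000000000000000440400001004000604000000000000001400009005004804010000000000000001102000000502010011020000000000000680018220800000022800102000000000000800480442003000008004800000000000300000884e00410002000008000000000280009200000000a22800092000000000010022012080080008100220120000000004000900403000800340001004000000000002000000108088040020000100000000004008100300008005800081002000000000300000980e00410003000008800000000400030060200000084000300608000000000800480442000010008004804400000000400020070000023080000a8060000000010002002180680008001820020800000002002003208010004010020032080000000400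030060a000000a400030060a0000000200401200001004c02004013000000000000200a0020000023080200a00200000000121000008080200001010000080800000002008400848011000020044000480000001142000000506200011404000005000000001000008080a01000000000080800000000040040000100400060400000001000000004000000014044000040000000180000000920040002014000009200400020000004800080700000010808002807000000004800102208000000a400010220a00000000004810402010048100c481040000000000008200402020040800082004020200000280009a02000000a02800092020000000000c144c000107300000c14440001073000080008000008002200820080021080000010020032080000048100200320801800000040000104100280401c00001001002800114200100050201001102000000502010000200209010800a0000200001010800a0048001800010808002480010000108080000200040084a00410002000400846004100240091202000000a1a00089202000000a000000209402004210000002090000042100480008070000001480800080500002000]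

/-- The matching for 9 colours. -/
def partners9 : ℕ :=
  0x5073542654f5e043a095759208412441e692a49022d77482a29283b2631245f2b6d0f750e3f771b3c1e3c393803164a2a3019600e722e573609500714652b0340115382742535015f1b802718717c7b4a792a77101f490519174b6f7870350d73756f67666516590c74606708727e7d383728842a6e0e005d720e16493950634a736f86462f44

/-- Four planes serve for nine and ten colours; here the classes 9 to 15 are empty. -/
theorem excess_9 : excess 135 9 planes9 = 0 := by decide +kernel

theorem packedMatching_9 : PackedMatching 135 partners9 := by decide +kernel

theorem crossCount_9 : crossCount 135 xsMany ysMany planes9 = 2 * 78269 := by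
  decide +kernel

theorem totalWeight_9 : totalWeight 135 9 xsMany ysMany planes9 partners9 = 423577 := by
  decide +kernel

/-- The bit planes of the colouring with 10 colours. -/
def planes10 : List ℕ :=
  [0x4000000000000000000000000000000000600000000000000000000000000000000030000000000000000000000000000000000800000000000000000000000000000000480000000000000000000000000000000046000000000000000000000000000000007b000000000000000000000000000000006e80000000000000000000000000000000170000000000000000000000000000000011e0000000000000000000000000000000652000000000000000000000000000000047780000000000000000000000000000001a30000000000000000000000000000000672c0000000000000000000000000000005222000000000000000000000000000000443d0000000000000000000000000000006d6440000000000000000000000000000037c6c00000000000000000000000000000248b20000000000000000000000000000079d2180000000000000000000000000000055bc800000000000000000000000000007aab9600000000000000000000000000007b509d00000000000000000000000000006706a700000000000000000000000000004cd9fdc0000000000000000000000000001a3b8f4000000000000000000000000000360fe910000000000000000000000000002074c530000000000000000000000000000dd4ed8000000000000000000000000000062ee11400000000000000000000000000096fa859000000000000000000000000003dd29da000000000000000000000000000092d6aeb400000000000000000000000004c697a4b400000000000000000000000000dc9fda060000000000000000000000000798399f24800000000000000000000000023ddc565040000000000000000000000000724220f920000000000000000000000004bef9bd9010000000000000000000000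0046ad26c6e7800000000000000000000000718f99f1ac40000000000000000000000046bd36a6fe800000000000000000000000171ee20db3c0000000000000000000000070f656b64e2800000000000000000000006d6d486bb9f800000000000000000000001339284da3fe000000000000000000000070b257b04e2d00000000000000000000007606a736d78100000000000000000000005286e59f438900000000000000000000007c74f22f1a36e0000000000000000000004624221f93c960000000000000000000003c0fe939b10398000000000000000000006bd03a26cef4000000000000000000000079523a2e5a74e4000000000000000000004524b3063f5868000000000000000000004379f04faada7780000000000000000000155bc950b15d9b80000000000000000000092d2a5d877b4c60000000000000000000788b1ecd4622e7200000000000000000001b3b8a4d87efec3000000000000000000025ad2aeb6c6304740000000000000000003dd29df03054fb0a0000000000000000000d54cc0939597bd20000000000000000004c2092461b6868b080000000000000000036c2f5b2fcb097894000000000000000004222137fcba86cb5c00000000000000000096d6aeb497b14a3e0000000000000000073cde5e005d7fbc850000000000000000078cb1fcd4626f7092400000000000000007a329799442ce52d320000000000000000268a26bafca2071dcb0000000000000000441d702f3b0f3100ac000000000000000059c681d44359e84d35000000000000000046bd36a6feab03b38c20000000000000006b501ba2cef4860ba6b0000000000000006e9036a6da841369a6a800000000000000157fc110b1df9a9659500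000000000000030f646b64e199325855e000000000000006d654869b8f9147e0ed2000000000000004339604da3feec128c73800000000000001a338f5dc4ace52130a300000000000000672ea370b6e3047e0e52e000000000000072a392ffcea064a1352230000000000000647c722f3a0ef460ac47c00000000000004d544c4bb9597bd278d44400000000000036c2d5a25cb093c8fb7c2c00000000000024892ebbfc63043f8a88f200000000000079821df24a54e08fa79d398000000000003dd38d503154db9e1b9d3c8000000000007a8b16fd4ea0e42927aa316000000000006fd09da06cd4e10b3fbd09d00000000000660ea734f6e3017ddf20ea70000000000058c9fde44636d70b268d99dc00000000001a3b8f4d84adec3311a3b8e400000000003c0fe919b18b1d5e1bc0ee9300000000002154c575035d7bdc527d5c5700000000000dd0fda034563bc278dd8fd800000000004626f116b3ab3ec69c42ee91c000000000096daa5d817b4c76d192f2a5d0000000007fd29da07c54e30b3bbd09da000000000009ad2aeb6c7304f5a0d2d2aeb40000000048697a4b411a59a1e48697a4b0000000000dd8fda2347693c2f8dd9fd80600000000798b9df22875c29e3799399f2e8000000063ddc5e50515fbcc527ddc5651400000000704620db3cb2cf0d872c220d92000000009ef99d901596e54309ef9859010000000032d2e46e7eb0ef7c402d2e46e78000000798b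99f0a845821e3f98f99f3ac400000066bc36a6fe8613e1ac2bc36a6de8000000173fe01db1d798d45973ee015b0c00000070f256b04e2d112d074f656b24e28000006d65486bb95b5d560ed65486bbbd80000013392a4da7feec3219b39284da7ee0000070b217b04c2db52d272b2d7b8462d000006606a634f68309fddf206a734d2e3000007206e597c78139cdd760ee7b5c383000007c52322f5a36e569a7970362e5a36e00004220321fd3a96cb5c4226225f93cb600003d8f8979a0031b1e3b88fd971a4c7980006b501a26cef40469a69d03b264ef40400079523ab64a74e409a79523fee5e14e40004524b307375b68e3dc124b7063b5a28000037d704fe3db74b28c379784fa3da74800155fc150b15f9b965915fc950b1dd98800012d2a46e7eb4c67c092d2a5ca7eb4c6007a8b16cd4620e72925a8b17ed4e24e72001a3b8e4d87aeec3211a398e4d84ecec300258d2efbec6304778a0ad2ebbcc63067403dd28dd03154fb9b1b9c38df03054fb9a00dd4cc0335547bd2f8dd4fc0131507bd204d24b2063b6868f0fc020b2461b6868f081ec235b2fca01789cb2c2e5bafcb2970dc4222335fcba96cb5c4226225fdba964b5c,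
   0x60000000000000000000000000000000005000000000000000000000000000000000500000000000000000000000000000000058000000000000000000000000000000000c00000000000000000000000000000000660000000000000000000000000000000025000000000000000000000000000000002400000000000000000000000000000000040000000000000000000000000000000010f00000000000000000000000000000003d480000000000000000000000000000006a0c00000000000000000000000000000012fe00000000000000000000000000000030060000000000000000000000000000002f6d80000000000000000000000000000010b24000000000000000000000000000005a92000000000000000000000000000000495640000000000000000000000000000047e090000000000000000000000000000020096c000000000000000000000000000030864000000000000000000000000000004e09b5000000000000000000000000000002dc22800000000000000000000000000010768700000000000000000000000000007a06b9200000000000000000000000000022a08b8000000000000000000000000000175204000000000000000000000000000011328710000000000000000000000000000282838800000000000000000000000000480b3c1d000000000000000000000000000809bd4b0000000000000000000000000041f456050000000000000000000000000017f2448400000000000000000000000000116687100000000000000000000000000067a012a2f800000000000000000000000056d20414b40000000000000000000000002424e7221c000000000000000000000000588b5cdd060000000000000000000000000c047c02340000000000000000000000006fa01aa1d9c000000000000000000000000c444c663c000000000000000000000000240867323c200000000000000000000000761930663a00000000000000000000000010bb42d0c18c000000000000000000000079009962a9500000000000000000000000761f31663a86000000000000000000000003dd22824053000000000000000000000001cd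20d2c053000000000000000000000007642b04b3da00000000000000000000002404e7321c2110000000000000000000002aa00ba9c088000000000000000000000066c9006dbea264000000000000000000004760a306f3d8080000000000000000000007808189f5f00e00000000000000000000394b49602116fb0000000000000000000020096c6b2d2a1d0000000000000000000048087c190423358000000000000000000030a6c19901299e600000000000000000007b02b92289c0681800000000000000000049745609005513740000000000000000000809ad4b05227d8000000000000000000011b28690414cf93500000000000000000006808489d5e00a1100000000000000000013860895c6e184578000000000000000002006c6334c0111cdc0000000000000000041f45404075d93a040000000000000000056821490b484831628000000000000000030e6c199012d8e6c1000000000000000006a1db1361a86004cb6000000000000000003564a18c0f314572100000000000000002f4de900b1db085a1a80000000000000005e9244dd5624f7816d40000000000000000c444c663c317182a8c00000000000000066893149b6a266884e200000000000000025494c643a52714a0e50000000000000002429642b3d2a1d0a8a4000000000000000241920663a0680428d200000000000000010b342d0c08cf271014f000000000000003903d9f22951681e3bd0000000000000007a0eb9338a828048b6a0c000000000000012fc22c0c097e261014fc0000000000000308645bb490919cd0340600000000000000f6cab04b1da085a9ab6c800000000000011b246d0c14cf935110b240000000000005b861c90e4e1801601286000000000000049545219c051176524556500000000000047e092a2fb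d808b1fc3e010000000000000809ac6b0d225d02d08096c0000000000030a6c1b949099d4c13486c0000000000005a09b54b14a26588f4a09b50000000000003dd22c040972261801dd228000000000010668310053d8e6c114f683000000000007a06b9328a82281ab7a06b9200000000002aa00b89c08006bb42aa08ba00000000001e520400b2949300292d2440000000000011768730455da92511136871000000000002808389e0a00623582808b8800000000048097c1906233586e4c0a7c190000000004a09bd4b04226580f0a09b54b00000000041745609025513f4045f4560500000000013f2448407fc9fc0417d2448440000000011768730457d88251117687100000000006fa012a2d9d80ab16c3a012a2d8000000056d20494b48483122d2d20414a400000002404e7223c231168ca42ce7221c0000000588b5cdd8620178465c8b5c1d0600000004c047c0234237586e0e047c023400000006fa012a0d9c80eb966ba012a3d9c0000002c454c663e1071c208d454c663c0000000242965223c2215088a428652a3c2000000761d30663a0680488f21930663a000000010b342d0c14efb31014b342d0c1cc0000079009922a941681ebf9049962a9c000000761f31661a86a048ae21db1261a020000003dd238040d72265803dd228040130000001dd20c240534255803cd22d04053400000760ab06f3da087398360ab06f3da000002004e7325c0111ecd2406e7321c23100002ba00aa9d18806b922aa01ba1d1c8000006609306db6a264ca4e2c9016d36a2640004660b386fbd8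08b39c360a286fbd80800007808588f4f00f92183808588e4f00f000394bc9706955f82a3bd4bd9602954f80002409646b2d2a1d0a8a0096c6b2d2a1d00048047c0224233596e4c0c7c1824233580030a6c19901299e4c114a6c1b9490d8e4007806b9228981681eb7a04b9228ac328180495442198055177524d745a19a051117400809ac6b0d227d02d0809ac4b0c227d02011328690455df935111328690414df935007808489f5e80e11582808489d4e00f11013065894c6f1045705f06089cc6e1845702006e6324c0111edd2406e7335c0119cdc,
   0x100000000000000000000000000000000068000000000000000000000000000000006c0000000000000000000000000000000068000000000000000000000000000000002c00000000000000000000000000000000120000000000000000000000000000000013c00000000000000000000000000000002bd80000000000000000000000000000005318000000000000000000000000000000134600000000000000000000000000000004e0000000000000000000000000000000780b00000000000000000000000000000003c640000000000000000000000000000001c040000000000000000000000000000001e44000000000000000000000000000006c0db800000000000000000000000000006c0098000000000000000000000000000004e04600000000000000000000000000006c04b90000000000000000000000000000135740000000000000000000000000000001e4468000000000000000000000000000535b7040000000000000000000000000006c209b200000000000000000000000000012c244880000000000000000000000000003c44698000000000000000000000000006c209b2200000000000000000000000000500f7076000000000000000000000000006c20b9270000000000000000000000000004e0868940000000000000000000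00000004a087896000000000000000000000000003c446a9d00000000000000000000000006c0cb9263800000000000000000000000011c24498c400000000000000000000000004a08f8974000000000000000000000000101f20560a000000000000000000000000780f38760a0000000000000000000000006420b9263b000000000000000000000000680f39760a0000000000000000000000002c008b9975200000000000000000000000121f00508080000000000000000000000013c6649084d000000000000000000000007bd934e28cd60000000000000000000000121b0054808500000000000000000000001356405080d580000000000000000000001356005080d58000000000000000000000680b39762a03000000000000000000000004a08f89742800000000000000000000006c209b263b0808000000000000000000006c4db9663a0300000000000000000000006c0db9762a0300000000000000000000002ca08ba971280e000000000000000000002bd96ce2cef273000000000000000000006c20992939080c80000000000000000000700f30760a03e04000000000000000000001e44689457817c0000000000000000000535b346288d6f31000000000000000000000e0468955381fa00000000000000000006c20892f330808aa00000000000000000003c64490c4f1175500000000000000000024a08ba9710808ab00000000000000000001e446884471177500000000000000000004e08689742817a340000000000000000004a0878975280fa150000000000000000041c24699c470171500000000000000000001e44689447817e1400000000000000000131b605482c6f01404000000000000000009e44689447917e1000000000000000000780b79660a02c04aa78000000000000000121f20520887e044810000000000000000680f39760a03600ca780000000000000006c0db9263b0308cefe8000000000000000680db9662a03624ebe8000000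0000000002c20896979280cab7a8000000000000000121710508085e00401200000000000000013ce449084d19354017c000000000000002b593ce28cd6f210a2bd80000000000000531b705082d6f0108531800000000000001357445080d59354017d6000000000000004e0468975381fa1480e00000000000000780bb9760a02004ea780b800000000000003c64490c4f11755007c6400000000000001c44699c4711735005e4400000000000001e44e8945381fe1405e040000000000006c0db9263b03084abe80cb8000000000006c009b2b3b080c8a7e800980000000000005e0468955381fe1405e046000000000007c04b9263b0a08cafe804b9000000000001356401080d5f05401756400000000000001e44689447117f1405e44680000000000535b704282d6f311a535b70400000000006c209b263b0808aafe8209b2000000000013c2448cc4f09751015c2448800000000003c44689c4f11775007c446980000000002c208b20790808ab7a8209b22000000000500f30760a07e044a400f30760000000006c24b9263b0808cafe800b92700000000000e0c68955281fa1500e0468940000000000a087896d280eab500a0878960000000003c44689c4f11775007c44699d000000006c24b9263b0a084abe81cb92638000000011c24498c4b01751015c24698c4000000004808b89752804ab4a8208f89740000000501f20568a07e0448521f20560a0000000780f30760a03604ca780f30760a00000006c24b9263b0a08cabe820b9263b0000000680db9760a03604ea680fb9762a00000002c208b0971200cab5a8208ba9742000000121b00548085e01401217005480800000013c6449084f3135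4017c64490c4f0000005bd9146288c6f310a53d9346288d600000121b40548287e0140061b005480c5000001356415080d5f05401756405080d5800001356001080d5e05401356005080d5c0000680db9762a03004ebe80fb9762a030000004a08789742807a3580a08f897428000006c20b9263b0888eabe820b9263b08080006c0db9263a0388cebe84db9263a03080006d0db9663a03084ebe80db9362a03080002ca08ba979280e2b7a8a08ba975280e0002bd96ce28cf27318a2fd964e6ccf2730002c00992939280cab7a820992939080c800780f30760a03e054a700f30760a03e040001e0668955781fe1405e04689553807e00535b304288d6f310a535970428ad6f310000e0468955381fa1405e04e8955381fa006c009b2b3b0808aafe810992f3908088a003c44498c4f11755007c64698c4f11755024a08ba971080cab1a8a08ba971080eab001e4468944701755005e44689447917f1004a08689742807a3580e0868974281fa34,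
   0x40000000000000000000000000000000000000000000000000000000000000000000000000000000000000000000000000000008000000000000000000000000000000000400000000000000000000000000000000000000000000000000000000000000000001000000000000000000000000000000000280000000000000000000000000000000120000000000000000000000000000000068a0000000000000000000000000000000200000000000000000000000000000000040000000000000000000000000000000000420000000000000000000000000000000200000000000000000000000000000000000190000000000000000000000000000000090000000000000000000000000000000240980000000000000000000000000000024040000000000000000000000000000001600100000000000000000000000000000100200000000000000000000000000000012300000000000000000000000000000000019a000000000000000000000000000000150400000000000000000000000000000002085000000000000000000000000000060093000000000000000000000000000000420040000000000000000000000000000014d24000000000000000000000000000068009930000000000000000000000000002409086000000000000000000000000000014c24000000000000000000000000000005e002800000000000000000000000000003504000800000000000000000000000001a0228128000000000000000000000000048043012800000000000000000000000002c1008402000000000000000000000000000430059000000000000000000000000002804192100000000000000000000000000121b005000000000000000000000000000066002007100000000000000000000000001c0028940000000000000000000000000004d00580000000000000000000000000001800089c0e0000000000000000000000012330040808000000000000000000000000820cb004108000000000000000000000024008129102000000000000000000000000400400c122000000000000000000000000820ca0001080000000000000000000000002085000d0800000000000000000000000020460009084000000000000000000000108080804004e000000000000000000000121b00440186e0000000000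00000000000014d2000047300000000000000000000000100448040401000000000000000000000108204810000e200000000000000000000404074120801110000000000000000000044009019100104000000000000000000001210020080c4e00000000000000000000005e0028070500220000000000000000000401920660a06000000000000000000000004044004362804c0000000000000000000120208168a8080000000000000000000000350500088d40210000000000000000000240901693000008a00000000000000000049405002081015008000000000000000004c10102030040080400000000000000000101921440106e8000000000000000000001a02281288820054a0000000000000000028140824020100c8400000000000000000401930660a02000084000000000000000004200c0025080902080000000000000000540010043a0480004c000000000000000000b00290400422a540000000000000000000601a002108082200800000000000000001800089c0400451400000000000000000014044800050111000500000000000000002900089c4a00490402000000000000000121202008084e0100120000000000000004820cb004108082932c2000000000000002000a12b11220c089200000000000000004484000c122004c00400000000000000000420040435080902084200000000000000200081020d280c089200000000000000000019a0440206c000900190000000000000008000804005f2a1400900000000000000240981293000008aca009800000000000024100024120400c06c8100000000000000120200062a84801209a00000000000000010020059040062040100300000000000000330400080c4a230006300000000000000001920460206000084019200000000000001504000c0501210005d04000000000000002085020d280908100208500000000000601930060a020000a4009300000000000004000404352800c0084000400000000000014d2400047300400014c2400000000000600499310001000e168049930000000000240908403000408a4a8010860000000000414034020652015084148240000000000005e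0028070580221091e002800000000000150400080d41210005d040008000000001a02281688808000a1a022812800000000480c301280030014a400c30128000000002c0108403000608a4a8000862200000000004b005904014404000430459000000000280419210241008c028041921100000000123b00508084e804112130050000000000046002007118002308160028071000000001c0028940500231001c0028940000000000490059003100040004f045800000000003800089c0e00410400800089c0e00000012120050808ce0100121300508180000000820cb000108192230c20cb000108000002408a129300004089a008a12910000000004044004163804c000400400c16200000008208e0021081922118204800210800000002084020d0809001002085020928000000020c6000d081920104204402090800000108204800004e2804108000810004e0000121b00440106e8000121900400104e0000004d0040047300044014d00580033000000180448040501311005004480c04010000108204190000e2004108200410000e200040427012020210048444270120a03100000400100912000404040040019120104000123002008084e01001610020080c4e000005c0028950500221081e00281501002200001900660a06000086019204602021000004004404362804c0084000404352804c00120218060a8080028120200060a848000003304000c0c40211007204080c2c400300240901613000008a4a00909613002008a04840700208101100a454070020810100084c100020380480a0680101000300400004101901440106e8000121900400106e0000]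

/-- The matching for 10 colours. -/
def partners10 : ℕ :=
  0x7429356543723c183a09385914362a4432692a010217775c56652824611f7f5f7e418275101d7781800e181c13694a4a783f32605d0d2e0b2109508514652d0384115365216935861e815c225c71167b7a797b770c592f451e4d415c1103350d612648677e65644276056067080c7e605775282878835400193b54025839234b4a49481d466544

theorem excess_10 : excess 135 10 planes10 = 0 := by decide +kernel

theorem packedMatching_10 : PackedMatching 135 partners10 := by decide +kernel

theorem crossCount_10 : crossCount 135 xsMany ysMany planes10 = 2 * 60922 := by
  decide +kernel

theorem totalWeight_10 : totalWeight 135 10 xsMany ysMany planes10 partners10 = 379922 := by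
  decide +kernel

end ColoredCrossing

/-! ### The nine rows of the table -/

theorem mainTheorem3 (k N : ℕ) (b : ℝ)
    (hrow : (k, N, b) ∈
      ([(2, 1468394, 0.11731413),
        (3, 732746, 0.06062466),
        (4, 413342, 0.03572151),
        (5, 264459, 0.02389326),
        (6, 183248, 0.01726050),
        (7, 133405, 0.01314080),
        (8, 99638, 0.01028335),
        (9, 78269, 0.00845339),
        (10, 60922, 0.00692671)] : List (ℕ × ℕ × ℝ))) :
    ∃ L l : ℝ, ∃ C : ColoredCrossing.Config (Fin 135) k,
      ColoredCrossing.IsCrossingConstant k L ∧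
      ColoredCrossing.InGeneralPosition C.pts ∧
      ColoredCrossing.monoCr C.pts C.col = N ∧
      ColoredCrossing.IsMatching C.mat ∧
      C.HasDoublingLimit l ∧
      C.IsOptimal l ∧
      L ≤ l ∧ l < b ∧
      (k = 2 → l < 0.11798016) ∧
      2.74 * l < 2 / (k : ℝ) ^ 2 - 1 / (k : ℝ) ^ 3 := by
  -- The comparisons with the earlier bounds are verified for the tabulated `b` and pass to `l`
  -- through `l < b`. What remains in each row is rational arithmetic with `N` and the weight `W`.
  have row : ∀ {W xs ys ms : ℕ} {planes : List ℕ}, 0 < k → k ≤ 2 ^ planes.length →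
      ColoredCrossing.degeneracy 135 xs ys = 0 → ColoredCrossing.excess 135 k planes = 0 →
      ColoredCrossing.PackedMatching 135 ms →
      ColoredCrossing.crossCount 135 xs ys planes = 2 * N →
      ColoredCrossing.totalWeight 135 k xs ys planes ms = W →
      24 * (N + ((W : ℝ) / 12 + 4 * (135 : ℕ) / 21)) / ((135 : ℕ) : ℝ) ^ 4 < b →
      (k = 2 → b ≤ 0.11798016) → 2.74 * b ≤ 2 / (k : ℝ) ^ 2 - 1 / (k : ℝ) ^ 3 →
      ∃ L l : ℝ, ∃ C : ColoredCrossing.Config (Fin 135) k,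
        ColoredCrossing.IsCrossingConstant k L ∧
        ColoredCrossing.InGeneralPosition C.pts ∧
        ColoredCrossing.monoCr C.pts C.col = N ∧
        ColoredCrossing.IsMatching C.mat ∧
        C.HasDoublingLimit l ∧
        C.IsOptimal l ∧
        L ≤ l ∧ l < b ∧
        (k = 2 → l < 0.11798016) ∧
        2.74 * l < 2 / (k : ℝ) ^ 2 - 1 / (k : ℝ) ^ 3 := by
    intro W xs ys ms planes hk hkl hg he hm hN hW hb h2 h3
    obtain ⟨L, l, C, hL, hP, hcr, hM, hl, hopt, hLl, hlb⟩ :=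
      ColoredCrossing.exists_optimal_of_packed (by norm_num) (by norm_num) hk hkl hg he hm hN hW hb
    exact ⟨L, l, C, hL, hP, hcr, hM, hl, hopt, hLl, hlb, fun h => hlb.trans_le (h2 h),
      by linarith⟩
  simp only [List.mem_cons, Prod.mk.injEq, List.not_mem_nil, or_false] at hrow
  rcases hrow with ⟨rfl, rfl, rfl⟩ | ⟨rfl, rfl, rfl⟩ | ⟨rfl, rfl, rfl⟩ | ⟨rfl, rfl, rfl⟩ |
    ⟨rfl, rfl, rfl⟩ | ⟨rfl, rfl, rfl⟩ | ⟨rfl, rfl, rfl⟩ | ⟨rfl, rfl, rfl⟩ | ⟨rfl, rfl, rfl⟩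
  · exact row (planes := ColoredCrossing.planes2) (by norm_num)
      -- The exponent, here and in the other rows, is the number of bit planes.
      (show 2 ≤ 2 ^ 1 by norm_num) ColoredCrossing.degeneracy_two
      ColoredCrossing.excess_2 ColoredCrossing.packedMatching_2 ColoredCrossing.crossCount_2
      ColoredCrossing.totalWeight_2 (by norm_num) (by norm_num) (by norm_num)
  · exact row (planes := ColoredCrossing.planes3) (by norm_num)
      (show 3 ≤ 2 ^ 2 by norm_num) ColoredCrossing.degeneracy_many
      ColoredCrossing.excess_3 ColoredCrossing.packedMatching_3 ColoredCrossing.crossCount_3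
      ColoredCrossing.totalWeight_3 (by norm_num) (by norm_num) (by norm_num)
  · exact row (planes := ColoredCrossing.planes4) (by norm_num)
      (show 4 ≤ 2 ^ 2 by norm_num) ColoredCrossing.degeneracy_many
      ColoredCrossing.excess_4 ColoredCrossing.packedMatching_4 ColoredCrossing.crossCount_4
      ColoredCrossing.totalWeight_4 (by norm_num) (by norm_num) (by norm_num)
  · exact row (planes := ColoredCrossing.planes5) (by norm_num)
      (show 5 ≤ 2 ^ 3 by norm_num) ColoredCrossing.degeneracy_many
      ColoredCrossing.excess_5 ColoredCrossing.packedMatching_5 ColoredCrossing.crossCount_5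
      ColoredCrossing.totalWeight_5 (by norm_num) (by norm_num) (by norm_num)
  · exact row (planes := ColoredCrossing.planes6) (by norm_num)
      (show 6 ≤ 2 ^ 3 by norm_num) ColoredCrossing.degeneracy_many
      ColoredCrossing.excess_6 ColoredCrossing.packedMatching_6 ColoredCrossing.crossCount_6
      ColoredCrossing.totalWeight_6 (by norm_num) (by norm_num) (by norm_num)
  · exact row (planes := ColoredCrossing.planes7) (by norm_num)
      (show 7 ≤ 2 ^ 3 by norm_num) ColoredCrossing.degeneracy_many
      ColoredCrossing.excess_7 ColoredCrossing.packedMatching_7 ColoredCrossing.crossCount_7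
      ColoredCrossing.totalWeight_7 (by norm_num) (by norm_num) (by norm_num)
  · exact row (planes := ColoredCrossing.planes8) (by norm_num)
      (show 8 ≤ 2 ^ 3 by norm_num) ColoredCrossing.degeneracy_many
      ColoredCrossing.excess_8 ColoredCrossing.packedMatching_8 ColoredCrossing.crossCount_8
      ColoredCrossing.totalWeight_8 (by norm_num) (by norm_num) (by norm_num)
  · exact row (planes := ColoredCrossing.planes9) (by norm_num)
      (show 9 ≤ 2 ^ 4 by norm_num) ColoredCrossing.degeneracy_many
      ColoredCrossing.excess_9 ColoredCrossing.packedMatching_9 ColoredCrossing.crossCount_9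
      ColoredCrossing.totalWeight_9 (by norm_num) (by norm_num) (by norm_num)
  · exact row (planes := ColoredCrossing.planes10) (by norm_num)
      (show 10 ≤ 2 ^ 4 by norm_num) ColoredCrossing.degeneracy_many
      ColoredCrossing.excess_10 ColoredCrossing.packedMatching_10 ColoredCrossing.crossCount_10
      ColoredCrossing.totalWeight_10 (by norm_num) (by norm_num) (by norm_num)
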